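/- Let $k$ be an algebraically closed field of characteristic zero, $C$ an integral smooth quasi-projective curve over $k$ with function field $K$, and $\mathcal A$ a hereditary $\mathcal O_C$-order. That is, $\mathcal A$ is a coherent torsion-free sheaf of $\mathcal O_C$-algebras whose generic stalk $D=\mathcal A\otimes_{\mathcal O_C} K$ is a central simple $K$-algebra, and every stalk $\mathcal A_p$ is a hereditary ring. An overorder of $\mathcal A$ is an $\mathcal O_C$-order $\mathcal B$ with $\mathcal A\subseteq\mathcal B\subseteq D$; it is maximal if it has no proper overorder. The ramification locus $\Delta$ is the complement of the largest open subset of $C$ on which $\mathcal A$ is Azumaya. Then $\Delta$ is finite, and for every $p\in\Delta$ there are an integer $r_p$, positive integers $n_1,\dots,n_{r_p}$ with sum $n$, and an isomorphism of $\mathcal O_{C,p}$-algebras $\varphi_p$ from $\mathcal A_p$ onto the algebra of those $n\times n$ block matrices over $\mathcal O_{C,p}$, with blocks of size $n_i\times n_j$, whose blocks strictly below the diagonal have all entries in the maximal ideal. Fix any such data for each $p\in\Delta$ and let $L_p^{(j)}=e_j\mathcal A_p$ and ${}'L_p^{(j)}=\mathcal A_pe_j$ for $1\le j\le r_p$, where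 $e_j\in\mathcal A_p$ corresponds under $\varphi_p$ to the diagonal matrix unit $E_{\alpha,\alpha}$ with $\alpha=n_1+\dots+n_j$. An overorder $\mathcal B$ is called purely of type $j$ at $p$ as a right (left) module if $\mathcal B_p$ is isomorphic to a direct sum of finitely many, and at least one, copies of $L_p^{(j)}$ as a right $\mathcal A_p$-module (of ${}'L_p^{(j)}$ as a left $\mathcal A_p$-module). Then $r_p>1$ for all $p\in\Delta$, and: (i) $\mathcal A$ has precisely $\prod_{p\in\Delta} r_p$ maximal overorders. (ii) Every maximal overorder $\mathcal B$ of $\mathcal A$ is locally projective as a left and as a right $\mathcal A$-module: $C$ is covered by affine open subsets $U$ such that $\mathcal B(U)$ is a finitely generated projective left (right) $\mathcal A(U)$-module. (iii) For every maximal overorder $\mathcal B$ and every $p\in\Delta$ there is exactly one $j$ such that $\mathcal B$ is purely of type $j$ at $p$ as a right module, and exactly one $j$ such that it is so as a left module. If two maximal overorders have the same type as right modules at every $p\in\Delta$, then they are equal. -/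

import Mathlib

universe u v

open AlgebraicGeometry CategoryTheory MulOpposite

noncomputable section

namespace HereditaryOrder

section Rings

/-- A ring is hereditary if all its left ideals and all its right ideals are projective. -/
def IsHereditaryRing (S : Type v) [Ring S] : Prop :=
  (∀ I : Submodule S S, Module.Projective S I) ∧
    ∀ I : Submodule Sᵐᵒᵖ S, Module.Projective Sᵐᵒᵖ I

variable {S T : Type v} [Ring S] [Ring T]

/-- `T` as a left `S`-module along a ring homomorphism `S → T`. -/
abbrev leftModule (φ : S →+* T) : Module S T := Module.compHom T φ

/-- `T` as a right `S`-module along a ring homomorphism `S → T`. -/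
abbrev rightModule (φ : S →+* T) : Module Sᵐᵒᵖ T := Module.compHom T (RingHom.op φ)

/-- `T` is a finitely generated projective left `S`-module. -/
def IsLeftFGProjective (φ : S →+* T) : Prop :=
  letI := leftModule φ
  Module.Finite S T ∧ Module.Projective S T

/-- `T` is a finitely generated projective right `S`-module. -/
def IsRightFGProjective (φ : S →+* T) : Prop :=
  letI := rightModule φ
  Module.Finite Sᵐᵒᵖ T ∧ Module.Projective Sᵐᵒᵖ T

/-- The right `S`-module `T` is isomorphic to `L ^ k` for some `k > 0`, where `L` is a right
ideal of `S`. -/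
def IsRightPower (φ : S →+* T) (L : Submodule Sᵐᵒᵖ S) : Prop :=
  letI := rightModule φ
  ∃ k : ℕ, 0 < k ∧ Nonempty (T ≃ₗ[Sᵐᵒᵖ] (Fin k → L))

/-- The left `S`-module `T` is isomorphic to `L ^ k` for some `k > 0`, where `L` is a left
ideal of `S`. -/
def IsLeftPower (φ : S →+* T) (L : Submodule S S) : Prop :=
  letI := leftModule φ
  ∃ k : ℕ, 0 < k ∧ Nonempty (T ≃ₗ[S] (Fin k → L))

end Rings

section Standard

variable (R : Type u) [CommRing R] [IsLocalRing R] {r : ℕ} (n : Fin r → ℕ)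

/-- The standard block order in `Mat_n(R)`, with `n = n₁ + ⋯ + n_r`: block matrices whose blocks
strictly below the diagonal have entries in the maximal ideal. Row `(i, s)` is the `s`-th row of
the `i`-th block. -/
def blockOrder : Subalgebra R (Matrix (Σ i, Fin (n i)) (Σ i, Fin (n i)) R) where
  carrier := {M | ∀ a b, b.1 < a.1 → M a b ∈ IsLocalRing.maximalIdeal R}
  mul_mem' {M N} hM hN a b hab := by
    rw [Matrix.mul_apply]
    refine Ideal.sum_mem _ fun c _ => ?_
    rcases lt_or_ge c.1 a.1 with h | h
    · exact Ideal.mul_mem_right _ _ (hM a c h)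
    · exact Ideal.mul_mem_left _ _ (hN c b (hab.trans_le h))
  add_mem' {M N} hM hN a b hab := Ideal.add_mem _ (hM a b hab) (hN a b hab)
  algebraMap_mem' x a b hab := by
    have : a ≠ b := fun h => by simp [h] at hab
    simp [Matrix.algebraMap_matrix_apply, this]

variable {n}

/-- The elementary matrix `E_{α,α}`, where `α = n₁ + ⋯ + n_j` is the last index of the `j`-th
block. -/
def blockIdempotent (hn : ∀ i, 0 < n i) (j : Fin r) : blockOrder R n :=
  ⟨Matrix.single ⟨j, n j - 1, Nat.sub_lt (hn j) one_pos⟩ ⟨j, n j - 1, Nat.sub_lt (hn j) one_pos⟩ 1,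
    fun a b hab => by
      rw [Matrix.single_apply, if_neg]
      · exact Ideal.zero_mem _
      · rintro ⟨rfl, rfl⟩
        exact lt_irrefl _ hab⟩

end Standard

section Sheaves

variable (X : Scheme.{u}) [IsIntegral X] (D : Type v) [Ring D] [Algebra X.functionField D]

/-- An algebra over the function field is an algebra over the sections on any nonempty open. -/
instance (priority := 50) sectionsAlgebra (U : X.Opens) [Nonempty U] : Algebra Γ(X, U) D :=
  Algebra.compHom D (algebraMap Γ(X, U) X.functionField)

/-- An algebra over the function field is an algebra over every local ring. -/
instance (priority := 50) stalkAlgebra (p : X) : Algebra (X.presheaf.stalk p) D :=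
  Algebra.compHom D (algebraMap (X.presheaf.stalk p) X.functionField)

/-- An `𝒪_X`-order in the `K(X)`-algebra `D`: a coherent sheaf of `𝒪_X`-subalgebras of the
constant sheaf `D` whose generic stalk is `D`. (A torsion-free coherent sheaf of algebras is a
subsheaf of the constant sheaf given by its generic stalk.) As `X` is irreducible, sections of
the constant sheaf over a nonempty open set are just elements of `D`. -/
@[ext]
structure OrderIn where
  /-- The sections over a nonempty open set. -/
  sections : ∀ (U : X.Opens) [Nonempty U], Subalgebra Γ(X, U) D
  /-- Restriction. -/
  restrict : ∀ (U V : X.Opens) [Nonempty U] [Nonempty V], U ≤ V →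
    ∀ x ∈ sections V, x ∈ sections U
  /-- Being a section is a local condition. -/
  local_mem : ∀ (V : X.Opens) [Nonempty V] (x : D),
    (∀ p ∈ V, ∃ (U : X.Opens) (_ : Nonempty U), p ∈ U ∧ U ≤ V ∧ x ∈ sections U) →
      x ∈ sections V
  /-- Quasi-coherence: sections over `D(f) ⊆ U` are the localization at `f` of those over `U`. -/
  quasiCoherent : ∀ (U : X.Opens) [Nonempty U], IsAffineOpen U →
    ∀ (f : Γ(X, U)) [Nonempty (X.basicOpen f)], ∀ x ∈ sections (X.basicOpen f),
      ∃ m : ℕ, f ^ m • x ∈ sections U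
  /-- Finite type. -/
  finite : ∀ (U : X.Opens) [Nonempty U], IsAffineOpen U → (sections U).toSubmodule.FG
  /-- The generic stalk is `D`. -/
  generic : ∀ x : D, ∃ (U : X.Opens) (_ : Nonempty U), x ∈ sections U

variable {X D}

namespace OrderIn

/-- Inclusion of subsheaves of `D`. -/
instance : PartialOrder (OrderIn X D) where
  le A B := ∀ (U : X.Opens) [Nonempty U], A.sections U ≤ B.sections U
  le_refl _ _ _ := le_rfl
  le_trans _ _ _ h h' U _ := (h U).trans (h' U)
  le_antisymm A B h h' := by
    ext U hU x
    exact ⟨fun hx => h U hx, fun hx => h' U hx⟩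

/-- The stalk at `p`, i.e. the union of the sections over the open neighbourhoods of `p`. -/
def stalk (A : OrderIn X D) (p : X) : Subalgebra (X.presheaf.stalk p) D where
  carrier := {x | ∃ (U : X.Opens) (_ : Nonempty U), p ∈ U ∧ x ∈ A.sections U}
  mul_mem' := by
    rintro x y ⟨U, hU, hpU, hx⟩ ⟨V, hV, hpV, hy⟩
    have : Nonempty (U ⊓ V : X.Opens) := ⟨⟨p, hpU, hpV⟩⟩
    exact ⟨U ⊓ V, this, ⟨hpU, hpV⟩,
      mul_mem (A.restrict _ U inf_le_left _ hx) (A.restrict _ V inf_le_right _ hy)⟩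
  add_mem' := by
    rintro x y ⟨U, hU, hpU, hx⟩ ⟨V, hV, hpV, hy⟩
    have : Nonempty (U ⊓ V : X.Opens) := ⟨⟨p, hpU, hpV⟩⟩
    exact ⟨U ⊓ V, this, ⟨hpU, hpV⟩,
      add_mem (A.restrict _ U inf_le_left _ hx) (A.restrict _ V inf_le_right _ hy)⟩
  algebraMap_mem' := by
    intro s
    obtain ⟨U, hpU, t, rfl⟩ := X.presheaf.exists_germ_eq s
    have : Nonempty U := ⟨⟨p, hpU⟩⟩
    refine ⟨U, this, hpU, ?_⟩
    have h : algebraMap (X.presheaf.stalk p) D (X.presheaf.germ U p hpU t) =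
        algebraMap Γ(X, U) D t := by
      change algebraMap X.functionField D (algebraMap (X.presheaf.stalk p) X.functionField _) =
        algebraMap X.functionField D (algebraMap Γ(X, U) X.functionField t)
      rw [Scheme.algebraMap_germ_eq_germToFunctionField]
      rfl
    rw [h]
    exact (A.sections U).algebraMap_mem t

theorem stalk_mono {A B : OrderIn X D} (h : A ≤ B) (p : X) : A.stalk p ≤ B.stalk p := by
  rintro x ⟨U, hU, hp, hx⟩
  exact ⟨U, hU, hp, h U hx⟩

/-- The order is hereditary: all its stalks are hereditary rings. -/
def IsHereditary (A : OrderIn X D) : Prop := ∀ p : X, IsHereditaryRing (A.stalk p)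

/-- The ramification locus: the complement of the largest open subset on which the order is
Azumaya. -/
def ramificationLocus (A : OrderIn X D) : Set X :=
  {p | ¬ ∃ U : X.Opens, p ∈ U ∧ ∀ q ∈ U, IsAzumaya (X.presheaf.stalk q) (A.stalk q)}

/-- The maximal overorders of `A`: orders in `D` that contain `A` and have no proper overorder. -/
def maximalOverorders (A : OrderIn X D) : Set (OrderIn X D) :=
  {B | A ≤ B ∧ ∀ B' : OrderIn X D, B ≤ B' → B' = B}

/-- The inclusion of sections over `U`. -/
def sectionsHom {A B : OrderIn X D} (h : A ≤ B) (U : X.Opens) [Nonempty U] :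
    A.sections U →+* B.sections U :=
  (Subalgebra.inclusion (h U) : A.sections U →ₐ[Γ(X, U)] B.sections U)

/-- The inclusion of stalks at `p`. -/
def stalkHom {A B : OrderIn X D} (h : A ≤ B) (p : X) : A.stalk p →+* B.stalk p :=
  (Subalgebra.inclusion (stalk_mono h p) : A.stalk p →ₐ[X.presheaf.stalk p] B.stalk p)

/-- The overorder `B` is a locally projective left `A`-module: `X` is covered by affine opens `U`
such that `B(U)` is a finitely generated projective left `A(U)`-module. -/
def IsLeftLocallyProjective {A B : OrderIn X D} (h : A ≤ B) : Prop :=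
  ∀ p : X, ∃ (U : X.Opens) (_ : Nonempty U), p ∈ U ∧ IsAffineOpen U ∧
    IsLeftFGProjective (sectionsHom h U)

/-- The overorder `B` is a locally projective right `A`-module. -/
def IsRightLocallyProjective {A B : OrderIn X D} (h : A ≤ B) : Prop :=
  ∀ p : X, ∃ (U : X.Opens) (_ : Nonempty U), p ∈ U ∧ IsAffineOpen U ∧
    IsRightFGProjective (sectionsHom h U)

/-- Ramification data `(n₁, …, n_r)` of `A` at `p`, together with an isomorphism of
`𝒪_{X,p}`-algebras from the stalk to the standard block order. -/
structure RamificationData (A : OrderIn X D) (p : X) where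
  /-- The number of blocks; this is the ramification index if it is at least two. -/
  r : ℕ
  /-- The sizes of the blocks. -/
  n : Fin r → ℕ
  n_pos : ∀ i, 0 < n i
  /-- The isomorphism. -/
  equiv : A.stalk p ≃ₐ[X.presheaf.stalk p] blockOrder (X.presheaf.stalk p) n

namespace RamificationData

variable {A : OrderIn X D} {p : X} (d : A.RamificationData p)

/-- The idempotent of the stalk that corresponds to `E_{α,α}`, with `α` the last index of the
`j`-th block. -/
def idempotent (j : Fin d.r) : A.stalk p :=
  d.equiv.symm (blockIdempotent (X.presheaf.stalk p) d.n_pos j)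

/-- The indecomposable projective right module `E_{α,α} A_p` (a row). -/
def row (j : Fin d.r) : Submodule (A.stalk p)ᵐᵒᵖ (A.stalk p) :=
  Submodule.span _ {d.idempotent j}

/-- The indecomposable projective left module `A_p E_{α,α}` (a column). -/
def column (j : Fin d.r) : Submodule (A.stalk p) (A.stalk p) :=
  Submodule.span _ {d.idempotent j}

/-- The overorder `B`, as a right `A`-module, is purely of type `j` at `p`. -/
def IsPurelyOfType {B : OrderIn X D} (h : A ≤ B) (j : Fin d.r) : Prop :=
  IsRightPower (stalkHom h p) (d.row j)

/-- The overorder `B`, as a left `A`-module, is purely of type `j` at `p`. -/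
def IsLeftPurelyOfType {B : OrderIn X D} (h : A ≤ B) (j : Fin d.r) : Prop :=
  IsLeftPower (stalkHom h p) (d.column j)

end RamificationData

end OrderIn

end Sheaves

end HereditaryOrder

end

/-! The problem is local. A section of an order is an element of `D` lying in the stalk at every
point of the open set. Since nonempty open sets have finite complement, an element of `D` lies in
almost all stalks, and an overorder of `A` can be prescribed at finitely many points
(`exists_stalk_eq`). Hence maximal overorders are families of local maximal overorders, and it
remains to show that a stalk has exactly `r` of them at a ramified point and is itself maximal
elsewhere.

The curve is locally étale over the affine line, so its function field is finite over `k(X)` and its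
local rings at non-generic points are discrete valuation rings. By Tsen's theorem `D` is a matrix
algebra (`exists_algEquiv_matrix`). Its matrix units lie in almost all stalks, which are therefore
Azumaya, and the ramification locus is finite.

Let `A` now be a hereditary order in `End V` over a discrete valuation ring `R`. A lattice of `A` in
`V` embeds into `A` as a left ideal, so it is projective, and `A`-linear maps from lattices to `V`
are scalars. Splitting `L × M → L + M` then shows that any two lattices are comparable
(`lattice_total`). Moreover `A` consists of all endomorphisms preserving its lattices
(`mem_of_forall_lattice`). Up to scaling the nonzero lattices lie between `𝔪 L₀` and `L₀`, where
they form a flag; a basis adapted to this flag puts `A` into block form (`exists_equiv_blockOrder`).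

For an order `B` containing a block order, a column of `B` through the first block is one of `r`
explicit lattices, and `B` preserves it. So `B` lies in one of `r` endomorphism rings of lattices
(`exists_le_diagOrder`), which are pairwise incomparable. All columns of the `j`-th ring are scalar
multiples of a column of `A` in block `j`, and all its rows are multiples of a row of `A` in the
cyclically next block; this gives the types. Two-sided ideals (`blockIdeal`) separate different
types, and also show that an Azumaya block order has one block.

Local projectivity holds for every overorder: a dual basis of the stalk extends to an affine
neighbourhood. -/

open AlgebraicGeometry CategoryTheory MulOpposite

noncomputable section

namespace HereditaryOrder

/-! ### Tsen's theorem -/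

section Tsen

open Polynomial

/-- All the maximal ideals at rational points of affine space have the same height. -/
theorem height_vanishingIdeal_singleton {k σ : Type*} [Field k] (x y : σ → k) :
    (MvPolynomial.vanishingIdeal k {x}).height = (MvPolynomial.vanishingIdeal k {y}).height := by
  let t (z : σ → k) : MvPolynomial σ k →ₐ[k] MvPolynomial σ k :=
    MvPolynomial.aeval fun i => MvPolynomial.X i + MvPolynomial.C (z i)
  let e : MvPolynomial σ k ≃ₐ[k] MvPolynomial σ k :=
    AlgEquiv.ofAlgHom (t (x - y)) (t (y - x)) (by ext1; simp [t]; ring) (by ext1; simp [t]; ring)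
  rw [← RingEquiv.height_comap e.toRingEquiv (MvPolynomial.vanishingIdeal k {y})]
  congr 1
  ext p
  have h : (MvPolynomial.aeval y).comp (t (x - y)) = MvPolynomial.aeval (R := k) x := by
    ext; simp [t]
  simp only [Ideal.mem_comap, MvPolynomial.mem_vanishingIdeal_singleton_iff]
  rw [← h]
  rfl

/-- The dimension of the polynomial ring is bounded by the heights of its maximal ideals. These are
rational points by the Nullstellensatz, and translation makes their heights equal. -/
theorem card_le_height_vanishingIdeal_singleton {k σ : Type*} [Field k] [IsAlgClosed k]
    [Fintype σ] (x : σ → k) :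
    (Fintype.card σ : ℕ∞) ≤ (MvPolynomial.vanishingIdeal k {x}).height := by
  have h1 := ringKrullDim_add_natCard_le_ringKrullDim_mvPolynomial (R := k) σ
  have h2 : ringKrullDim (MvPolynomial σ k) ≤ (MvPolynomial.vanishingIdeal k {x}).height := by
    rw [ringKrullDim_le_iff_isMaximal_height_le]
    intro m hm
    obtain ⟨y, rfl⟩ := MvPolynomial.eq_vanishingIdeal_singleton_of_isMaximal k hm
    rw [height_vanishingIdeal_singleton x y]
  have h3 := h1.trans h2
  rw [ringKrullDim_eq_zero_of_field, zero_add, Nat.card_eq_fintype_card] at h3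
  exact_mod_cast h3

/-- Over an algebraically closed field, fewer polynomials than variables which vanish at the
origin have another common zero. -/
theorem exists_ne_zero_common_zero {k σ τ : Type*} [Field k] [IsAlgClosed k] [Fintype σ]
    [Fintype τ] (h : Fintype.card τ < Fintype.card σ) (f : τ → MvPolynomial σ k)
    (hf : ∀ j, MvPolynomial.aeval (0 : σ → k) (f j) = 0) :
    ∃ x : σ → k, x ≠ 0 ∧ ∀ j, MvPolynomial.aeval x (f j) = 0 := by
  classical
  by_contra! hne
  let I := Ideal.span ((Finset.univ.image f : Finset _) : Set (MvPolynomial σ k))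
  have hz : MvPolynomial.zeroLocus k I = {0} := by
    rw [MvPolynomial.zeroLocus_span]
    ext x
    simp only [Finset.coe_image, Finset.coe_univ, Set.image_univ, Set.forall_mem_range,
      Set.mem_ofPred_eq, Set.mem_singleton_iff]
    refine ⟨fun hx => ?_, ?_⟩
    · by_contra h0
      obtain ⟨j, hj⟩ := hne x h0
      exact hj (hx j)
    · rintro rfl
      exact hf
  have hr := MvPolynomial.vanishingIdeal_zeroLocus_eq_radical (K := k) I
  rw [hz] at hr
  -- If the origin is the only zero, its ideal is the radical of `I`, hence a minimal prime over
  -- `I`, and Krull's height theorem bounds its height by the number of generators.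
  have hmin : MvPolynomial.vanishingIdeal k {(0 : σ → k)} ∈ I.minimalPrimes := by
    rw [← Ideal.radical_minimalPrimes, ← hr, Ideal.minimalPrimes_eq_subsingleton_self]
    rfl
  have h1 := Ideal.height_le_card_of_mem_minimalPrimes_span_finset hmin
  have h2 := (card_le_height_vanishingIdeal_singleton (0 : σ → k)).trans h1
  have h3 : (Finset.univ.image f).card ≤ Fintype.card τ := Finset.card_image_le
  have h4 : Fintype.card σ ≤ (Finset.univ.image f).card := by exact_mod_cast h2
  omega

/-- In a noncommutative finite-dimensional division algebra every norm is a proper power. -/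
theorem exists_norm_eq_pow {F D : Type*} [Field F] [DivisionRing D] [Algebra F D]
    [FiniteDimensional F D] (hD : ∃ x y : D, x * y ≠ y * x) (y : D) :
    ∃ (c : F) (e : ℕ), 2 ≤ e ∧ Algebra.norm F y = c ^ e := by
  -- The norm from `D` is the norm from the field `L = F[y]` raised to the power `[D : L]`. This
  -- degree exceeds one because `L` is commutative and `D` is not.
  let L := Algebra.adjoin F {y}
  have hL := Algebra.isMulCommutative_adjoin F (s := {y}) (by simp)
  let _ : CommRing L := { (inferInstance : Ring L) with mul_comm := hL.is_comm.comm }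
  have : IsDomain L := inferInstance
  have hfd : FiniteDimensional F L := inferInstance
  let _ : Field L := (isField_of_isIntegral_of_isField' (R := F) (S := L) (Field.toIsField F)).toField
  let y' : L := ⟨y, Algebra.self_mem_adjoin_singleton F y⟩
  have : IsScalarTower F L D := inferInstance
  have : FiniteDimensional L D := Module.Finite.of_restrictScalars_finite F L D
  refine ⟨Algebra.norm F y', Module.finrank L D, ?_, ?_⟩
  · by_contra! hlt
    have hpos : 0 < Module.finrank L D := Module.finrank_pos
    have h1 : Module.finrank L D = 1 := by omega
    have hL : ∀ x : D, x ∈ L := by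
      obtain h := (finrank_eq_one_iff_of_nonzero' (1 : D) one_ne_zero).1 h1
      intro x
      obtain ⟨c, hc⟩ := h x
      rw [← hc]
      change (c : D) * 1 ∈ L
      rw [mul_one]
      exact c.2
    obtain ⟨a, b, hab⟩ := hD
    have := mul_comm (⟨a, hL a⟩ : L) ⟨b, hL b⟩
    exact hab (congrArg Subtype.val this)
  · have h := LinearMap.det_restrictScalars (R := F) (S := L) (A := D)
      (f := y' • LinearMap.id)
    rw [LinearMap.det_smul, LinearMap.det_id, mul_one, map_pow] at h
    rw [← h, Algebra.norm_apply]
    rfl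

theorem natDegree_det_le {R ι : Type*} [CommRing R] [Fintype ι] [DecidableEq ι]
    (M : Matrix ι ι R[X]) (c : ℕ) (hM : ∀ a b, (M a b).natDegree ≤ c) :
    M.det.natDegree ≤ Fintype.card ι * c := by
  rw [Matrix.det_apply]
  refine natDegree_sum_le_of_forall_le _ _ fun s _ => ?_
  refine (natDegree_smul_le _ _).trans ((natDegree_prod_le _ _).trans ?_)
  exact (Finset.sum_le_card_nsmul _ _ c fun i _ => hM _ _).trans (by simp)

/-- Tsen's theorem: over the rational function field of an algebraically closed field, there is
no noncommutative finite-dimensional division algebra. -/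
theorem mul_comm_of_finiteDimensional_ratFunc {k F D : Type*} [Field k] [IsAlgClosed k] [Field F]
    [Algebra k[X] F] [IsFractionRing k[X] F] [DivisionRing D] [Algebra F D]
    [FiniteDimensional F D] (x y : D) : x * y = y * x := by
  classical
  by_contra hxy
  obtain ⟨d, ⟨b⟩⟩ : ∃ d, Nonempty (Module.Basis (Fin d) F D) := ⟨_, ⟨Module.finBasis F D⟩⟩
  have : Nonempty (Fin d) := b.index_nonempty
  have hd : 0 < d := Fin.pos_iff_nonempty.2 b.index_nonempty
  -- Denominators of the structure constants are cleared by `g`, so that the norm of `g • ∑ z i • b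
  -- i` becomes the determinant of a polynomial matrix.
  obtain ⟨g, hg⟩ := IsLocalization.exist_integer_multiples_of_finite (nonZeroDivisors k[X])
    (fun q : Fin d × Fin d × Fin d => Algebra.leftMulMatrix b (b q.1) q.2.1 q.2.2)
  choose G hG using hg
  have hg0 : algebraMap k[X] F g ≠ 0 := by
    simp
  let c : ℕ := Finset.univ.sup fun q => (G q).natDegree
  have hc (q) : (G q).natDegree ≤ c :=
    Finset.le_sup (f := fun q => (G q).natDegree) (Finset.mem_univ q)
  let mat (z : Fin d → k[X]) : Matrix (Fin d) (Fin d) k[X] :=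
    Matrix.of fun a a' => ∑ i, z i * G (i, a, a')
  have hmat (z : Fin d → k[X]) : algebraMap k[X] F (mat z).det =
      Algebra.norm F (algebraMap k[X] F g • ∑ i, algebraMap k[X] F (z i) • b i) := by
    rw [Algebra.norm_eq_matrix_det b, RingHom.map_det]
    congr 1
    ext a a'
    simp only [mat, RingHom.mapMatrix_apply, Matrix.map_apply, Matrix.of_apply, map_sum, map_mul,
      hG, map_smul, Matrix.smul_apply, Matrix.sum_apply, smul_eq_mul, Finset.mul_sum]
    exact Finset.sum_congr rfl fun i _ => by rw [Algebra.smul_def]; ring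
  have hdeg (z : Fin d → k[X]) (hz : ∀ i, (z i).natDegree ≤ c + 1) :
      (mat z).det.natDegree ≤ d * (2 * c + 1) := by
    refine (natDegree_det_le _ (2 * c + 1) fun a a' => ?_).trans (by simp)
    simp only [mat, Matrix.of_apply]
    refine natDegree_sum_le_of_forall_le _ _ fun j _ => natDegree_mul_le.trans ?_
    have := hz j
    have := hc (j, a, a')
    omega
  -- Polynomials `z i` of degree at most `c + 1` have `d * (c + 2)` coefficients altogether, more
  -- than the `s` conditions that the determinant vanish at `s` given points. The determinant is a
  -- proper power `q ^ e`, so it has at least `2 * s` roots with multiplicity, one multiple of `d`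
  -- more than its degree bound `d * (2 * c + 1)` allows.
  let s := d * (c + 1)
  let pt : Fin s ↪ k := (Fin.valEmbedding).trans (Infinite.natEmbedding k)
  let u (w : Fin d × Fin (c + 2) → k) (i : Fin d) : k[X] := ∑ l, C (w (i, l)) * X ^ (l : ℕ)
  let f (j : Fin s) : MvPolynomial (Fin d × Fin (c + 2)) k :=
    (Matrix.of fun a a' => ∑ i, (∑ l : Fin (c + 2), MvPolynomial.X (i, l) *
      MvPolynomial.C (pt j ^ (l : ℕ))) * MvPolynomial.C ((G (i, a, a')).eval (pt j))).det
  have hf (w j) : MvPolynomial.aeval w (f j) = (mat (u w)).det.eval (pt j) := by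
    rw [← coe_evalRingHom, RingHom.map_det, AlgHom.map_det]
    congr 1
    ext a a'
    simp [mat, u, eval_finsetSum]
  obtain ⟨w, hw0, hw⟩ := exists_ne_zero_common_zero (by simp [s]; nlinarith) f (by
    intro j
    have h0 : u 0 = 0 := by ext1 i; simp [u]
    have h1 : mat 0 = 0 := by ext a a'; simp [mat]
    rw [hf, h0, h1, Matrix.det_zero, eval_zero])
  have hcoeff (i : Fin d) (l : Fin (c + 2)) : (u w i).coeff l = w (i, l) := by
    simp only [u, finsetSum_coeff, coeff_C_mul, coeff_X_pow]
    rw [Finset.sum_eq_single l] <;> simp +contextual [Fin.val_inj, eq_comm]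
  have hu0 : u w ≠ 0 := by
    intro h
    apply hw0
    ext ⟨i, l⟩
    rw [← hcoeff, h]
    simp
  have hudeg (i) : (u w i).natDegree ≤ c + 1 := by
    refine natDegree_sum_le_of_forall_le _ _ fun l _ => (natDegree_C_mul_X_pow_le _ _).trans ?_
    omega
  have hy0 : algebraMap k[X] F g • ∑ i, algebraMap k[X] F (u w i) • b i ≠ 0 := by
    refine smul_ne_zero hg0 fun h => hu0 ?_
    ext1 i
    have := Fintype.linearIndependent_iff.1 b.linearIndependent _ h i
    simpa using this
  have hP0 : (mat (u w)).det ≠ 0 := by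
    intro h
    have h1 := hmat (u w)
    rw [h, map_zero] at h1
    have h2 := (IsUnit.mk0 _ hy0).map (Algebra.norm F)
    rw [← h1] at h2
    exact not_isUnit_zero h2
  obtain ⟨r, e, he, hr⟩ := exists_norm_eq_pow (F := F) ⟨x, y, hxy⟩
    (algebraMap k[X] F g • ∑ i, algebraMap k[X] F (u w i) • b i)
  rw [← hmat] at hr
  obtain ⟨q, rfl⟩ : ∃ q, algebraMap k[X] F q = r :=
    IsIntegrallyClosed.exists_algebraMap_eq_of_isIntegral_pow (n := e) (by omega)
      (hr ▸ isIntegral_algebraMap)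
  rw [← map_pow] at hr
  have hPq : (mat (u w)).det = q ^ e := IsFractionRing.injective k[X] F hr
  have hq0 : q ≠ 0 := by
    rintro rfl
    rw [zero_pow (by omega)] at hPq
    exact hP0 hPq
  have hroots : s ≤ q.natDegree := by
    have : (Finset.univ.map pt).val ⊆ q.roots := by
      intro a ha
      obtain ⟨j, -, rfl⟩ := Finset.mem_map.1 (show a ∈ Finset.univ.map pt from ha)
      rw [mem_roots hq0, IsRoot.def]
      have := hw j
      rw [hf, hPq, eval_pow] at this
      exact pow_eq_zero_iff (by omega) |>.1 this
    have := card_le_degree_of_subset_roots this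
    simpa using this
  have h1 := hdeg (u w) hudeg
  rw [hPq, natDegree_pow] at h1
  have h2 : 2 * s ≤ e * q.natDegree := Nat.mul_le_mul he hroots
  have : 2 * s = d * (2 * c + 1) + d := by simp only [s]; ring
  omega

/-- A central simple algebra over a finite extension of the rational function field of an
algebraically closed field is a matrix algebra. -/
theorem exists_algEquiv_matrix {k F K : Type*} {E : Type v} [Field k] [IsAlgClosed k] [Field F]
    [Algebra k[X] F] [IsFractionRing k[X] F] [Field K] [Algebra F K] [FiniteDimensional F K]
    [Ring E] [Algebra K E] [FiniteDimensional K E] [Algebra.IsCentral K E] [IsSimpleRing E] :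
    ∃ N : ℕ, N ≠ 0 ∧ Nonempty (E ≃ₐ[K] Matrix (Fin N) (Fin N) K) := by
  have : IsArtinianRing E := IsArtinianRing.of_finite K E
  obtain ⟨n, hn, D, _, _, _, ⟨e⟩⟩ := IsSimpleRing.exists_algEquiv_matrix_divisionRing_finite K E
  refine ⟨n, hn.ne, ⟨?_⟩⟩
  letI : Algebra F D := Algebra.compHom D (algebraMap F K)
  have : IsScalarTower F K D := IsScalarTower.of_algebraMap_eq fun _ => rfl
  have : FiniteDimensional F D := Module.Finite.trans K D
  have hcomm (x y : D) : x * y = y * x := mul_comm_of_finiteDimensional_ratFunc (k := k) (F := F) x y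
  have hcen : Algebra.IsCentral K (Matrix (Fin n) (Fin n) D) := Algebra.IsCentral.of_algEquiv K _ _ e
  -- Since `D` is commutative its scalar matrices are central, and the centre is only `K`.
  have hsurj : Function.Surjective (algebraMap K D) := by
    intro x
    have hx : Matrix.scalar (Fin n) x ∈ Subalgebra.center K (Matrix (Fin n) (Fin n) D) := by
      rw [Subalgebra.mem_center_iff]
      intro M
      ext a b
      simp [Matrix.diagonal_mul, Matrix.mul_diagonal, hcomm x]
    obtain ⟨c, hc⟩ := hcen.out hx
    have := congrFun₂ hc ⟨0, Nat.pos_of_ne_zero hn.ne⟩ ⟨0, Nat.pos_of_ne_zero hn.ne⟩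
    refine ⟨c, ?_⟩
    simpa [Matrix.algebraMap_matrix_apply] using this
  exact e.trans (AlgEquiv.mapMatrix
    (AlgEquiv.ofBijective (Algebra.ofId K D) ⟨(algebraMap K D).injective, hsurj⟩)).symm

end Tsen

/-! ### Smooth curves: local rings, function field and topology -/

section Curve

open Polynomial

/-- A Noetherian local domain that is unramified over a principal ideal domain is a discrete
valuation ring, unless it is a field. -/
theorem isDiscreteValuationRing_of_formallyUnramified {A S : Type*} [CommRing A] [IsDomain A]
    [IsPrincipalIdealRing A] [CommRing S] [IsDomain S] [IsLocalRing S] [IsNoetherianRing S]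
    [Algebra A S] [Algebra.FormallyUnramified A S] [Algebra.EssFiniteType A S]
    (hS : ¬ IsField S) : IsDiscreteValuationRing S := by
  let P := (IsLocalRing.maximalIdeal S).comap (algebraMap A S)
  let AP := Localization.AtPrime P
  have hu (y : P.primeCompl) : IsUnit (algebraMap A S y) := by
    by_contra h
    exact y.2 ((IsLocalRing.mem_maximalIdeal _).2 h)
  let φ : AP →+* S := IsLocalization.lift hu
  let _ : Algebra AP S := φ.toAlgebra
  have hφ (a : A) : algebraMap AP S (algebraMap A AP a) = algebraMap A S a :=
    IsLocalization.lift_eq hu a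
  have : IsScalarTower A AP S := IsScalarTower.of_algebraMap_eq fun a => (hφ a).symm
  have : IsLocalHom (algebraMap AP S) := by
    refine ⟨fun a ha => ?_⟩
    obtain ⟨x, s, rfl⟩ := IsLocalization.exists_mk'_eq P.primeCompl a
    rw [IsLocalization.AtPrime.isUnit_mk'_iff AP P]
    intro hx
    have h1 : algebraMap A S x ∈ IsLocalRing.maximalIdeal S := hx
    rw [← hφ, ← IsLocalization.mk'_spec AP x s, map_mul, hφ] at h1
    exact (IsLocalRing.mem_maximalIdeal _).1 h1 (ha.mul (hu s))
  have : Algebra.FormallyUnramified AP S := .of_restrictScalars A _ _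
  have : Algebra.EssFiniteType AP S := .of_comp A _ _
  -- Unramifiedness means that the maximal ideal of `A_P` generates that of `S`. So the latter is
  -- generated by the image of a generator of `P`.
  have h := Algebra.FormallyUnramified.map_maximalIdeal (R := AP) (S := S)
  rw [← Localization.AtPrime.map_eq_maximalIdeal, Ideal.map_map,
    ← IsScalarTower.algebraMap_eq] at h
  obtain ⟨⟨t, ht⟩⟩ := IsPrincipalIdealRing.principal P
  refine ((IsDiscreteValuationRing.TFAE S hS).out 0 4 rfl rfl).2 ⟨⟨algebraMap A S t, h.symm.trans ?_⟩⟩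
  rw [ht]
  exact (Ideal.map_span _ _).trans (by simp [Ideal.submodule_span_eq])

/-- Both finiteness and unramifiedness pass from `A` to its fraction field, and over a field they
imply finite dimension. -/
theorem finiteDimensional_fractionRing_of_formallyUnramified {A K : Type*} [CommRing A]
    [IsDomain A] [Field K] [Algebra A K] [Algebra.FormallyUnramified A K]
    [Algebra.EssFiniteType A K] (hinj : Function.Injective (algebraMap A K)) :
    ∃ _ : Algebra (FractionRing A) K, FiniteDimensional (FractionRing A) K := by
  have : FaithfulSMul A K := (faithfulSMul_iff_algebraMap_injective A K).2 hinj
  let _ := FractionRing.liftAlgebra A K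
  have : Algebra.FormallyUnramified (FractionRing A) K := .of_restrictScalars A _ _
  have : Algebra.EssFiniteType (FractionRing A) K := .of_comp A _ _
  exact ⟨inferInstance, Algebra.FormallyUnramified.finite_of_free _ _⟩

theorem injective_of_etale {A B : Type*} [CommRing A] [IsDomain A] [CommRing B] [IsDomain B]
    [Algebra A B] [Algebra.Etale A B] : Function.Injective (algebraMap A B) := by
  have : Module.Flat A B := inferInstance
  have : Module.IsTorsionFree A B := inferInstance
  exact FaithfulSMul.algebraMap_injective A B

variable {k : Type u} [Field k] {C : Scheme.{u}} (f : C ⟶ Spec (CommRingCat.of k))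

/-- A smooth curve is locally étale over the affine line. -/
theorem exists_etale_polynomial [SmoothOfRelativeDimension 1 f] (x : C) :
    ∃ (V : C.Opens) (_ : IsAffineOpen V) (_ : x ∈ V) (φ : k[X] →+* Γ(C, V)), φ.Etale := by
  obtain ⟨U, hU, V, hV, hx, e, hf⟩ :=
    SmoothOfRelativeDimension.exists_isStandardSmoothOfRelativeDimension (n := 1) (f := f) x
  obtain ⟨g, -, hg⟩ := hf.exists_etale_mvPolynomial
  -- The base is a single point.
  have hUtop : U = ⊤ := by
    have hxU : f x ∈ U := e hx
    ext y
    have hss : Subsingleton (PrimeSpectrum k) := inferInstance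
    have : y = f x := hss.elim (α := PrimeSpectrum k) _ _
    simp [this, hxU]
  subst hUtop
  let e₁ : k ≃+* Γ(Spec (CommRingCat.of k), ⊤) :=
    (Scheme.ΓSpecIso (CommRingCat.of k)).symm.commRingCatIsoToRingEquiv
  let e₂ : k[X] ≃+* MvPolynomial (Fin 1) Γ(Spec (CommRingCat.of k), ⊤) :=
    (Polynomial.mapEquiv e₁).trans (MvPolynomial.uniqueAlgEquiv _ (Fin 1)).symm.toRingEquiv
  exact ⟨V, hV, hx, g.comp e₂.toRingHom, RingHom.Etale.stableUnderComposition _ _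
    (RingHom.Etale.of_bijective e₂.bijective) hg⟩

theorem isLocallyNoetherian_of_smooth [SmoothOfRelativeDimension 1 f] : IsLocallyNoetherian C := by
  have := SmoothOfRelativeDimension.smooth 1 f
  exact LocallyOfFiniteType.isLocallyNoetherian f

variable [IsIntegral C]

theorem exists_finiteDimensional_functionField [SmoothOfRelativeDimension 1 f] :
    ∃ _ : Algebra (FractionRing k[X]) C.functionField,
      FiniteDimensional (FractionRing k[X]) C.functionField := by
  obtain ⟨V, hV, hx, φ, hφ⟩ := exists_etale_polynomial f (genericPoint C)
  have : Nonempty V := ⟨⟨_, hx⟩⟩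
  let _ : Algebra k[X] Γ(C, V) := φ.toAlgebra
  have : Algebra.Etale k[X] Γ(C, V) := hφ
  let _ : Algebra k[X] C.functionField := ((algebraMap Γ(C, V) C.functionField).comp φ).toAlgebra
  have : IsScalarTower k[X] Γ(C, V) C.functionField := IsScalarTower.of_algebraMap_eq' rfl
  have : IsFractionRing Γ(C, V) C.functionField := functionField_isFractionRing_of_isAffineOpen C V hV
  have : Algebra.FormallyUnramified Γ(C, V) C.functionField :=
    .of_isLocalization (nonZeroDivisors Γ(C, V))
  have : Algebra.FormallyUnramified k[X] C.functionField := .comp _ Γ(C, V) _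
  have : Algebra.EssFiniteType Γ(C, V) C.functionField :=
    .of_isLocalization _ (nonZeroDivisors Γ(C, V))
  have : Algebra.EssFiniteType k[X] C.functionField := .comp _ Γ(C, V) _
  refine finiteDimensional_fractionRing_of_formallyUnramified ?_
  exact (IsFractionRing.injective Γ(C, V) C.functionField).comp injective_of_etale

theorem genericPoint_mem (U : C.Opens) [h : Nonempty U] : genericPoint C ∈ U :=
  ((genericPoint_spec C).mem_open_set_iff U.isOpen).mpr (by simpa using h)

theorem primeIdealOf_ne_bot {U : C.Opens} (hU : IsAffineOpen U) {p : C} (hpU : p ∈ U)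
    (hp : p ≠ genericPoint C) : (hU.primeIdealOf ⟨p, hpU⟩).asIdeal ≠ ⊥ := by
  intro h
  have : Nonempty U := ⟨⟨p, hpU⟩⟩
  have h1 := hU.fromSpec_primeIdealOf ⟨p, hpU⟩
  have h2 := hU.fromSpec_primeIdealOf ⟨genericPoint C, genericPoint_mem U⟩
  rw [hU.primeIdealOf_genericPoint, genericPoint_eq_bot_of_affine] at h2
  have h3 : hU.primeIdealOf ⟨p, hpU⟩ = ⊥ := PrimeSpectrum.ext h
  rw [h3] at h1
  exact hp (h1.symm.trans h2)

/-- The local rings of a smooth curve at the points other than the generic point are discrete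
valuation rings. -/
theorem isDiscreteValuationRing_stalk [SmoothOfRelativeDimension 1 f] {p : C}
    (hp : p ≠ genericPoint C) : IsDiscreteValuationRing (C.presheaf.stalk p) := by
  obtain ⟨V, hV, hx, φ, hφ⟩ := exists_etale_polynomial f p
  have : Nonempty V := ⟨⟨_, hx⟩⟩
  have := isLocallyNoetherian_of_smooth f
  let _ : Algebra k[X] Γ(C, V) := φ.toAlgebra
  have : Algebra.Etale k[X] Γ(C, V) := hφ
  let _ : Algebra Γ(C, V) (C.presheaf.stalk p) := C.presheaf.algebra_section_stalk ⟨p, hx⟩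
  let q := (hV.primeIdealOf ⟨p, hx⟩).asIdeal
  have hloc : IsLocalization.AtPrime (C.presheaf.stalk p) q :=
    hV.isLocalization_stalk ⟨p, hx⟩
  let _ : Algebra k[X] (C.presheaf.stalk p) :=
    ((algebraMap Γ(C, V) (C.presheaf.stalk p)).comp φ).toAlgebra
  have : IsScalarTower k[X] Γ(C, V) (C.presheaf.stalk p) := IsScalarTower.of_algebraMap_eq' rfl
  have : Algebra.FormallyUnramified Γ(C, V) (C.presheaf.stalk p) :=
    .of_isLocalization q.primeCompl
  have : Algebra.FormallyUnramified k[X] (C.presheaf.stalk p) := .comp _ Γ(C, V) _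
  have : Algebra.EssFiniteType Γ(C, V) (C.presheaf.stalk p) := .of_isLocalization _ q.primeCompl
  have : Algebra.EssFiniteType k[X] (C.presheaf.stalk p) := .comp _ Γ(C, V) _
  refine isDiscreteValuationRing_of_formallyUnramified (A := k[X]) ?_
  exact IsLocalization.AtPrime.not_isField Γ(C, V) (primeIdealOf_ne_bot hV hx hp) _

/-- The points specializing to `q` come from the spectrum of the local ring at `q`. This is a
discrete valuation ring, with only a generic and a closed point. -/
theorem eq_of_specializes [SmoothOfRelativeDimension 1 f] {p q : C}
    (hp : p ≠ genericPoint C) (h : p ⤳ q) : p = q := by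
  have hq : q ≠ genericPoint C := by
    rintro rfl
    exact hp (h.antisymm (genericPoint_specializes p)).eq
  have := isDiscreteValuationRing_stalk f hq
  have hr := Scheme.range_fromSpecStalk (X := C) (x := q)
  obtain ⟨y, rfl⟩ : p ∈ Set.range (C.fromSpecStalk q) := hr ▸ h
  obtain ⟨z, hz⟩ : genericPoint C ∈ Set.range (C.fromSpecStalk q) :=
    hr ▸ genericPoint_specializes q
  by_cases hy : PrimeSpectrum.asIdeal y = ⊥
  · have h1 : y ⤳ z := (PrimeSpectrum.le_iff_specializes y z).1 
      (show PrimeSpectrum.asIdeal y ≤ PrimeSpectrum.asIdeal z from hy ▸ bot_le)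
    have h2 := h1.map (C.fromSpecStalk q).continuous
    rw [hz] at h2
    exact absurd (h2.antisymm (genericPoint_specializes _)).eq hp
  · have h1 : y = IsLocalRing.closedPoint (C.presheaf.stalk q) :=
      PrimeSpectrum.ext (IsLocalRing.eq_maximalIdeal (PrimeSpectrum.isPrime y |>.isMaximal hy))
    rw [h1, Scheme.fromSpecStalk_closedPoint]

theorem isClosed_singleton [SmoothOfRelativeDimension 1 f] {p : C} (hp : p ≠ genericPoint C) :
    IsClosed ({p} : Set C) := by
  rw [← closure_eq_iff_isClosed]
  ext q
  rw [← specializes_iff_mem_closure, Set.mem_singleton_iff]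
  exact ⟨fun h => (eq_of_specializes f hp h).symm, fun h => h ▸ specializes_rfl⟩

/-- A nonempty open subset of a curve has a finite complement. -/
theorem finite_compl [SmoothOfRelativeDimension 1 f] [QuasiCompact f] (U : C.Opens) [Nonempty U] :
    ((U : Set C)ᶜ).Finite := by
  have := isLocallyNoetherian_of_smooth f
  have : CompactSpace C := QuasiCompact.compactSpace_of_compactSpace f
  have : IsNoetherian C := {}
  obtain ⟨S, hS, hcl, hirr, hU⟩ :=
    TopologicalSpace.NoetherianSpace.exists_finite_set_isClosed_irreducible
      (isClosed_compl_iff.2 U.isOpen)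
  rw [hU]
  refine hS.sUnion fun t ht => ?_
  -- A component of the complement is the closure of its generic point, which differs from that of
  -- `C` and so is already closed.
  obtain ⟨x, hx⟩ := QuasiSober.sober (hirr t ht) (hcl t ht)
  have hxU : x ∉ U := by
    have : x ∈ (U : Set C)ᶜ := hU ▸ ⟨t, ht, hx.mem⟩
    exact this
  have hxg : x ≠ genericPoint C := by
    rintro rfl
    exact hxU (genericPoint_mem U)
  rw [← hx.def, (isClosed_singleton f hxg).closure_eq]
  exact Set.finite_singleton x

end Curve

/-! ### Bases adapted to a flag -/

section AdaptedBasis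

/-- A chain of subspaces of a finite-dimensional space has an adapted basis. -/
theorem exists_adapted_linearIndepOn {k W : Type*} [Field k] [AddCommGroup W] [Module k W]
    [FiniteDimensional k W] {𝓕 : Set (Submodule k W)} (h𝓕 : IsChain (· ≤ ·) 𝓕)
    (G : Submodule k W) :
    ∃ s : Set W, LinearIndepOn k id s ∧ Submodule.span k s = G ∧
      ∀ F ∈ 𝓕, F ≤ G → Submodule.span k (s ∩ F) = F := by
  induction h : Module.finrank k G using Nat.strong_induction_on generalizing G with
  | _ n ih =>
  by_cases hex : ∃ F ∈ 𝓕, F < G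
  · obtain ⟨H, ⟨hH, hHG⟩, hmax⟩ := WellFounded.has_min
      (wellFounded_gt (α := Submodule k W)) {F | F ∈ 𝓕 ∧ F < G} hex
    obtain ⟨s, hs, hsH, hsF⟩ := ih _ (h ▸ Submodule.finrank_lt_finrank_of_lt hHG) H rfl
    have hsG : s ⊆ G := fun x hx => hHG.le (hsH ▸ Submodule.subset_span hx)
    obtain ⟨t, hst, htG, hGt, ht⟩ :
        ∃ t, s ⊆ t ∧ t ⊆ (G : Set W) ∧ (G : Set W) ⊆ Submodule.span k t ∧ LinearIndepOn k id t := by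
      obtain ⟨t, h1, h2, h3, h4⟩ := exists_linearIndepOn_id_extension hs hsG
      exact ⟨t, h2, h1, h3, h4⟩
    have htH : t ∩ H = s := by
      refine subset_antisymm (fun x hx => ?_) fun x hx => ⟨hst hx, hsH ▸ Submodule.subset_span hx⟩
      by_contra hxs
      refine (ht.mono (Set.insert_subset hx.1 hst)).notMem_span_of_insert hxs ?_
      rw [Set.image_id, hsH]
      exact hx.2
    refine ⟨t, ht, le_antisymm (Submodule.span_le.2 htG) hGt, fun F hF hFG => ?_⟩
    rcases hFG.eq_or_lt with rfl | hlt
    · rw [Set.inter_eq_left.2 htG]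
      exact le_antisymm (Submodule.span_le.2 htG) hGt
    · have hFH : F ≤ H := by
        rcases h𝓕.total hF hH with h1 | h1
        · exact h1
        · rcases h1.eq_or_lt with rfl | h2
          · exact le_rfl
          · exact absurd h2 (hmax F ⟨hF, hlt⟩)
      have h1 := hsF F hF hFH
      rwa [← htH, Set.inter_assoc, Set.inter_eq_right.2 (SetLike.coe_subset_coe.2 hFH)] at h1
  · push Not at hex
    obtain ⟨t, h1, h2, h3⟩ := exists_linearIndependent k (G : Set W)
    rw [Submodule.span_eq] at h2
    refine ⟨t, h3, h2, fun F hF hFG => ?_⟩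
    rcases hFG.eq_or_lt with rfl | hlt
    · rw [Set.inter_eq_left.2 h1, h2]
    · exact absurd hlt (hex F hF)

variable {R : Type*} [CommRing R] [IsLocalRing R]

-- The members of the chain contain `𝔪 M`, so they are determined by their images over the residue
-- field. An adapted basis of the reduction lifts by Nakayama.
open TensorProduct in
theorem exists_adapted_basis {M : Type*} [AddCommGroup M] [Module R M] [Module.Finite R M]
    [Module.Free R M] {𝓕 : Set (Submodule R M)} (h𝓕 : IsChain (· ≤ ·) 𝓕)
    (hm : ∀ F ∈ 𝓕, ∀ x ∈ IsLocalRing.maximalIdeal R, ∀ m : M, x • m ∈ F) :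
    ∃ (n : ℕ) (b : Module.Basis (Fin n) R M), ∀ F ∈ 𝓕, ∀ m : M,
      m ∈ F ↔ ∀ a, b a ∉ F → b.repr m a ∈ IsLocalRing.maximalIdeal R := by
  let k := IsLocalRing.ResidueField R
  let q : M →ₗ[R] k ⊗[R] M := TensorProduct.mk R k M 1
  have hq : Function.Surjective q := TensorProduct.mk_surjective R M k IsLocalRing.residue_surjective
  have hker (m : M) (hqm : q m = 0) (F) (hF : F ∈ 𝓕) : m ∈ F := by
    let c := Module.Free.chooseBasis R M
    rw [← c.sum_repr m]
    refine Submodule.sum_mem _ fun i _ => hm F hF _ ?_ _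
    have := congrArg (fun w => (c.baseChange k).repr w i) hqm
    have h : algebraMap R k (c.repr m i) = 0 := by simpa [q, Algebra.smul_def] using this
    exact (IsLocalRing.residue_eq_zero_iff _).1 h
  let bar (F : Submodule R M) : Submodule k (k ⊗[R] M) := Submodule.span k (q '' F)
  have hbar (F) (hF : F ∈ 𝓕) (m : M) : q m ∈ bar F ↔ m ∈ F := by
    refine ⟨fun h => ?_, fun h => Submodule.subset_span ⟨m, h, rfl⟩⟩
    rw [← Submodule.restrictScalars_mem R, Submodule.restrictScalars_span R k
      IsLocalRing.residue_surjective, ← Submodule.map_span, Submodule.span_eq] at h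
    obtain ⟨f, hf, hfm⟩ := h
    have := hker (m - f) (by rw [map_sub, hfm, sub_self]) F hF
    simpa using F.add_mem this hf
  obtain ⟨s, hs, hsp, hsF⟩ := exists_adapted_linearIndepOn (𝓕 := bar '' 𝓕)
    (IsChain.image_of_map_rel _ _ bar (fun _ _ h => Submodule.span_mono (Set.image_mono h)) h𝓕) ⊤
  have := Module.finitePresentation_of_projective R M
  have : Finite s := hs.finite
  let eN := Finite.equivFin s
  choose g hg using hq
  let v (i : Fin _) : M := g (eN.symm i)
  have hqv (i) : q (v i) = eN.symm i := hg _
  have hqv' : q ∘ v = Subtype.val ∘ eN.symm := funext hqv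
  obtain ⟨b, hb⟩ := Module.exists_basis_of_basis_baseChange (R := R) v
    (by
      change LinearIndependent k (q ∘ v)
      rw [hqv']
      exact (linearIndependent_equiv' eN.symm rfl).2 hs)
    (by
      change Submodule.span k (Set.range (q ∘ v)) = ⊤
      rw [hqv', Set.range_comp, eN.symm.surjective.range_eq, Set.image_univ, Subtype.range_coe, hsp])
    (Module.Flat.rTensor_preserves_injective_linearMap _ Subtype.val_injective)
  refine ⟨_, b, fun F hF m => ⟨fun hmF a ha => ?_, fun h => ?_⟩⟩
  · have h1 : q m ∈ Submodule.span k (s ∩ bar F) := by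
      rw [hsF _ ⟨F, hF, rfl⟩ le_top]
      exact (hbar F hF m).2 hmF
    have h2 : Submodule.span k (s ∩ bar F) ≤ LinearMap.ker ((b.baseChange k).coord a) := by
      refine Submodule.span_le.2 ?_
      rintro w ⟨hws, hwF⟩
      have hw : w = b.baseChange k (eN ⟨w, hws⟩) := by
        rw [Module.Basis.baseChange_apply, hb]
        exact ((hqv _).trans (by rw [Equiv.symm_apply_apply])).symm
      have hne : eN ⟨w, hws⟩ ≠ a := by
        rintro rfl
        refine ha ((hbar F hF _).1 ?_)
        rwa [hb, hqv, Equiv.symm_apply_apply]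
      rw [SetLike.mem_coe, LinearMap.mem_ker, hw, Module.Basis.coord_apply, Module.Basis.repr_self,
        Finsupp.single_eq_of_ne hne.symm]
    have h3 : (b.baseChange k).repr ((1 : k) ⊗ₜ m) a = 0 := h2 h1
    have h4 : algebraMap R k (b.repr m a) = 0 := by
      rw [Module.Basis.baseChange_repr_tmul, Algebra.smul_def, mul_one] at h3
      exact h3
    exact (IsLocalRing.residue_eq_zero_iff _).1 h4
  · rw [← b.sum_repr m]
    refine Submodule.sum_mem _ fun a _ => ?_
    by_cases ha : b a ∈ F
    · exact F.smul_mem _ ha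
    · exact hm F hF _ (h a ha) _

end AdaptedBasis

/-! ### Orders over a domain -/

section LocalOrder

variable {R E : Type*} [CommRing R] [Ring E] [Algebra R E]

/-- A subalgebra of `E`, finitely generated as an `R`-module, with `Frac(R) A = E`. -/
def IsLocalOrder (A : Subalgebra R E) : Prop :=
  (Subalgebra.toSubmodule A).FG ∧ ∀ x : E, ∃ r : R, r ≠ 0 ∧ r • x ∈ A

theorem exists_smul_mem_of_fg {M : Type*} [IsDomain R] [AddCommGroup M] [Module R M]
    {Q : Submodule R M} (hQ : ∀ x : M, ∃ r : R, r ≠ 0 ∧ r • x ∈ Q) {P : Submodule R M} (hP : P.FG) :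
    ∃ r : R, r ≠ 0 ∧ ∀ x ∈ P, r • x ∈ Q := by
  induction P, hP using Submodule.fg_induction with
  | singleton x =>
    obtain ⟨r, hr, hrx⟩ := hQ x
    refine ⟨r, hr, fun y hy => ?_⟩
    obtain ⟨c, rfl⟩ := Submodule.mem_span_singleton.1 hy
    rw [smul_comm]
    exact Q.smul_mem c hrx
  | sup P P' _ _ ihP ihP' =>
    obtain ⟨r, hr, hrP⟩ := ihP
    obtain ⟨s, hs, hsP⟩ := ihP'
    refine ⟨r * s, mul_ne_zero hr hs, fun x hx => ?_⟩
    obtain ⟨p, hp, q, hq, rfl⟩ := Submodule.mem_sup.1 hx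
    rw [smul_add]
    refine add_mem ?_ ?_
    · rw [mul_comm, mul_smul]
      exact Q.smul_mem s (hrP p hp)
    · rw [mul_smul]
      exact Q.smul_mem r (hsP q hq)

theorem IsLocalOrder.exists_smul_mem [IsDomain R] {A : Subalgebra R E} (hA : IsLocalOrder A)
    {P : Submodule R E} (hP : P.FG) : ∃ r : R, r ≠ 0 ∧ ∀ x ∈ P, r • x ∈ A :=
  exists_smul_mem_of_fg (Q := Subalgebra.toSubmodule A) hA.2 hP

theorem IsLocalOrder.finite {A : Subalgebra R E} (hA : IsLocalOrder A) : Module.Finite R A :=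
  Module.Finite.iff_fg.2 hA.1

/-- Some nonzero multiple `r • z` lies in `A`, which proves the identity up to the factor `r`, and
`Y` is torsion-free. Thus `A`-linear maps commute with the ambient algebra wherever this makes
sense. -/
theorem map_eq_smul_of_isLocalOrder {A : Subalgebra R E} (hA : IsLocalOrder A) {X Y : Type*}
    [AddCommGroup X] [Module E X] [Module R X] [IsScalarTower R E X] [AddCommGroup Y] [Module E Y]
    [Module R Y] [IsScalarTower R E Y] [Module.IsTorsionFree R Y] [IsDomain R] {N : Submodule A X}
    (s : N →ₗ[A] Y) (z : E) (x x' : N) (h : (x' : X) = z • (x : X)) : s x' = z • s x := by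
  obtain ⟨r, hr, hrz⟩ := hA.2 z
  have h1 : (⟨r • z, hrz⟩ : A) • x = algebraMap R A r • x' := by
    ext
    change (r • z) • (x : X) = algebraMap R E r • (x' : X)
    rw [h, algebraMap_smul, smul_assoc]
  have h2 := congrArg s h1
  rw [map_smul, map_smul] at h2
  have h3 : r • (z • s x) = r • s x' := by
    rw [← smul_assoc, ← algebraMap_smul E r (s x')]
    exact h2
  exact (smul_right_injective Y hr h3).symm

end LocalOrder

/-! ### Lattices of a hereditary order -/

section Lattices

variable {R K V : Type*} [CommRing R] [IsDomain R] [Field K] [Algebra R K]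
  [IsFractionRing R K] [AddCommGroup V] [Module K V] [Module R V] [IsScalarTower R K V]
  [FiniteDimensional K V] {A : Subalgebra R (Module.End K V)}

/-- The lattices of an order all of whose left ideals are projective are projective. -/
theorem projective_lattice (hA : IsLocalOrder A) (hproj : ∀ I : Submodule A A, Module.Projective A I)
    (L : Submodule A V) [Module.Finite R L] : Module.Projective A L := by
  rcases subsingleton_or_nontrivial V with _ | _
  · exact Module.Projective.of_free
  obtain ⟨φ, v, hv⟩ : ∃ (φ : V →ₗ[K] K) (v : V), φ v = 1 := by
    obtain ⟨v, hv⟩ := exists_ne (0 : V)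
    obtain ⟨φ, hφ⟩ := Module.Projective.exists_dual_eq_one K hv
    exact ⟨φ, v, hφ⟩
  -- A suitable multiple of `l ↦ (w ↦ φ w • l)` embeds the lattice into `A` as a left ideal.
  let j₀ : V →ₗ[R] Module.End K V :=
    { toFun w := φ.smulRight w
      map_add' w w' := by ext; simp
      map_smul' c w := by ext w'; exact smul_comm (φ w') c w }
  have hfg : ((L.restrictScalars R).map j₀).FG :=
    Submodule.FG.map _ (Module.Finite.iff_fg.1 ‹Module.Finite R L›)
  obtain ⟨r, hr, hrA⟩ := hA.exists_smul_mem hfg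
  let j : L →ₗ[A] A :=
    { toFun l := ⟨r • j₀ l, hrA _ ⟨l, l.2, rfl⟩⟩
      map_add' l l' := Subtype.ext (by simp)
      map_smul' a l := by
        ext w
        change r • (φ w • (a : Module.End K V) l) = (a : Module.End K V) (r • φ w • (l : V))
        rw [LinearMap.map_smul_of_tower, map_smul] }
  have hj : Function.Injective j := by
    intro l l' h
    have h1 : r • (φ v • (l : V)) = r • (φ v • (l' : V)) := LinearMap.congr_fun (congrArg Subtype.val h) v
    rw [hv, one_smul, one_smul] at h1
    have : Module.IsTorsionFree R V := Module.IsTorsionFree.trans_faithfulSMul R K V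
    exact Subtype.ext (smul_right_injective V hr h1)
  have := hproj (LinearMap.range j)
  exact Module.Projective.of_equiv (LinearEquiv.ofInjective j hj).symm

/-- If `φ x = 1`, the rank-one map `φ.smulRight x'` carries `x` to `x'`. Commutation with it gives
`s x' = φ (s x) • x'`. -/
theorem lattice_hom_eq_smul (hA : IsLocalOrder A) {N : Submodule A V} (s : N →ₗ[A] V) :
    ∃ c : K, ∀ x : N, s x = c • (x : V) := by
  by_cases h : ∃ x : N, x ≠ 0
  · obtain ⟨x, hx⟩ := h
    have : Module.IsTorsionFree R V := Module.IsTorsionFree.trans_faithfulSMul R K V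
    obtain ⟨φ, hφ⟩ := Module.Projective.exists_dual_eq_one K (x := (x : V)) (by simpa using hx)
    refine ⟨φ (s x), fun x' => ?_⟩
    rw [map_eq_smul_of_isLocalOrder hA s (φ.smulRight (x' : V)) x x' (by simp [hφ])]
    simp
  · push Not at h
    exact ⟨0, fun x => by simp [h x]⟩

/-- The lattices of an order all of whose left ideals are projective form a chain. -/
theorem lattice_total [ValuationRing R] (hA : IsLocalOrder A)
    (hproj : ∀ I : Submodule A A, Module.Projective A I)
    (L M : Submodule A V) [Module.Finite R L] [Module.Finite R M] : L ≤ M ∨ M ≤ L := by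
  have : Module.Finite R (L ⊔ M : Submodule A V) := by
    have h : ((L ⊔ M : Submodule A V).restrictScalars R).FG := by
      rw [Submodule.restrictScalars_sup]
      exact (Module.Finite.iff_fg.1 ‹Module.Finite R L›).sup (Module.Finite.iff_fg.1 ‹Module.Finite R M›)
    exact Module.Finite.iff_fg.2 h
  have := projective_lattice hA hproj (L ⊔ M)
  let f : L × M →ₗ[A] (L ⊔ M : Submodule A V) :=
    (Submodule.inclusion le_sup_left).coprod (Submodule.inclusion le_sup_right)
  have hf : Function.Surjective f := by
    rintro ⟨x, hx⟩
    obtain ⟨l, hl, m, hm, rfl⟩ := Submodule.mem_sup.1 hx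
    exact ⟨(⟨l, hl⟩, ⟨m, hm⟩), rfl⟩
  -- The components of a splitting are scalars `c` and `d`, with sum `1` unless the lattices vanish.
  -- Over a valuation ring one of them has its inverse in `R`, and then the corresponding lattice
  -- contains `L ⊔ M`.
  obtain ⟨s, hs⟩ := Module.projective_lifting_property f LinearMap.id hf
  obtain ⟨c, hc⟩ := lattice_hom_eq_smul hA (L.subtype ∘ₗ LinearMap.fst A L M ∘ₗ s)
  obtain ⟨d, hd⟩ := lattice_hom_eq_smul hA (M.subtype ∘ₗ LinearMap.snd A L M ∘ₗ s)
  have hcL (x : V) (hx : x ∈ L ⊔ M) : c • x ∈ L := by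
    have := hc ⟨x, hx⟩
    rw [← this]
    exact (s ⟨x, hx⟩).1.2
  have hdM (x : V) (hx : x ∈ L ⊔ M) : d • x ∈ M := by
    have := hd ⟨x, hx⟩
    rw [← this]
    exact (s ⟨x, hx⟩).2.2
  have hsum (x : V) (hx : x ∈ L ⊔ M) : (c + d) • x = x := by
    have h1 := congrArg Subtype.val (LinearMap.congr_fun hs ⟨x, hx⟩)
    have h2 : c • x + d • x = x := by
      rw [← hc ⟨x, hx⟩, ← hd ⟨x, hx⟩]
      exact h1
    rw [add_smul, h2]
  have key (c : K) (N : Submodule A V) (hcN : ∀ x ∈ L ⊔ M, c • x ∈ N) (y : R)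
      (hy : algebraMap R K y * c = 1) : L ⊔ M ≤ N := by
    intro x hx
    have h1 : y • c • x ∈ N := N.smul_of_tower_mem y (hcN x hx)
    rwa [← algebraMap_smul K, smul_smul, hy, one_smul] at h1
  by_cases h0 : ∀ x ∈ L ⊔ M, x = 0
  · exact Or.inl fun x hx => by rw [h0 x (le_sup_left (a := L) hx)]; exact M.zero_mem
  push Not at h0
  obtain ⟨x, hx, hx0⟩ := h0
  have hcd : c + d = 1 := by
    have h1 : (c + d - 1) • x = 0 := by rw [sub_smul, hsum x hx, one_smul, sub_self]
    rcases smul_eq_zero.1 h1 with h2 | h2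
    · exact sub_eq_zero.1 h2
    · exact absurd h2 hx0
  suffices L ⊔ M ≤ L ∨ L ⊔ M ≤ M from
    this.symm.imp (fun h => le_sup_left.trans h) fun h => le_sup_right.trans h
  rcases ValuationRing.isInteger_or_isInteger R c with ⟨y, hy⟩ | ⟨y, hy⟩
  · rcases IsLocalRing.isUnit_or_isUnit_one_sub_self y with hu | hu
    · obtain ⟨z, hz⟩ := hu.exists_left_inv
      exact Or.inl (key c L hcL z (by rw [← hy, ← map_mul, hz, map_one]))
    · obtain ⟨z, hz⟩ := hu.exists_left_inv
      refine Or.inr (key d M hdM z ?_)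
      rw [← eq_sub_iff_add_eq'.2 hcd |>.symm, ← hy, ← map_one (algebraMap R K), ← map_sub, ← map_mul, hz]
  · by_cases hc0 : c = 0
    · refine Or.inr (key d M hdM 1 ?_)
      rw [← hcd, hc0, zero_add, map_one, one_mul]
    · exact Or.inl (key c L hcL y (by rw [hy, inv_mul_cancel₀ hc0]))

/-- An order all of whose left ideals are projective is determined by its lattices. -/
theorem mem_of_forall_lattice [IsNoetherianRing R] (hA : IsLocalOrder A)
    (hproj : ∀ I : Submodule A A, Module.Projective A I) (x : Module.End K V)
    (hx : ∀ L : Submodule A V, Module.Finite R L → ∀ l ∈ L, x l ∈ L) : x ∈ A := by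
  classical
  let b := Module.finBasis K V
  have : Module.IsTorsionFree R V := Module.IsTorsionFree.trans_faithfulSMul R K V
  have : Module.IsTorsionFree R (Module.End K V) :=
    Module.IsTorsionFree.trans_faithfulSMul R K (Module.End K V)
  -- It suffices that `x` preserves lattices in `End V`, since `A` is one and contains `1`. The
  -- induction is on the set of basis vectors not killed by `P`. Evaluation at `b i` maps `P` onto a
  -- lattice in `V`, hence splits; the splitting commutes with `x`, and the remainder also kills `b
  -- i`.
  have key (s : Finset (Fin (Module.finrank K V))) (P : Submodule A (Module.End K V))
      (hP : Module.Finite R P) (hs : ∀ p ∈ P, ∀ i ∉ s, p (b i) = 0) : ∀ p ∈ P, x * p ∈ P := by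
    induction s using Finset.induction_on generalizing P with
    | empty =>
      intro p hp
      have : p = 0 := b.ext fun i => by simpa using hs p hp i (by simp)
      rw [this, mul_zero]
      exact P.zero_mem
    | insert i s hi ih =>
      intro p hp
      let ev : Module.End K V →ₗ[A] V := LinearMap.toSpanSingleton (Module.End K V) V (b i)
        |>.restrictScalars A
      have hev (q : Module.End K V) : ev q = q (b i) := rfl
      let L := P.map ev
      have hL : Module.Finite R L :=
        Module.Finite.of_surjective ((ev.submoduleMap P).restrictScalars R)
          (LinearMap.submoduleMap_surjective ev P)
      have := projective_lattice hA hproj L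
      let f : P →ₗ[A] L := ev.submoduleMap P
      obtain ⟨t, ht⟩ := Module.projective_lifting_property f LinearMap.id
        (LinearMap.submoduleMap_surjective ev P)
      let l : L := ⟨p (b i), p, hp, rfl⟩
      let l' : L := ⟨x (p (b i)), hx L hL _ l.2⟩
      have hl' : ((t l' : P) : Module.End K V) = x * (t l : P) :=
        map_eq_smul_of_isLocalOrder hA (P.subtype ∘ₗ t) x l l' rfl
      have htl : ((t l : P) : Module.End K V) (b i) = p (b i) :=
        congrArg Subtype.val (LinearMap.congr_fun ht l)
      let P' : Submodule A (Module.End K V) := P ⊓ LinearMap.ker ev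
      have : _root_.IsNoetherian R P := isNoetherian_of_isNoetherianRing_of_finite R P
      have hP' : Module.Finite R P' :=
        Module.Finite.of_injective ((Submodule.inclusion inf_le_left : P' →ₗ[A] P).restrictScalars R)
          (Submodule.inclusion_injective (inf_le_left : P' ≤ P))
      have hmem : p - (t l : P) ∈ P' := by
        refine ⟨P.sub_mem hp (t l).2, ?_⟩
        change (p - (t l : P)) (b i) = 0
        rw [LinearMap.sub_apply, htl, sub_self]
      have h1 := ih P' hP' (fun q hq j hj => by
        by_cases hji : j = i
        · subst hji
          exact hq.2
        · exact hs q hq.1 j (by simp [hji, hj])) _ hmem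
      have h2 : x * p = x * (p - (t l : P)) + (t l' : P) := by rw [hl']; noncomm_ring
      rw [h2]
      exact P.add_mem h1.1 (t l').2
  let P := LinearMap.range (LinearMap.toSpanSingleton A (Module.End K V) 1)
  have hfA := hA.finite
  have hP : Module.Finite R P := Module.Finite.trans A P
  obtain ⟨a, ha⟩ := key Finset.univ P hP (by simp) 1 ⟨1, by simp⟩
  have : x = (a : Module.End K V) := by
    rw [mul_one] at ha
    rw [← ha]
    change (a : Module.End K V) * 1 = _
    rw [mul_one]
  rw [this]
  exact a.2

end Lattices

/-! ### Blocks from a weak order -/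

section Blocks

/-- A strict weak order on a finite type is given by a rank function. -/
theorem exists_rank {ι : Type*} [Finite ι] (r : ι → ι → Prop) (hirr : ∀ a, ¬ r a a)
    (htrans : ∀ a b c, r a b → r b c → r a c) (hweak : ∀ a b c, r a c → r a b ∨ r b c) :
    ∃ h : ι → ℕ, ∀ a b, h a < h b ↔ r a b := by
  classical
  have := Fintype.ofFinite ι
  refine ⟨fun a => (Finset.univ.filter fun c => r c a).card, fun a b => ⟨fun hlt => ?_, fun hab => ?_⟩⟩
  · by_contra hab
    refine absurd hlt (not_lt.2 (Finset.card_le_card fun c hc => ?_))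
    simp only [Finset.mem_filter, Finset.mem_univ, true_and] at hc ⊢
    exact (hweak c a b hc).resolve_right hab
  · refine Finset.card_lt_card (Finset.ssubset_iff.2 ⟨a, by simpa using hirr a, fun c hc => ?_⟩)
    simp only [Finset.mem_insert, Finset.mem_filter, Finset.mem_univ, true_and] at hc ⊢
    rcases hc with rfl | hc
    · exact hab
    · exact htrans _ _ _ hc hab

theorem exists_block_equiv {ι : Type*} [Finite ι] (h : ι → ℕ) :
    ∃ (r : ℕ) (n : Fin r → ℕ) (_ : ∀ i, 0 < n i) (e : ι ≃ Σ i, Fin (n i)),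
      ∀ a b, (e a).1 < (e b).1 ↔ h a < h b := by
  classical
  have := Fintype.ofFinite ι
  let I := Finset.univ.image h
  let o : Fin I.card ≃o I := I.orderIsoOfFin rfl
  let f (a : ι) : Fin I.card := o.symm ⟨h a, Finset.mem_image_of_mem _ (Finset.mem_univ a)⟩
  refine ⟨I.card, fun i => Fintype.card {a // f a = i}, fun i => ?_,
    (Equiv.sigmaFiberEquiv f).symm.trans (Equiv.sigmaCongrRight fun i => Fintype.equivFin _),
    fun a b => ?_⟩
  · obtain ⟨a, -, ha⟩ := Finset.mem_image.1 (o i).2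
    refine Fintype.card_pos_iff.2 ⟨a, ?_⟩
    simp only [f]
    rw [OrderIso.symm_apply_eq]
    exact Subtype.ext ha
  · change f a < f b ↔ _
    simp [f]

end Blocks

/-! ### Block orders over the fraction field -/

section BlockMatrices

variable (R : Type*) [CommRing R] [IsLocalRing R] (K : Type*) [Field K] [Algebra R K]
  {r : ℕ} (n : Fin r → ℕ)

/-- The block order as an order in the matrix algebra over the fraction field. -/
def fracBlockOrder : Subalgebra R (Matrix (Σ i, Fin (n i)) (Σ i, Fin (n i)) K) :=
  (blockOrder R n).map (Algebra.ofId R K).mapMatrix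

variable {n}

theorem mem_fracBlockOrder (M : Matrix (Σ i, Fin (n i)) (Σ i, Fin (n i)) K) :
    M ∈ fracBlockOrder R K n ↔ ∀ a b, ∃ y : R, algebraMap R K y = M a b ∧
      (b.1 < a.1 → y ∈ IsLocalRing.maximalIdeal R) := by
  constructor
  · rintro ⟨N, hN, rfl⟩ a b
    exact ⟨N a b, rfl, hN a b⟩
  · intro h
    choose y hy hym using h
    exact ⟨Matrix.of y, fun a b => hym a b, Matrix.ext hy⟩

/-- The block order is isomorphic to its image over the fraction field. -/
def fracBlockOrderEquiv [FaithfulSMul R K] : blockOrder R n ≃ₐ[R] fracBlockOrder R K n :=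
  (blockOrder R n).equivMapOfInjective _
    (Matrix.map_injective (FaithfulSMul.algebraMap_injective R K))

theorem coe_fracBlockOrderEquiv [FaithfulSMul R K] (M : blockOrder R n) :
    (fracBlockOrderEquiv R K M : Matrix (Σ i, Fin (n i)) (Σ i, Fin (n i)) K) =
      (M : Matrix _ _ R).map (algebraMap R K) := rfl

end BlockMatrices

/-! ### Structure of hereditary orders over a discrete valuation ring -/

section Structure

variable {R K V : Type*} [CommRing R] [IsDomain R] [IsDiscreteValuationRing R] [Field K]
  [Algebra R K] [IsFractionRing R K] [AddCommGroup V] [Module K V] [Module R V]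
  [IsScalarTower R K V] [FiniteDimensional K V] {A : Subalgebra R (Module.End K V)}

/-- Multiplication by a scalar, as a map of modules over an order. -/
def scalarMap (A : Subalgebra R (Module.End K V)) (c : K) : V →ₗ[A] V where
  toFun v := c • v
  map_add' := smul_add c
  map_smul' a v := (map_smul (a : Module.End K V) c v).symm

/-- Every lattice has a multiple between `L₀` and `𝔪 L₀`. -/
theorem exists_scalar (hA : IsLocalOrder A) (hproj : ∀ I : Submodule A A, Module.Projective A I)
    {L₀ : Submodule A V} [Module.Finite R L₀] [Module.Free R L₀] (h₀ : ∀ v : V, ∃ r : R, r ≠ 0 ∧ r • v ∈ L₀)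
    (L : Submodule A V) [Module.Finite R L] (hL : L ≠ ⊥) :
    ∃ c : K, c ≠ 0 ∧ (∀ v, c • v ∈ L → v ∈ L₀) ∧
      ∀ v ∈ L₀, ∀ y ∈ IsLocalRing.maximalIdeal R, c • y • v ∈ L := by
  obtain ⟨π, hπ⟩ := IsDiscreteValuationRing.exists_irreducible R
  have hπ0 : algebraMap R K π ≠ 0 := by simpa using hπ.ne_zero
  obtain ⟨r, hr, hrL⟩ : ∃ r : R, r ≠ 0 ∧ ∀ v ∈ L, r • v ∈ L₀ := by
    exact exists_smul_mem_of_fg (Q := L₀.restrictScalars R) h₀ (P := L.restrictScalars R)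
      (Module.Finite.iff_fg.1 ‹Module.Finite R L›)
  have hr0 : algebraMap R K r ≠ 0 := by simpa using hr
  -- The multiples `c m • L₀` decrease. The first contains `L`, and they do not all do so, because a
  -- nonzero coordinate is not divisible by every power of `π`. The last one containing `L` is
  -- chosen; the next one is contained in `L` by comparability.
  let c (m : ℕ) : K := algebraMap R K π ^ m / algebraMap R K r
  have hc0 (m) : c m ≠ 0 := div_ne_zero (pow_ne_zero _ hπ0) hr0
  obtain ⟨v, hvL, hv0⟩ := L.exists_mem_ne_zero_of_ne_bot hL
  have hex : ∃ m, ¬ L ≤ L₀.map (scalarMap A (c m)) := by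
    by_contra! hall
    let β := Module.Free.chooseBasis R L₀
    have hne : (⟨r • v, hrL v hvL⟩ : L₀) ≠ 0 := by
      intro h
      have h1 : r • v = 0 := congrArg Subtype.val h
      rw [← algebraMap_smul K] at h1
      exact hv0 ((smul_eq_zero.1 h1).resolve_left hr0)
    obtain ⟨a, ha⟩ : ∃ a, β.repr ⟨r • v, hrL v hvL⟩ a ≠ 0 := by
      by_contra! h
      exact hne (β.repr.injective (by ext a; simpa using h a))
    obtain ⟨m, hm⟩ := FiniteMultiplicity.of_not_isUnit hπ.not_isUnit ha
    obtain ⟨w, hw, hwv⟩ := hall (m + 1) hvL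
    have h1 : (⟨r • v, hrL v hvL⟩ : L₀) = π ^ (m + 1) • ⟨w, hw⟩ := by
      refine Subtype.ext ?_
      change r • v = π ^ (m + 1) • w
      rw [← hwv]
      change r • (c (m + 1) • w) = _
      rw [← algebraMap_smul K r, smul_smul, mul_div_cancel₀ _ hr0, ← map_pow, algebraMap_smul]
    apply hm
    rw [h1, map_smul, Finsupp.smul_apply, smul_eq_mul]
    exact dvd_mul_right _ _
  classical
  have hpos : Nat.find hex ≠ 0 := by
    intro h
    refine Nat.find_spec hex fun w hw => ?_
    rw [h]
    refine ⟨r • w, hrL w hw, ?_⟩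
    change c 0 • r • w = w
    rw [← algebraMap_smul K r, smul_smul, div_mul_cancel₀ _ hr0, pow_zero, one_smul]
  obtain ⟨m, hm⟩ := Nat.exists_eq_succ_of_ne_zero hpos
  have h1 : L ≤ L₀.map (scalarMap A (c m)) := not_not.1 (Nat.find_min hex (m := m) (by omega))
  have h2 : ¬ L ≤ L₀.map (scalarMap A (c (m + 1))) := by
    have := Nat.find_spec hex
    rwa [hm] at this
  have : Module.Finite R (L₀.map (scalarMap A (c (m + 1)))) :=
    Module.Finite.of_surjective (((scalarMap A (c (m + 1))).submoduleMap L₀).restrictScalars R)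
      (LinearMap.submoduleMap_surjective _ _)
  have h3 := (lattice_total hA hproj L (L₀.map (scalarMap A (c (m + 1))))).resolve_left h2
  refine ⟨c m, hc0 m, fun w hw => ?_, fun w hw y hy => ?_⟩
  · obtain ⟨w', hw', hww⟩ := h1 hw
    have : w' = w := smul_right_injective V (hc0 m) hww
    exact this ▸ hw'
  · rw [hπ.maximalIdeal_eq, Ideal.mem_span_singleton] at hy
    obtain ⟨z, rfl⟩ := hy
    have h4 : c m • (π * z) • w = c (m + 1) • z • w := by
      rw [mul_smul, ← algebraMap_smul K π, smul_smul]
      congr 1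
      simp only [c]
      ring
    rw [h4]
    exact h3 ⟨z • w, L₀.smul_of_tower_mem z hw, rfl⟩

/-- A hereditary order in a matrix algebra over a discretely valued field is a block order. -/
theorem exists_equiv_blockOrder (hA : IsLocalOrder A)
    (hproj : ∀ I : Submodule A A, Module.Projective A I) :
    ∃ (r : ℕ) (n : Fin r → ℕ) (_ : ∀ i, 0 < n i), Nonempty (A ≃ₐ[R] blockOrder R n) := by
  classical
  have : Module.IsTorsionFree R V := Module.IsTorsionFree.trans_faithfulSMul R K V
  have := hA.finite
  let b₀ := Module.finBasis K V
  let L₀ : Submodule A V := Submodule.span A (Set.range b₀)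
  have : Module.Finite A L₀ := Module.Finite.span_of_finite A (Set.finite_range b₀)
  have : Module.Finite R L₀ := Module.Finite.trans A L₀
  have : _root_.IsNoetherian R L₀ := isNoetherian_of_isNoetherianRing_of_finite R L₀
  have : Module.IsTorsionFree R L₀ :=
    Subtype.val_injective.moduleIsTorsionFree _ fun (c : R) (x : L₀) => rfl
  have : Module.Free R L₀ := Module.free_of_finite_type_torsion_free' (R := R) (M := L₀)
  have h₀ (v : V) : ∃ r : R, r ≠ 0 ∧ r • v ∈ L₀ := by
    obtain ⟨s, hs⟩ := IsLocalization.exist_integer_multiples_of_finite (nonZeroDivisors R)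
      (b₀.repr v)
    choose y hy using hs
    refine ⟨s, nonZeroDivisors.ne_zero s.2, ?_⟩
    rw [← b₀.sum_repr v, Finset.smul_sum]
    refine L₀.sum_mem fun i _ => ?_
    rw [← smul_assoc, ← hy, algebraMap_smul]
    exact L₀.smul_of_tower_mem _ (Submodule.subset_span ⟨i, rfl⟩)
  -- The flag of lattices between `𝔪 L₀` and `L₀`.
  let 𝓕 : Set (Submodule R L₀) := {F | ∃ L : Submodule A V, L ≤ L₀ ∧
    (∀ x ∈ IsLocalRing.maximalIdeal R, ∀ v ∈ L₀, x • v ∈ L) ∧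
      F = (L.comap L₀.subtype).restrictScalars R}
  have hfin (L : Submodule A V) (hL : L ≤ L₀) : Module.Finite R L :=
    Module.Finite.of_injective ((Submodule.inclusion hL).restrictScalars R)
      (Submodule.inclusion_injective hL)
  have h𝓕 : IsChain (· ≤ ·) 𝓕 := by
    rintro _ ⟨L, hL, -, rfl⟩ _ ⟨M, hM, -, rfl⟩ -
    have := hfin L hL
    have := hfin M hM
    exact (lattice_total hA hproj L M).imp (fun h v hv => h hv) fun h v hv => h hv
  have hm𝓕 : ∀ F ∈ 𝓕, ∀ x ∈ IsLocalRing.maximalIdeal R, ∀ m : L₀, x • m ∈ F := by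
    rintro _ ⟨L, hL, hm, rfl⟩ x hx m
    exact hm x hx m m.2
  obtain ⟨N, β, hβ⟩ := exists_adapted_basis (R := R) (M := L₀) (𝓕 := 𝓕) h𝓕 hm𝓕
  have hspan : ⊤ ≤ Submodule.span K (Set.range fun i => (β i : V)) := by
    intro v _
    obtain ⟨r, hr, hrv⟩ := h₀ v
    have h1 : r • v ∈ Submodule.span K (Set.range fun i => (β i : V)) := by
      have h2 := congrArg Subtype.val (β.sum_repr ⟨r • v, hrv⟩)
      rw [← show _ = r • v from h2, AddSubmonoidClass.coe_finsetSum]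
      refine Submodule.sum_mem _ fun i _ => Submodule.smul_of_tower_mem _ _ (Submodule.subset_span ⟨i, rfl⟩)
    rw [← algebraMap_smul K] at h1
    exact (Submodule.smul_mem_iff _ (by simpa using hr)).1 h1
  have hli : LinearIndependent K fun i => (β i : V) := by
    rw [← LinearIndependent.iff_fractionRing R K]
    exact β.linearIndependent.map_injOn ((L₀.subtype).restrictScalars R)
      Subtype.val_injective.injOn
  let βK := Module.Basis.mk hli hspan
  have hrepr (v : L₀) (a) : βK.repr v a = algebraMap R K (β.repr v a) := by
    have h2 : (v : V) = ∑ i, algebraMap R K (β.repr v i) • βK i := by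
      have h3 := congrArg Subtype.val (β.sum_repr v)
      rw [AddSubmonoidClass.coe_finsetSum] at h3
      refine h3.symm.trans (Finset.sum_congr rfl fun i _ => ?_)
      rw [algebraMap_smul, Module.Basis.mk_apply]
      rfl
    rw [h2, βK.repr_sum_self]
  -- If a member of the flag contains `β b` but not `β a`, then the entry at `(a, b)` of an element
  -- of `A` has to lie in `𝔪`. This relation is a strict weak order because the flag is a chain.
  obtain ⟨h, hh⟩ := exists_rank (fun b a => ∃ F ∈ 𝓕, β b ∈ F ∧ β a ∉ F)
    (by rintro a ⟨F, -, h1, h2⟩; exact h2 h1)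
    (by
      rintro a b c ⟨F, hF, haF, hbF⟩ ⟨G, hG, hbG, hcG⟩
      refine ⟨G, hG, ?_, hcG⟩
      rcases h𝓕.total hF hG with h1 | h1
      · exact h1 haF
      · exact absurd (h1 hbG) hbF)
    (by
      rintro a b c ⟨F, hF, haF, hcF⟩
      by_cases hb : β b ∈ F
      · exact Or.inr ⟨F, hF, hb, hcF⟩
      · exact Or.inl ⟨F, hF, haF, hb⟩)
  have hmem (x : Module.End K V) : x ∈ A ↔ ∀ a b, ∃ y : R,
      algebraMap R K y = LinearMap.toMatrix βK βK x a b ∧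
        (h b < h a → y ∈ IsLocalRing.maximalIdeal R) := by
    constructor
    · intro hx a b
      have hxb : x (β b) ∈ L₀ := L₀.smul_mem ⟨x, hx⟩ (β b).2
      refine ⟨β.repr ⟨_, hxb⟩ a, ?_, fun hab => ?_⟩
      · rw [← hrepr, LinearMap.toMatrix_apply, Module.Basis.mk_apply]
      · obtain ⟨F, hF, hbF, haF⟩ := (hh b a).1 hab
        refine (hβ F hF _).1 ?_ a haF
        obtain ⟨L, hL, -, rfl⟩ := hF
        exact L.smul_mem ⟨x, hx⟩ hbF
    · intro hX
      choose y hy hym using hX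
      have hx (v : L₀) : x v = (∑ a, (∑ b, y a b * β.repr v b) • β a : L₀) := by
        refine βK.repr.injective (Finsupp.ext fun a => ?_)
        rw [hrepr, β.repr_sum_self, ← LinearMap.toMatrix_mulVec_repr βK βK x v]
        simp only [Matrix.mulVec, dotProduct, hrepr, ← hy, map_sum, map_mul]
      have hx₀ (v) (hv : v ∈ L₀) : x v ∈ L₀ := by
        rw [hx ⟨v, hv⟩]
        exact Subtype.property _
      have hxF (F) (hF : F ∈ 𝓕) (v : L₀) (hv : v ∈ F) : (⟨x v, hx₀ v v.2⟩ : L₀) ∈ F := by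
        rw [hβ F hF]
        intro a ha
        have : (⟨x v, hx₀ v v.2⟩ : L₀) = ∑ a, (∑ b, y a b * β.repr v b) • β a := Subtype.ext (hx v)
        rw [this, β.repr_sum_self]
        refine Ideal.sum_mem _ fun b _ => ?_
        by_cases hb : β b ∈ F
        · exact Ideal.mul_mem_right _ _ (hym a b ((hh b a).2 ⟨F, hF, hb, ha⟩))
        · exact Ideal.mul_mem_left _ _ ((hβ F hF v).1 hv b hb)
      refine mem_of_forall_lattice hA hproj x fun L hL l hl => ?_
      by_cases hbot : L = ⊥
      · subst hbot
        simp only [Submodule.mem_bot] at hl ⊢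
        rw [hl, map_zero]
      -- Rescaling brings an arbitrary nonzero lattice into the flag, and `x` commutes with scalars.
      obtain ⟨c, hc, hcL, hcm⟩ := exists_scalar hA hproj h₀ L hbot
      let L' := L.comap (scalarMap A c)
      have hL' : (L'.comap L₀.subtype).restrictScalars R ∈ 𝓕 :=
        ⟨L', hcL, fun y hy v hv => hcm v hv y hy, rfl⟩
      have hv : c⁻¹ • l ∈ L' := by
        change c • c⁻¹ • l ∈ L
        rwa [smul_inv_smul₀ hc]
      have h1 : c • x (c⁻¹ • l) ∈ L := hxF _ hL' ⟨c⁻¹ • l, hcL _ hv⟩ hv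
      rwa [map_smul, smul_inv_smul₀ hc] at h1
  obtain ⟨r, n, hn, e, he⟩ := exists_block_equiv h
  refine ⟨r, n, hn, ⟨?_⟩⟩
  let T : Module.End K V ≃ₐ[K] Matrix _ _ K := LinearMap.toMatrixAlgEquiv (βK.reindex e)
  have hT : A.map (T.restrictScalars R : Module.End K V ≃ₐ[R] Matrix _ _ K).toAlgHom =
      fracBlockOrder R K n := by
    have hTx (x : Module.End K V) (a b) : T x (e a) (e b) = LinearMap.toMatrix βK βK x a b := by
      change LinearMap.toMatrix (βK.reindex e) (βK.reindex e) x (e a) (e b) = _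
      simp [LinearMap.toMatrix_apply]
    have hTA (x : Module.End K V) : T x ∈ fracBlockOrder R K n ↔ x ∈ A := by
      rw [mem_fracBlockOrder, hmem, e.symm.forall_congr_left]
      refine forall_congr' fun a => ?_
      rw [e.symm.forall_congr_left]
      refine forall_congr' fun b => exists_congr fun y => ?_
      rw [Equiv.symm_symm, hTx, he]
    ext M
    constructor
    · rintro ⟨x, hx, rfl⟩
      exact (hTA x).2 hx
    · intro hM
      exact ⟨T.symm M, (hTA _).1 (by simpa using hM), T.apply_symm_apply M⟩
  exact (A.equivMapOfInjective _ (T.restrictScalars R).injective).trans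
    ((Subalgebra.equivOfEq _ _ hT).trans (fracBlockOrderEquiv R K).symm)

end Structure

/-! ### Extending homomorphisms of orders to the ambient algebras -/

section Extension

variable {R K E E' : Type*} [CommRing R] [IsDomain R] [Field K] [Algebra R K] [IsFractionRing R K]
  [Ring E] [Algebra K E] [Algebra R E] [IsScalarTower R K E]
  [Ring E'] [Algebra K E'] [Algebra R E'] [IsScalarTower R K E']

/-- A homomorphism from a subalgebra which spans `E` over the fraction field extends to `E`. -/
theorem exists_algHom_extension {A : Subalgebra R E} (hA : ∀ x : E, ∃ r : R, r ≠ 0 ∧ r • x ∈ A)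
    (f : A →ₐ[R] E') : ∃ F : E →ₐ[K] E', ∀ a : A, F a = f a := by
  have : Module.IsTorsionFree R E' := Module.IsTorsionFree.trans_faithfulSMul R K E'
  choose r hr hrA using hA
  have hr0 (x) : algebraMap R K (r x) ≠ 0 := by simpa using hr x
  let F (x : E) : E' := (algebraMap R K (r x))⁻¹ • f ⟨r x • x, hrA x⟩
  have hF (x : E) (s : R) (hs : s • x ∈ A) : s • F x = f ⟨s • x, hs⟩ := by
    have h1 : s • f ⟨r x • x, hrA x⟩ = r x • f ⟨s • x, hs⟩ := by
      rw [← map_smul, ← map_smul]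
      congr 1
      exact Subtype.ext (smul_comm s (r x) x)
    simp only [F]
    rw [smul_comm, h1, ← algebraMap_smul K (r x), smul_smul, inv_mul_cancel₀ (hr0 x), one_smul]
  have hF' (x : E) (y : E') (s : R) (hs0 : s ≠ 0) (z : A) (hz : (z : E) = s • x) (h : f z = s • y) :
      F x = y := by
    have hs : s • x ∈ A := hz ▸ z.2
    refine smul_right_injective E' hs0 ((hF x s hs).trans (Eq.trans ?_ h))
    congr 1
    exact Subtype.ext hz.symm
  have hmul (x y : E) : F (x * y) = F x * F y := by
    refine hF' _ _ (r x * r y) (mul_ne_zero (hr x) (hr y)) (⟨_, hrA x⟩ * ⟨_, hrA y⟩)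
      (smul_mul_smul_comm _ _ _ _) ?_
    rw [← smul_mul_smul_comm, hF x _ (hrA x), hF y _ (hrA y), ← map_mul]
  have hadd (x y : E) : F (x + y) = F x + F y := by
    have hx : (r x * r y) • x ∈ A := by rw [mul_comm, mul_smul]; exact A.smul_mem (hrA x) _
    have hy : (r x * r y) • y ∈ A := by rw [mul_smul]; exact A.smul_mem (hrA y) _
    refine hF' _ _ (r x * r y) (mul_ne_zero (hr x) (hr y)) (⟨_, hx⟩ + ⟨_, hy⟩)
      (smul_add _ _ _).symm ?_
    rw [smul_add, hF x _ hx, hF y _ hy, ← map_add]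
  have halg (c : K) : F (algebraMap K E c) = algebraMap K E' c := by
    obtain ⟨p, q, hq, rfl⟩ := IsFractionRing.div_surjective (A := R) c
    have hq0 : algebraMap R K q ≠ 0 := by simpa using nonZeroDivisors.ne_zero hq
    refine hF' _ _ q (nonZeroDivisors.ne_zero hq) (algebraMap R A p) ?_ ?_
    · change algebraMap R E p = _
      rw [Algebra.smul_def, IsScalarTower.algebraMap_apply R K E q, ← map_mul,
        mul_div_cancel₀ _ hq0, ← IsScalarTower.algebraMap_apply]
    · rw [f.commutes, Algebra.smul_def, IsScalarTower.algebraMap_apply R K E' q, ← map_mul,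
        mul_div_cancel₀ _ hq0, ← IsScalarTower.algebraMap_apply]
  exact ⟨{ toFun := F
           map_one' := by simpa using halg 1
           map_mul' := hmul
           map_zero' := by simpa using halg 0
           map_add' := hadd
           commutes' := halg }, fun a => hF' _ _ 1 one_ne_zero a (by simp) (by simp)⟩

theorem algHom_ext_of_spanning {A : Subalgebra R E} (hA : ∀ x : E, ∃ r : R, r ≠ 0 ∧ r • x ∈ A)
    {F G : E →ₐ[K] E'} (h : ∀ a ∈ A, F a = G a) : F = G := by
  have : Module.IsTorsionFree R E' := Module.IsTorsionFree.trans_faithfulSMul R K E'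
  ext x
  obtain ⟨r, hr, hrx⟩ := hA x
  refine smul_right_injective E' hr ?_
  have := h _ hrx
  rwa [← algebraMap_smul K r x, map_smul, map_smul, algebraMap_smul, algebraMap_smul] at this

/-- An isomorphism between spanning subalgebras extends to the ambient algebras. -/
theorem exists_algEquiv_extension {A : Subalgebra R E} {A' : Subalgebra R E'}
    (hA : ∀ x : E, ∃ r : R, r ≠ 0 ∧ r • x ∈ A) (hA' : ∀ x : E', ∃ r : R, r ≠ 0 ∧ r • x ∈ A')
    (f : A ≃ₐ[R] A') : ∃ F : E ≃ₐ[K] E', ∀ a : A, F a = f a := by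
  obtain ⟨F, hF⟩ := exists_algHom_extension (K := K) hA (A'.val.comp f.toAlgHom)
  obtain ⟨G, hG⟩ := exists_algHom_extension (K := K) hA' (A.val.comp f.symm.toAlgHom)
  refine ⟨AlgEquiv.ofAlgHom F G (algHom_ext_of_spanning hA' fun a ha => ?_)
    (algHom_ext_of_spanning hA fun a ha => ?_), hF⟩
  · have h1 := hG ⟨a, ha⟩
    simp only [AlgHom.comp_apply] at h1 ⊢
    rw [h1]
    exact (hF _).trans (congrArg Subtype.val (f.apply_symm_apply ⟨a, ha⟩))
  · have h1 := hF ⟨a, ha⟩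
    simp only [AlgHom.comp_apply] at h1 ⊢
    rw [h1]
    exact (hG _).trans (congrArg Subtype.val (f.symm_apply_apply ⟨a, ha⟩))

end Extension

/-! ### Powers of one-sided ideals generated by an idempotent -/

section Powers

variable {R : Type*} {E : Type v} [CommRing R] [Ring E] [Algebra R E] {A B : Subalgebra R E}

theorem mem_span_op_singleton {S : Type*} [Ring S] {e : S} (he : e * e = e) (y : S) :
    y ∈ Submodule.span Sᵐᵒᵖ {e} ↔ e * y = y := by
  rw [Submodule.mem_span_singleton]
  refine ⟨?_, fun h => ⟨op y, h⟩⟩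
  rintro ⟨c, rfl⟩
  change e * (e * unop c) = e * unop c
  rw [← mul_assoc, he]

theorem mem_span_singleton_idempotent {S : Type*} [Ring S] {e : S} (he : e * e = e) (y : S) :
    y ∈ Submodule.span S {e} ↔ y * e = y := by
  rw [Submodule.mem_span_singleton]
  refine ⟨?_, fun h => ⟨y, h⟩⟩
  rintro ⟨c, rfl⟩
  change c * e * e = c * e
  rw [mul_assoc, he]

/-- A criterion for an overorder to be a power of the right ideal `e A`. -/
theorem isRightPower_of_matrixUnits (hAB : A ≤ B) {e : A} (he : e * e = e) {κ : Type*} [Fintype κ]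
    [DecidableEq κ] [Nonempty κ] (g h : κ → E) (hg : ∀ a, ∀ x ∈ B, g a * x ∈ A)
    (heg : ∀ a, (e : E) * g a = g a) (hh : ∀ a, ∀ y ∈ A, h a * (e * y) ∈ B)
    (hgh : ∀ a b, g a * (h b * e) = if a = b then (e : E) else 0) (hsum : ∑ a, h a * g a = 1) :
    IsRightPower ((Subalgebra.inclusion hAB : A →ₐ[R] B) : A →+* B)
      (Submodule.span Aᵐᵒᵖ {e}) := by
  let t := (Fintype.equivFin κ).symm
  let _ := rightModule ((Subalgebra.inclusion hAB : A →ₐ[R] B) : A →+* B)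
  have hey (y : Submodule.span Aᵐᵒᵖ {e}) : (e : E) * ((y : A) : E) = (y : A) :=
    congrArg Subtype.val ((mem_span_op_singleton he _).1 y.2)
  refine ⟨Fintype.card κ, Fintype.card_pos, ⟨?_⟩⟩
  exact
    { toFun x i := ⟨⟨g (t i) * x, hg _ x x.2⟩, (mem_span_op_singleton he _).2
        (Subtype.ext (by
          change (e : E) * (g (t i) * x) = g (t i) * x
          rw [← mul_assoc, heg]))⟩
      map_add' x y := by
        ext i
        exact mul_add _ _ _
      map_smul' c x := by
        ext i
        exact (mul_assoc _ _ _).symm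
      invFun y := ⟨∑ i, h (t i) * (y i : A), B.sum_mem fun i _ => by
        rw [← hey]
        exact hh _ _ (y i : A).2⟩
      left_inv x := by
        ext
        change ∑ i, h (t i) * (g (t i) * (x : E)) = x
        simp only [← mul_assoc]
        rw [← Finset.sum_mul, t.sum_comp fun a => h a * g a, hsum, one_mul]
      right_inv y := by
        ext i
        change g (t i) * ∑ i', h (t i') * ((y i' : A) : E) = (y i : A)
        rw [Finset.mul_sum, Finset.sum_eq_single i]
        · rw [← hey, ← mul_assoc (h _), ← mul_assoc (g _), hgh, if_pos rfl]
        · intro i' _ hi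
          rw [← hey, ← mul_assoc (h _), ← mul_assoc (g _), hgh, if_neg, zero_mul]
          exact fun hti => hi (t.injective hti).symm
        · simp }

/-- A criterion for an overorder to be a power of the left ideal `A e`. -/
theorem isLeftPower_of_matrixUnits (hAB : A ≤ B) {e : A} (he : e * e = e) {κ : Type*} [Fintype κ]
    [DecidableEq κ] [Nonempty κ] (g h : κ → E) (hg : ∀ a, ∀ x ∈ B, x * g a ∈ A)
    (heg : ∀ a, g a * (e : E) = g a) (hh : ∀ a, ∀ y ∈ A, y * e * h a ∈ B)
    (hgh : ∀ a b, (e : E) * h b * g a = if a = b then (e : E) else 0)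
    (hsum : ∑ a, g a * h a = 1) :
    IsLeftPower ((Subalgebra.inclusion hAB : A →ₐ[R] B) : A →+* B) (Submodule.span A {e}) := by
  let t := (Fintype.equivFin κ).symm
  let _ := leftModule ((Subalgebra.inclusion hAB : A →ₐ[R] B) : A →+* B)
  have hey (y : Submodule.span A {e}) : ((y : A) : E) * (e : E) = (y : A) :=
    congrArg Subtype.val ((mem_span_singleton_idempotent he _).1 y.2)
  refine ⟨Fintype.card κ, Fintype.card_pos, ⟨?_⟩⟩
  exact
    { toFun x i := ⟨⟨x * g (t i), hg _ x x.2⟩, (mem_span_singleton_idempotent he _).2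
        (Subtype.ext (by
          change x * g (t i) * (e : E) = x * g (t i)
          rw [mul_assoc, heg]))⟩
      map_add' x y := by
        ext i
        exact add_mul _ _ _
      map_smul' c x := by
        ext i
        exact mul_assoc _ _ _
      invFun y := ⟨∑ i, (y i : A) * h (t i), B.sum_mem fun i _ => by
        rw [← hey]
        exact hh _ _ (y i : A).2⟩
      left_inv x := by
        ext
        change ∑ i, (x : E) * g (t i) * h (t i) = x
        simp only [mul_assoc]
        rw [← Finset.mul_sum, t.sum_comp fun a => g a * h a, hsum, mul_one]
      right_inv y := by
        ext i
        change (∑ i', ((y i' : A) : E) * h (t i')) * g (t i) = (y i : A)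
        rw [Finset.sum_mul, Finset.sum_eq_single i]
        · rw [← hey, mul_assoc _ _ (h _), mul_assoc _ _ (g _), hgh, if_pos rfl]
        · intro i' _ hi
          rw [← hey, mul_assoc _ _ (h _), mul_assoc _ _ (g _), hgh, if_neg, mul_zero]
          exact fun hti => hi (t.injective hti).symm
        · simp }

/-- A power of a right ideal `e S` is not a power of another one if a two-sided ideal contains the
idempotent of the latter and not `e`. -/
theorem not_isRightPower_of_ideal {S T : Type v} [Ring S] [Ring T] {φ : S →+* T} {e e' : S}
    (he' : e' * e' = e') (J : AddSubgroup S) (hl : ∀ a, ∀ x ∈ J, a * x ∈ J)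
    (hr : ∀ a, ∀ x ∈ J, x * a ∈ J) (heJ : e ∉ J) (heJ' : e' ∈ J)
    (h : IsRightPower φ (Submodule.span Sᵐᵒᵖ {e})) :
    ¬ IsRightPower φ (Submodule.span Sᵐᵒᵖ {e'}) := by
  intro h'
  let _ := rightModule φ
  obtain ⟨k, hk, ⟨f⟩⟩ := h
  obtain ⟨k', -, ⟨f'⟩⟩ := h'
  let Φ := f.symm.trans f'
  let v : Fin k → Submodule.span Sᵐᵒᵖ {e} := fun _ => ⟨e, Submodule.mem_span_singleton_self e⟩
  let ε : Submodule.span Sᵐᵒᵖ {e'} := ⟨e', Submodule.mem_span_singleton_self e'⟩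
  -- The coordinates of `Φ v` lie in `e' S`, hence in `J`. Pulling this expansion back along `Φ`
  -- writes the coordinate `e` of `v` as a sum of multiples of elements of `J`.
  have h1 : Φ v = ∑ i, op ((Φ v i : S)) • (Pi.single i ε : Fin k' → Submodule.span Sᵐᵒᵖ {e'}) := by
    ext i
    rw [Finset.sum_apply, Finset.sum_eq_single i]
    · rw [Pi.smul_apply, Pi.single_eq_same]
      exact ((mem_span_op_singleton he' _).1 (Φ v i).2).symm
    · intro j _ hj
      rw [Pi.smul_apply, Pi.single_eq_of_ne hj.symm, smul_zero]
    · simp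
  have h2 := congrArg (fun w => ((Φ.symm w ⟨0, hk⟩ : Submodule.span Sᵐᵒᵖ {e}) : S)) h1
  simp only [LinearEquiv.symm_apply_apply, map_sum, map_smul, Finset.sum_apply, Pi.smul_apply] at h2
  refine heJ ?_
  have h3 : e = ((v ⟨0, hk⟩ : Submodule.span Sᵐᵒᵖ {e}) : S) := rfl
  rw [h3, h2, AddSubmonoidClass.coe_finsetSum]
  refine sum_mem fun i _ => ?_
  change _ * (Φ v i : S) ∈ J
  refine hl _ _ ?_
  rw [← (mem_span_op_singleton he' _).1 (Φ v i).2]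
  exact hr _ _ heJ'

theorem not_isLeftPower_of_ideal {S T : Type v} [Ring S] [Ring T] {φ : S →+* T} {e e' : S}
    (he' : e' * e' = e') (J : AddSubgroup S) (hl : ∀ a, ∀ x ∈ J, a * x ∈ J)
    (hr : ∀ a, ∀ x ∈ J, x * a ∈ J) (heJ : e ∉ J) (heJ' : e' ∈ J)
    (h : IsLeftPower φ (Submodule.span S {e})) :
    ¬ IsLeftPower φ (Submodule.span S {e'}) := by
  intro h'
  let _ := leftModule φ
  obtain ⟨k, hk, ⟨f⟩⟩ := h
  obtain ⟨k', -, ⟨f'⟩⟩ := h'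
  let Φ := f.symm.trans f'
  let v : Fin k → Submodule.span S {e} := fun _ => ⟨e, Submodule.mem_span_singleton_self e⟩
  let ε : Submodule.span S {e'} := ⟨e', Submodule.mem_span_singleton_self e'⟩
  have h1 : Φ v = ∑ i, (Φ v i : S) • (Pi.single i ε : Fin k' → Submodule.span S {e'}) := by
    ext i
    rw [Finset.sum_apply, Finset.sum_eq_single i]
    · rw [Pi.smul_apply, Pi.single_eq_same]
      exact ((mem_span_singleton_idempotent he' _).1 (Φ v i).2).symm
    · intro j _ hj
      rw [Pi.smul_apply, Pi.single_eq_of_ne hj.symm, smul_zero]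
    · simp
  have h2 := congrArg (fun w => ((Φ.symm w ⟨0, hk⟩ : Submodule.span S {e}) : S)) h1
  simp only [LinearEquiv.symm_apply_apply, map_sum, map_smul, Finset.sum_apply, Pi.smul_apply] at h2
  refine heJ ?_
  have h3 : e = ((v ⟨0, hk⟩ : Submodule.span S {e}) : S) := rfl
  rw [h3, h2, AddSubmonoidClass.coe_finsetSum]
  refine sum_mem fun i _ => ?_
  change (Φ v i : S) * _ ∈ J
  refine hr _ _ ?_
  rw [← (mem_span_singleton_idempotent he' _).1 (Φ v i).2]
  exact hl _ _ heJ'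

end Powers

theorem IsLocalOrder.map {R E E' : Type*} [CommRing R] [Ring E] [Algebra R E] [Ring E']
    [Algebra R E'] {A : Subalgebra R E} (hA : IsLocalOrder A) (T : E ≃ₐ[R] E') :
    IsLocalOrder (A.map (T : E →ₐ[R] E')) := by
  refine ⟨?_, fun x => ?_⟩
  · rw [Subalgebra.map_toSubmodule]
    exact hA.1.map _
  · obtain ⟨r, hr, hrx⟩ := hA.2 (T.symm x)
    exact ⟨r, hr, r • T.symm x, hrx, by simp⟩

/-! ### Endomorphism rings of diagonal lattices -/

section DiagOrder

variable (R : Type*) {K ι : Type*} [CommRing R] [Field K] [Algebra R K] [Fintype ι]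
  [DecidableEq ι]

/-- The endomorphism ring of the lattice `⨁ u_a R`. -/
def diagOrder (u : ι → Kˣ) : Subalgebra R (Matrix ι ι K) where
  carrier := {M | ∀ a b, ((u a)⁻¹ : Kˣ) * M a b * u b ∈ (algebraMap R K).range}
  mul_mem' {M N} hM hN a b := by
    rw [Matrix.mul_apply, Finset.mul_sum, Finset.sum_mul]
    refine sum_mem fun c _ => ?_
    have h := mul_mem (hM a c) (hN c b)
    convert h using 1
    simp only [Units.val_inv_eq_inv_val]
    field_simp
  add_mem' {M N} hM hN a b := by
    rw [Matrix.add_apply, mul_add, add_mul]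
    exact add_mem (hM a b) (hN a b)
  algebraMap_mem' x a b := by
    rw [Matrix.algebraMap_matrix_apply]
    split_ifs with h
    · subst h
      exact ⟨x, by rw [Units.val_inv_eq_inv_val]; field_simp⟩
    · simp

variable {R}

theorem single_mem_diagOrder {u : ι → Kˣ} {a b : ι} {x : K} :
    Matrix.single a b x ∈ diagOrder R u ↔ ((u a)⁻¹ : Kˣ) * x * u b ∈ (algebraMap R K).range := by
  refine ⟨fun h => by simpa using h a b, fun h c d => ?_⟩
  rw [Matrix.single_apply]
  split_ifs with hcd
  · obtain ⟨rfl, rfl⟩ := hcd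
    exact h
  · simp

theorem isLocalOrder_diagOrder [IsDomain R] [IsFractionRing R K] (u : ι → Kˣ) :
    IsLocalOrder (diagOrder R u) := by
  refine ⟨?_, fun M => ?_⟩
  · let g : Matrix ι ι R →ₗ[R] Matrix ι ι K :=
      { toFun N := Matrix.of fun a b => (u a : K) * algebraMap R K (N a b) * ((u b)⁻¹ : Kˣ)
        map_add' N N' := by
          ext a b
          simp [mul_add, add_mul]
        map_smul' c N := by
          ext a b
          simp [Algebra.smul_def]
          ring }
    have h : Subalgebra.toSubmodule (diagOrder R u) = LinearMap.range g := by
      ext M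
      constructor
      · intro hM
        choose N hN using hM
        refine ⟨Matrix.of N, ?_⟩
        ext a b
        change (u a : K) * algebraMap R K (N a b) * ((u b)⁻¹ : Kˣ) = M a b
        rw [hN]
        simp only [Units.val_inv_eq_inv_val]
        field_simp
      · rintro ⟨N, rfl⟩ a b
        refine ⟨N a b, ?_⟩
        change _ = _ * ((u a : K) * algebraMap R K (N a b) * ((u b)⁻¹ : Kˣ)) * _
        simp only [Units.val_inv_eq_inv_val]
        field_simp
    rw [h, LinearMap.range_eq_map]
    exact Module.Finite.fg_top.map g
  · obtain ⟨b, hb⟩ := IsLocalization.exist_integer_multiples_of_finite (nonZeroDivisors R)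
      fun t : ι × ι => ((u t.1)⁻¹ : Kˣ) * M t.1 t.2 * (u t.2 : K)
    refine ⟨b, nonZeroDivisors.ne_zero b.2, fun a c => ?_⟩
    obtain ⟨y, hy⟩ := hb (a, c)
    refine ⟨y, hy.trans ?_⟩
    simp [Algebra.smul_def]
    ring

/-- The diagonal entries of a matrix unit multiple in an order are integral. -/
theorem mem_range_of_single_mem [IsFractionRing R K] [IsIntegrallyClosed R] [IsNoetherianRing R]
    {B : Subalgebra R (Matrix ι ι K)} (hB : IsLocalOrder B) {a : ι} {x : K}
    (hx : Matrix.single a a x ∈ B) (h1 : Matrix.single a a (1 : K) ∈ B) :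
    x ∈ (algebraMap R K).range := by
  -- The coefficients `y` with `y E_{a,a} ∈ B` form a ring which embeds into the Noetherian module
  -- `B`. It is finite over `R`, hence integral.
  let S : Subalgebra R K :=
    { carrier := {y | Matrix.single a a y ∈ B}
      mul_mem' := fun {y z} hy hz => by
        have := B.mul_mem hy hz
        rwa [Matrix.single_mul_single_same] at this
      add_mem' := fun {y z} hy hz => by
        have := B.add_mem hy hz
        rwa [← Matrix.single_add] at this
      algebraMap_mem' := fun c => by
        have := B.smul_mem h1 c
        rwa [Matrix.smul_single, ← Algebra.algebraMap_eq_smul_one] at this }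
  have hS : (Subalgebra.toSubmodule S).FG := by
    have := hB.finite
    have : IsNoetherian R (Subalgebra.toSubmodule B) := isNoetherian_of_isNoetherianRing_of_finite R B
    let g : S →ₗ[R] Subalgebra.toSubmodule B :=
      ((Matrix.singleLinearMap R a a).comp S.val.toLinearMap).codRestrict _ fun y => y.2
    have hg : Function.Injective g := fun y z hyz => by
      refine Subtype.ext ?_
      have := congrFun (congrFun (congrArg Subtype.val hyz) a) a
      change Matrix.single a a (y : K) a a = Matrix.single a a (z : K) a a at this
      simpa using this
    exact Module.Finite.iff_fg.1 (Module.Finite.of_injective g hg)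
  exact IsIntegrallyClosed.isIntegral_iff.1 (IsIntegral.of_mem_of_fg S hS x hx)

end DiagOrder

/-! ### The chain of lattices of a block order -/

section Weights

variable {K : Type*} [Field K] {r : ℕ} {n : Fin r → ℕ}

/-- The weights of the `j`-th lattice in the chain attached to a block order. -/
def blockWeight (π : Kˣ) (j : Fin r) (a : Σ i, Fin (n i)) : Kˣ := if j < a.1 then π else 1

/-- The first order contains the matrix unit in position `(a, b)` scaled by the quotient of its
weights. For `a` in block `j` and `b` in block `j' ≠ j`, its normalized entry for the second order
is `ϖ⁻¹`, whichever of `j`, `j'` is larger. -/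
theorem eq_of_diagOrder_le {R : Type*} [CommRing R] [Algebra R K] [IsFractionRing R K]
    {π : R} {ϖ : Kˣ} (hπ : Irreducible π) (hϖ : (ϖ : K) = algebraMap R K π)
    (hn : ∀ i, 0 < n i) {j j' : Fin r}
    (h : diagOrder R (blockWeight (n := n) ϖ j) ≤ diagOrder R (blockWeight ϖ j')) : j = j' := by
  have key (a b : Σ i, Fin (n i)) : ((blockWeight ϖ j' a)⁻¹ : Kˣ) *
      (blockWeight ϖ j a * (blockWeight ϖ j b)⁻¹ : Kˣ) * (blockWeight ϖ j' b : K) ∈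
        (algebraMap R K).range := by
    refine single_mem_diagOrder.1 (h (single_mem_diagOrder.2 ⟨1, ?_⟩))
    simp
  have hno : (ϖ : K)⁻¹ ∉ (algebraMap R K).range := by
    rintro ⟨y, hy⟩
    refine hπ.not_isUnit (IsUnit.of_mul_eq_one y ?_)
    apply IsFractionRing.injective R K
    rw [map_mul, hy, ← hϖ, map_one]
    simp
  by_contra hne
  have h1 := key ⟨j, 0, hn j⟩ ⟨j', 0, hn j'⟩
  refine hno ?_
  rcases lt_or_gt_of_ne hne with hlt | hlt
  · simpa [blockWeight, hlt, hlt.le, hlt.not_gt] using h1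
  · simpa [blockWeight, hlt, hlt.le, hlt.not_gt] using h1

end Weights

/-! ### Overorders of a block order -/

section Classification

variable {R K : Type*} [CommRing R] [IsDomain R] [IsDiscreteValuationRing R] [Field K]
  [Algebra R K] {r : ℕ} {n : Fin r → ℕ}

theorem single_mem_fracBlockOrder {a b : Σ i, Fin (n i)} {y : R}
    (hy : b.1 < a.1 → y ∈ IsLocalRing.maximalIdeal R) :
    Matrix.single a b (algebraMap R K y) ∈ fracBlockOrder R K n := by
  rw [mem_fracBlockOrder]
  intro a' b'
  rw [Matrix.single_apply]
  split_ifs with h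
  · obtain ⟨rfl, rfl⟩ := h
    exact ⟨y, rfl, hy⟩
  · exact ⟨0, map_zero _, fun _ => zero_mem _⟩

variable {π : R} {ϖ : Kˣ}

/-- Only entries with row block beyond `j` and column block not beyond `j` get divided by `ϖ`. They
lie strictly below the diagonal. -/
theorem fracBlockOrder_le_diagOrder (hπ : Irreducible π) (hϖ : (ϖ : K) = algebraMap R K π)
    (j : Fin r) :
    fracBlockOrder R K n ≤ diagOrder R (blockWeight ϖ j) := by
  intro M hM a b
  obtain ⟨y, hy, hym⟩ := (mem_fracBlockOrder R K M).1 hM a b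
  rw [← hy]
  unfold blockWeight
  by_cases ha : j < a.1 <;> by_cases hb : j < b.1
  · rw [if_pos ha, if_pos hb]
    exact ⟨y, by rw [Units.val_inv_eq_inv_val]; field_simp⟩
  · rw [if_pos ha, if_neg hb]
    have := hym ((not_lt.1 hb).trans_lt ha)
    rw [hπ.maximalIdeal_eq, Ideal.mem_span_singleton] at this
    obtain ⟨z, rfl⟩ := this
    refine ⟨z, ?_⟩
    rw [map_mul, ← hϖ]
    simp
  · rw [if_neg ha, if_pos hb]
    refine ⟨y * π, ?_⟩
    rw [map_mul, ← hϖ]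
    simp
  · rw [if_neg ha, if_neg hb]
    exact ⟨y, by simp⟩

/-- Every order which contains the block order is contained in one of the `r` standard maximal
orders. -/
theorem exists_le_diagOrder [IsFractionRing R K] (hπ : Irreducible π)
    (hϖ : (ϖ : K) = algebraMap R K π)
    (hr : 0 < r) (hn : ∀ i, 0 < n i)
    {B : Subalgebra R (Matrix (Σ i, Fin (n i)) (Σ i, Fin (n i)) K)} (hB : IsLocalOrder B)
    (h : fracBlockOrder R K n ≤ B) : ∃ j, B ≤ diagOrder R (blockWeight ϖ j) := by
  classical
  -- Column `o` of `B` is a lattice stable under `B`. Its entries are integral because `B` contains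
  -- the matrix units moving them to the diagonal position `(o, o)`. If `j` is the last block in
  -- which a unit occurs, the lattice has weights `blockWeight ϖ j`.
  let o : Σ i, Fin (n i) := ⟨⟨0, hr⟩, ⟨0, hn _⟩⟩
  have ho (a : Σ i, Fin (n i)) : o.1 ≤ a.1 := Fin.le_def.2 (Nat.zero_le _)
  have hone {a b : Σ i, Fin (n i)} (hab : a.1 ≤ b.1) : Matrix.single a b (1 : K) ∈ B := by
    rw [← map_one (algebraMap R K)]
    exact h (single_mem_fracBlockOrder fun h => absurd h (not_lt.2 hab))
  have hint (a) (x : K) (hx : Matrix.single a o x ∈ B) : x ∈ (algebraMap R K).range := by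
    refine mem_range_of_single_mem hB (a := o) ?_ (hone le_rfl)
    have := mul_mem (hone (ho a)) hx
    rwa [Matrix.single_mul_single_same, one_mul] at this
  let s : Finset (Fin r) := Finset.univ.filter fun i =>
    ∃ a : Σ i, Fin (n i), i ≤ a.1 ∧ Matrix.single a o (1 : K) ∈ B
  have hs : s.Nonempty := ⟨⟨0, hr⟩, by
    simp only [s, Finset.mem_filter, Finset.mem_univ, true_and]
    exact ⟨o, le_rfl, hone le_rfl⟩⟩
  obtain ⟨a₀, ha₀, ha₀B⟩ := (Finset.mem_filter.1 (s.max'_mem hs)).2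
  set j := s.max' hs
  have hsmall {b : Σ i, Fin (n i)} (hb : ¬ j < b.1) : Matrix.single b o (1 : K) ∈ B := by
    have := mul_mem (hone ((not_lt.1 hb).trans ha₀)) ha₀B
    rwa [Matrix.single_mul_single_same, one_mul] at this
  have hlarge {a : Σ i, Fin (n i)} (ha : j < a.1) (x : K) (hx : Matrix.single a o x ∈ B) :
      ∃ y, algebraMap R K y = (ϖ : K)⁻¹ * x := by
    obtain ⟨y, rfl⟩ := hint a x hx
    have hy : y ∈ IsLocalRing.maximalIdeal R := by
      rw [IsLocalRing.mem_maximalIdeal, mem_nonunits_iff]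
      intro hyu
      refine absurd ha (not_lt.2 (s.le_max' _ ?_))
      simp only [s, Finset.mem_filter, Finset.mem_univ, true_and]
      refine ⟨a, le_rfl, ?_⟩
      obtain ⟨z, hz⟩ := hyu.exists_left_inv
      have := B.smul_mem hx z
      rwa [Matrix.smul_single, Algebra.smul_def, ← map_mul, hz, map_one] at this
    rw [hπ.maximalIdeal_eq, Ideal.mem_span_singleton] at hy
    obtain ⟨z, rfl⟩ := hy
    refine ⟨z, ?_⟩
    rw [map_mul, ← hϖ]
    simp
  refine ⟨j, fun M hM a b => ?_⟩
  have hw : Matrix.single b o (blockWeight ϖ j b : K) ∈ B := by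
    unfold blockWeight
    split_ifs with hb
    · rw [hϖ]
      refine h (single_mem_fracBlockOrder fun _ => ?_)
      rw [hπ.maximalIdeal_eq]
      exact Ideal.mem_span_singleton_self π
    · rw [Units.val_one]
      exact hsmall hb
  have hx : Matrix.single a o (M a b * blockWeight ϖ j b) ∈ B := by
    have := mul_mem (mul_mem (hone (le_refl a.1)) hM) hw
    rwa [Matrix.single_mul_mul_single, one_mul] at this
  rw [mul_assoc]
  by_cases ha : j < a.1
  · obtain ⟨y, hy⟩ := hlarge ha _ hx
    refine ⟨y, hy.trans ?_⟩
    rw [show blockWeight ϖ j a = ϖ from if_pos ha, Units.val_inv_eq_inv_val]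
  · rw [show blockWeight ϖ j a = 1 from if_neg ha, inv_one, Units.val_one, one_mul]
    exact hint a _ hx

end Classification

/-! ### Rows and columns of the maximal overorders -/

section Types

variable {R K : Type*} [CommRing R] [IsDomain R] [IsDiscreteValuationRing R] [Field K]
  [Algebra R K] {r : ℕ} {n : Fin r → ℕ} {π : R} {ϖ : Kˣ}
  {E : Type v} [Ring E] [Algebra K E] [Algebra R E] {A B : Subalgebra R E}

/-- The overorder with weights `u` is a power of the row `α`. -/
theorem isRightPower_of_weight (hπ : Irreducible π) (hϖ : (ϖ : K) = algebraMap R K π)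
    (T : E ≃ₐ[K] Matrix (Σ i, Fin (n i)) (Σ i, Fin (n i)) K)
    (hA : ∀ x, x ∈ A ↔ T x ∈ fracBlockOrder R K n) {u : (Σ i, Fin (n i)) → Kˣ}
    (hB : ∀ x, x ∈ B ↔ T x ∈ diagOrder R u) (hAB : A ≤ B) (α : Σ i, Fin (n i)) (c : Kˣ)
    (hu : ∀ a, c = u a * if a.1 < α.1 then ϖ else 1) (e : A) (he : T e = Matrix.single α α 1) :
    IsRightPower ((Subalgebra.inclusion hAB : A →ₐ[R] B) : A →+* B)
      (Submodule.span Aᵐᵒᵖ {e}) := by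
  have hee : e * e = e := Subtype.ext (T.injective (by simp [he]))
  have : Nonempty (Σ i, Fin (n i)) := ⟨α⟩
  have hmem (a : Σ i, Fin (n i)) (x : K) (hx : x ∈ (algebraMap R K).range) :
      ∃ y : R, algebraMap R K y = c * ((u a)⁻¹ : Kˣ) * x ∧
        (a.1 < α.1 → y ∈ IsLocalRing.maximalIdeal R) := by
    obtain ⟨z, rfl⟩ := hx
    by_cases ha : a.1 < α.1
    · refine ⟨π * z, ?_, fun _ => ?_⟩
      · rw [hu a, if_pos ha, map_mul, ← hϖ]
        simp only [Units.val_mul, Units.val_inv_eq_inv_val]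
        field_simp
      · rw [hπ.maximalIdeal_eq]
        exact Ideal.mul_mem_right _ _ (Ideal.mem_span_singleton_self π)
    · refine ⟨z, ?_, fun h => absurd h ha⟩
      rw [hu a, if_neg ha]
      simp
  -- Entry `b` of row `a` of `B` ranges over `u a * (u b)⁻¹ R`, and by `hu` that of row `α` of `A`
  -- ranges over `c * (u b)⁻¹ R`. So multiplication by `c * (u a)⁻¹` identifies the two rows.
  refine isRightPower_of_matrixUnits hAB hee (κ := Σ i, Fin (n i))
    (fun a => T.symm (Matrix.single α a ((c * (u a)⁻¹ : Kˣ) : K)))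
    (fun a => T.symm (Matrix.single a α ((u a * c⁻¹ : Kˣ) : K))) (fun a x hx => ?_) (fun a => ?_)
    (fun a y hy => ?_) (fun a b => ?_) ?_
  · rw [hA, map_mul, AlgEquiv.apply_symm_apply, mem_fracBlockOrder]
    intro a' b
    by_cases ha' : a' = α
    · subst ha'
      rw [Matrix.single_mul_apply_same]
      obtain ⟨y, hy, hym⟩ := hmem b _ ((hB x).1 hx a b)
      refine ⟨y, hy.trans ?_, hym⟩
      simp only [Units.val_mul, Units.val_inv_eq_inv_val]
      field_simp
    · rw [Matrix.single_mul_apply_of_ne _ _ _ _ _ ha']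
      exact ⟨0, map_zero _, fun _ => zero_mem _⟩
  · apply T.injective
    rw [map_mul, AlgEquiv.apply_symm_apply, he, Matrix.single_mul_single_same, one_mul]
  · rw [hB, map_mul, map_mul, AlgEquiv.apply_symm_apply, he, ← mul_assoc,
      Matrix.single_mul_single_same, mul_one]
    intro a' b
    by_cases ha' : a' = a
    · subst ha'
      rw [Matrix.single_mul_apply_same]
      obtain ⟨z, hz, hzm⟩ := (mem_fracBlockOrder R K _).1 ((hA y).1 hy) α b
      rw [← hz]
      by_cases hb : b.1 < α.1
      · have := hzm hb
        rw [hπ.maximalIdeal_eq, Ideal.mem_span_singleton] at this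
        obtain ⟨w, rfl⟩ := this
        refine ⟨w, ?_⟩
        rw [hu b, if_pos hb, map_mul, ← hϖ]
        simp only [Units.val_mul, Units.val_inv_eq_inv_val]
        field_simp
      · refine ⟨z, ?_⟩
        rw [hu b, if_neg hb]
        simp only [Units.val_mul, Units.val_inv_eq_inv_val, Units.val_one]
        field_simp
    · rw [Matrix.single_mul_apply_of_ne _ _ _ _ _ ha']
      exact ⟨0, by simp⟩
  · apply T.injective
    rw [map_mul, map_mul, AlgEquiv.apply_symm_apply, AlgEquiv.apply_symm_apply, he,
      Matrix.single_mul_single_same, mul_one]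
    split_ifs with h
    · subst h
      rw [Matrix.single_mul_single_same, he, ← Units.val_mul]
      simp
    · rw [Matrix.single_mul_single_of_ne _ _ _ _ h, map_zero]
  · apply T.injective
    rw [map_sum, map_one]
    simp only [map_mul, AlgEquiv.apply_symm_apply, Matrix.single_mul_single_same, ← Units.val_mul]
    simp [Matrix.sum_single_one]

/-- The overorder with weights `u` is a power of the column `α`. -/
theorem isLeftPower_of_weight (hπ : Irreducible π) (hϖ : (ϖ : K) = algebraMap R K π)
    (T : E ≃ₐ[K] Matrix (Σ i, Fin (n i)) (Σ i, Fin (n i)) K)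
    (hA : ∀ x, x ∈ A ↔ T x ∈ fracBlockOrder R K n) {u : (Σ i, Fin (n i)) → Kˣ}
    (hB : ∀ x, x ∈ B ↔ T x ∈ diagOrder R u) (hAB : A ≤ B) (α : Σ i, Fin (n i))
    (hu : ∀ a, u a = if α.1 < a.1 then ϖ else 1) (e : A) (he : T e = Matrix.single α α 1) :
    IsLeftPower ((Subalgebra.inclusion hAB : A →ₐ[R] B) : A →+* B)
      (Submodule.span A {e}) := by
  have hee : e * e = e := Subtype.ext (T.injective (by simp [he]))
  have : Nonempty (Σ i, Fin (n i)) := ⟨α⟩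
  have hmem (a : Σ i, Fin (n i)) (x : K) (hx : x ∈ (algebraMap R K).range) :
      ∃ y : R, algebraMap R K y = u a * x ∧
        (α.1 < a.1 → y ∈ IsLocalRing.maximalIdeal R) := by
    obtain ⟨z, rfl⟩ := hx
    by_cases ha : α.1 < a.1
    · refine ⟨π * z, ?_, fun _ => ?_⟩
      · rw [hu a, if_pos ha, map_mul, ← hϖ]
      · rw [hπ.maximalIdeal_eq]
        exact Ideal.mul_mem_right _ _ (Ideal.mem_span_singleton_self π)
    · refine ⟨z, ?_, fun h => absurd h ha⟩
      rw [hu a, if_neg ha]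
      simp
  -- Entry `b` of column `a` of `B` ranges over `u b * (u a)⁻¹ R`, and that of column `α` of `A`
  -- over `u b R`.
  refine isLeftPower_of_matrixUnits hAB hee (κ := Σ i, Fin (n i))
    (fun a => T.symm (Matrix.single a α (u a : K)))
    (fun a => T.symm (Matrix.single α a ((u a)⁻¹ : Kˣ))) (fun a x hx => ?_) (fun a => ?_)
    (fun a y hy => ?_) (fun a b => ?_) ?_
  · rw [hA, map_mul, AlgEquiv.apply_symm_apply, mem_fracBlockOrder]
    intro b a'
    by_cases ha' : a' = α
    · subst ha'
      rw [Matrix.mul_single_apply_same]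
      obtain ⟨y, hy, hym⟩ := hmem b _ ((hB x).1 hx b a)
      refine ⟨y, hy.trans ?_, hym⟩
      simp only [Units.val_inv_eq_inv_val]
      field_simp
    · rw [Matrix.mul_single_apply_of_ne _ _ _ _ _ ha']
      exact ⟨0, map_zero _, fun _ => zero_mem _⟩
  · apply T.injective
    rw [map_mul, AlgEquiv.apply_symm_apply, he, Matrix.single_mul_single_same, mul_one]
  · rw [hB, map_mul, map_mul, AlgEquiv.apply_symm_apply, he, mul_assoc,
      Matrix.single_mul_single_same, one_mul]
    intro b a'
    by_cases ha' : a' = a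
    · subst ha'
      rw [Matrix.mul_single_apply_same]
      obtain ⟨z, hz, hzm⟩ := (mem_fracBlockOrder R K _).1 ((hA y).1 hy) b α
      rw [← hz]
      by_cases hb : α.1 < b.1
      · have := hzm hb
        rw [hπ.maximalIdeal_eq, Ideal.mem_span_singleton] at this
        obtain ⟨w, rfl⟩ := this
        refine ⟨w, ?_⟩
        rw [hu b, if_pos hb, map_mul, ← hϖ]
        simp only [Units.val_inv_eq_inv_val]
        field_simp
      · refine ⟨z, ?_⟩
        rw [hu b, if_neg hb]
        simp only [Units.val_inv_eq_inv_val, Units.val_one]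
        field_simp
    · rw [Matrix.mul_single_apply_of_ne _ _ _ _ _ ha']
      exact ⟨0, by simp⟩
  · apply T.injective
    rw [map_mul, map_mul, AlgEquiv.apply_symm_apply, AlgEquiv.apply_symm_apply, he,
      Matrix.single_mul_single_same, one_mul]
    split_ifs with h
    · subst h
      rw [Matrix.single_mul_single_same, he, ← Units.val_mul]
      simp
    · rw [Matrix.single_mul_single_of_ne _ _ _ _ (Ne.symm h), map_zero]
  · apply T.injective
    rw [map_sum, map_one]
    simp only [map_mul, AlgEquiv.apply_symm_apply, Matrix.single_mul_single_same, ← Units.val_mul]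
    simp [Matrix.sum_single_one]

end Types

/-! ### Two-sided ideals of block orders and the Azumaya property -/

section BlockIdeal

variable (R : Type*) [CommRing R] [IsLocalRing R] {r : ℕ} (n : Fin r → ℕ)

/-- The ideal of the block order of matrices whose `i`-th diagonal block has entries in the maximal
ideal. -/
def blockIdeal (i : Fin r) : AddSubgroup (blockOrder R n) where
  carrier := {M | ∀ s t : Fin (n i), M.1 ⟨i, s⟩ ⟨i, t⟩ ∈ IsLocalRing.maximalIdeal R}
  add_mem' hM hN s t := Ideal.add_mem _ (hM s t) (hN s t)
  zero_mem' _ _ := Ideal.zero_mem _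
  neg_mem' hM s t := neg_mem (hM s t)

variable {R n}

/-- In a diagonal entry of block `i`, a summand whose middle index lies outside block `i` has a
factor strictly below the diagonal. -/
theorem mul_mem_blockIdeal_left {i : Fin r} (M : blockOrder R n) {N : blockOrder R n}
    (hN : N ∈ blockIdeal R n i) : M * N ∈ blockIdeal R n i := by
  intro s t
  change (M.1 * N.1) ⟨i, s⟩ ⟨i, t⟩ ∈ _
  rw [Matrix.mul_apply]
  refine Ideal.sum_mem _ fun c _ => ?_
  rcases lt_trichotomy c.1 i with h | h | h
  · exact Ideal.mul_mem_right _ _ (M.2 ⟨i, s⟩ c h)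
  · obtain ⟨_, q⟩ := c
    obtain rfl : _ = i := h
    exact Ideal.mul_mem_left _ _ (hN q t)
  · exact Ideal.mul_mem_left _ _ (N.2 c ⟨i, t⟩ h)

theorem mul_mem_blockIdeal_right {i : Fin r} {M : blockOrder R n} (hM : M ∈ blockIdeal R n i)
    (N : blockOrder R n) : M * N ∈ blockIdeal R n i := by
  intro s t
  change (M.1 * N.1) ⟨i, s⟩ ⟨i, t⟩ ∈ _
  rw [Matrix.mul_apply]
  refine Ideal.sum_mem _ fun c _ => ?_
  rcases lt_trichotomy c.1 i with h | h | h
  · exact Ideal.mul_mem_right _ _ (M.2 ⟨i, s⟩ c h)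
  · obtain ⟨_, q⟩ := c
    obtain rfl : _ = i := h
    exact Ideal.mul_mem_right _ _ (hM s q)
  · exact Ideal.mul_mem_left _ _ (N.2 c ⟨i, t⟩ h)

theorem blockIdempotent_notMem_blockIdeal (hn : ∀ i, 0 < n i) (i : Fin r) :
    blockIdempotent R hn i ∉ blockIdeal R n i := by
  intro h
  have := h ⟨n i - 1, Nat.sub_lt (hn i) one_pos⟩ ⟨n i - 1, Nat.sub_lt (hn i) one_pos⟩
  simp [blockIdempotent] at this

theorem blockIdempotent_mem_blockIdeal (hn : ∀ i, 0 < n i) {i i' : Fin r} (h : i' ≠ i) :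
    blockIdempotent R hn i' ∈ blockIdeal R n i := by
  intro s t
  change Matrix.single _ _ (1 : R) _ _ ∈ _
  rw [Matrix.single_apply, if_neg]
  · exact zero_mem _
  · rintro ⟨h1, -⟩
    exact h (congrArg Sigma.fst h1)

theorem blockIdempotent_mul_self (hn : ∀ i, 0 < n i) (i : Fin r) :
    blockIdempotent R hn i * blockIdempotent R hn i = blockIdempotent R hn i := by
  refine Subtype.ext ?_
  change Matrix.single _ _ (1 : R) * Matrix.single _ _ (1 : R) = Matrix.single _ _ (1 : R)
  rw [Matrix.single_mul_single_same, one_mul]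

/-- A block order with an Azumaya structure has only one block. -/
theorem eq_one_of_isAzumaya (hr : 0 < r) (hn : ∀ i, 0 < n i) [IsAzumaya R (blockOrder R n)] :
    r = 1 := by
  by_contra hr1
  let i₀ : Fin r := ⟨0, hr⟩
  let i₁ : Fin r := ⟨1, by omega⟩
  have hi : i₁ ≠ i₀ := by simp [i₀, i₁]
  let x : Σ i, Fin (n i) := ⟨i₁, n i₁ - 1, Nat.sub_lt (hn i₁) one_pos⟩
  -- Over an Azumaya algebra every endomorphism is a sum of two-sided multiplications, so it
  -- preserves two-sided ideals. But `g` sends an idempotent in `blockIdeal R n i₀` to `1`.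
  let g : Module.End R (blockOrder R n) :=
    { toFun M := (M : Matrix _ _ R) x x • 1
      map_add' M N := add_smul _ _ _
      map_smul' c M := mul_smul _ _ _ }
  have hstable (t : TensorProduct R (blockOrder R n) (blockOrder R n)ᵐᵒᵖ) (M : blockOrder R n)
      (hM : M ∈ blockIdeal R n i₀) : AlgHom.mulLeftRight R _ t M ∈ blockIdeal R n i₀ := by
    induction t with
    | zero => simp
    | tmul a b =>
      rw [AlgHom.mulLeftRight_apply]
      exact mul_mem_blockIdeal_right (mul_mem_blockIdeal_left _ hM) _
    | add s t hs ht =>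
      rw [map_add]
      exact add_mem hs ht
  obtain ⟨t, ht⟩ := (IsAzumaya.bij (R := R) (A := blockOrder R n)).2 g
  have h1 := hstable t _ (blockIdempotent_mem_blockIdeal (R := R) hn hi)
  rw [ht] at h1
  have h2 : g (blockIdempotent R hn i₁) = 1 := by
    change (Matrix.single x x (1 : R)) x x • (1 : blockOrder R n) = 1
    rw [Matrix.single_apply_same, one_smul]
  rw [h2] at h1
  have h3 := h1 ⟨0, hn i₀⟩ ⟨0, hn i₀⟩
  simp at h3

theorem isAzumaya_blockOrder (hn : ∀ i, 0 < n i) (hr : r = 1) : IsAzumaya R (blockOrder R n) := by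
  subst hr
  have h : blockOrder R n = ⊤ := by
    refine top_unique fun M _ a b hab => absurd hab ?_
    rw [Subsingleton.elim a.1 b.1]
    exact lt_irrefl _
  have : Nonempty (Σ i, Fin (n i)) := ⟨⟨0, 0, hn 0⟩⟩
  have := IsAzumaya.matrix R (Σ i, Fin (n i))
  rw [h]
  exact IsAzumaya.of_AlgEquiv R _ _ Subalgebra.topEquiv.symm

end BlockIdeal

/-! ### Maximal overorders over a discrete valuation ring -/

section LocalOverorders

variable {R K : Type*} [CommRing R] [IsDomain R] [IsDiscreteValuationRing R] [Field K]
  [Algebra R K] [IsFractionRing R K] {r : ℕ} {n : Fin r → ℕ}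

theorem isLocalOrder_fracBlockOrder : IsLocalOrder (fracBlockOrder R K n) := by
  obtain ⟨π, hπ⟩ := IsDiscreteValuationRing.exists_irreducible R
  refine ⟨?_, fun M => ?_⟩
  · have : Module.Finite R (blockOrder R n) :=
      Module.Finite.iff_fg.2 (IsNoetherian.noetherian (Subalgebra.toSubmodule (blockOrder R n)))
    rw [fracBlockOrder, Subalgebra.map_toSubmodule]
    exact (Module.Finite.iff_fg.1 this).map _
  · obtain ⟨b, hb⟩ := IsLocalization.exist_integer_multiples_of_finite (nonZeroDivisors R)
      fun t : (Σ i, Fin (n i)) × (Σ i, Fin (n i)) => M t.1 t.2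
    -- The extra factor `π` takes care of the entries below the diagonal.
    refine ⟨π * b, mul_ne_zero hπ.ne_zero (nonZeroDivisors.ne_zero b.2), ?_⟩
    rw [mem_fracBlockOrder]
    intro a c
    obtain ⟨y, hy⟩ := hb (a, c)
    refine ⟨π * y, ?_, fun _ => ?_⟩
    · rw [map_mul, hy, Matrix.smul_apply, mul_smul, Algebra.smul_def π]
    · rw [hπ.maximalIdeal_eq]
      exact Ideal.mul_mem_right _ _ (Ideal.mem_span_singleton_self π)

variable {E : Type v} [Ring E] [Nontrivial E] [Algebra R E] {A : Subalgebra R E}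

theorem blockCount_pos (d : A ≃ₐ[R] blockOrder R n) : 0 < r := by
  refine Nat.pos_of_ne_zero fun hr => ?_
  subst hr
  have : Subsingleton (blockOrder R n) := ⟨fun M N => Subtype.ext (Matrix.ext fun a => a.1.elim0)⟩
  have h : (1 : A) = 0 := d.injective (Subsingleton.elim _ _)
  exact one_ne_zero (congrArg Subtype.val h : (1 : E) = 0)

/-- The maximal overorders of a local order isomorphic to a block order, and their types. -/
theorem exists_maximal_overorders (K : Type*) [Field K] [Algebra R K] [IsFractionRing R K]
    [Algebra K E] [IsScalarTower R K E] (hA : IsLocalOrder A)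
    (d : A ≃ₐ[R] blockOrder R n) (hn : ∀ i, 0 < n i) :
    ∃ (M : Fin r → Subalgebra R E) (σ : Equiv.Perm (Fin r)),
      (∀ j, A ≤ M j) ∧ (∀ j, IsLocalOrder (M j)) ∧
      (∀ B, IsLocalOrder B → A ≤ B → ∃ j, B ≤ M j) ∧ (∀ j j', M j ≤ M j' → j = j') ∧
      (r = 1 → ∀ j, M j ≤ A) ∧
      ∀ j B (h : A ≤ B), B = M j → ∀ i,
        (IsRightPower ((Subalgebra.inclusion h : A →ₐ[R] B) : A →+* B)
          (Submodule.span Aᵐᵒᵖ {d.symm (blockIdempotent R hn i)}) ↔ i = σ j) ∧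
        (IsLeftPower ((Subalgebra.inclusion h : A →ₐ[R] B) : A →+* B)
          (Submodule.span A {d.symm (blockIdempotent R hn i)}) ↔ i = j) := by
  obtain ⟨π, hπ⟩ := IsDiscreteValuationRing.exists_irreducible R
  obtain ⟨ϖ, hϖ⟩ : ∃ ϖ : Kˣ, (ϖ : K) = algebraMap R K π :=
    ⟨Units.mk0 (algebraMap R K π) (by simpa using hπ.ne_zero), rfl⟩
  obtain ⟨T, hT⟩ := exists_algEquiv_extension (K := K) hA.2
    (isLocalOrder_fracBlockOrder (R := R) (K := K) (n := n)).2 (d.trans (fracBlockOrderEquiv R K))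
  have hTA (x : E) : x ∈ A ↔ T x ∈ fracBlockOrder R K n := by
    refine ⟨fun hx => ?_, fun hx => ?_⟩
    · rw [hT ⟨x, hx⟩]
      exact Subtype.property _
    · have h1 := hT ((d.trans (fracBlockOrderEquiv R K)).symm ⟨T x, hx⟩)
      rw [AlgEquiv.apply_symm_apply] at h1
      rw [← T.injective h1]
      exact Subtype.property _
  let M (j : Fin r) : Subalgebra R E :=
    (diagOrder R (blockWeight (n := n) ϖ j)).map ((T.restrictScalars R).symm : _ →ₐ[R] E)
  have hM (j : Fin r) (x : E) : x ∈ M j ↔ T x ∈ diagOrder R (blockWeight (n := n) ϖ j) := by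
    constructor
    · rintro ⟨y, hy, rfl⟩
      change T (T.symm y) ∈ _
      rwa [T.apply_symm_apply]
    · exact fun h => ⟨T x, h, T.symm_apply_apply x⟩
  have hr : 0 < r := blockCount_pos d
  have he (i : Fin r) : T (d.symm (blockIdempotent R hn i)) =
      Matrix.single ⟨i, n i - 1, Nat.sub_lt (hn i) one_pos⟩
        ⟨i, n i - 1, Nat.sub_lt (hn i) one_pos⟩ 1 := by
    rw [hT, AlgEquiv.trans_apply, AlgEquiv.apply_symm_apply, coe_fracBlockOrderEquiv]
    exact (Matrix.map_single _ _ _ _).trans (by rw [map_one])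
  have hee (i : Fin r) : d.symm (blockIdempotent R hn i) * d.symm (blockIdempotent R hn i) =
      d.symm (blockIdempotent R hn i) := by
    rw [← map_mul, blockIdempotent_mul_self]
  let J (i : Fin r) : AddSubgroup A := (blockIdeal R n i).comap (d : A →+ blockOrder R n)
  have hJl (i : Fin r) (a : A) : ∀ x ∈ J i, a * x ∈ J i := fun x hx => by
    change d (a * x) ∈ blockIdeal R n i
    rw [map_mul]
    exact mul_mem_blockIdeal_left _ hx
  have hJr (i : Fin r) (a : A) : ∀ x ∈ J i, x * a ∈ J i := fun x hx => by
    change d (x * a) ∈ blockIdeal R n i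
    rw [map_mul]
    exact mul_mem_blockIdeal_right hx _
  have hJe (i : Fin r) : d.symm (blockIdempotent R hn i) ∉ J i := by
    change d _ ∉ blockIdeal R n i
    rw [d.apply_symm_apply]
    exact blockIdempotent_notMem_blockIdeal hn i
  have hJe' {i i' : Fin r} (h : i' ≠ i) : d.symm (blockIdempotent R hn i') ∈ J i := by
    change d _ ∈ blockIdeal R n i
    rw [d.apply_symm_apply]
    exact blockIdempotent_mem_blockIdeal hn h
  -- The column of `A` with the weights of `M j` is in block `j`. The row with the inverse weights,
  -- up to scaling, is in block `j + 1`, because the entries of a row of `A` drop to `𝔪` before its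
  -- own block. For the last `j` all weights are `1` and the row is in block `0`.
  refine ⟨M, finRotate r, fun j x hx => (hM j x).2 (fracBlockOrder_le_diagOrder hπ hϖ j
    ((hTA x).1 hx)), fun j => (isLocalOrder_diagOrder _).map _, fun B hB hAB => ?_,
    fun j j' hjj => ?_, fun hr1 j x hx => ?_, fun j B h hBj i => ?_⟩
  · obtain ⟨j, hj⟩ := exists_le_diagOrder hπ hϖ hr hn (hB.map (T.restrictScalars R))
      (fun x hx => ⟨T.symm x, hAB ((hTA _).2 (by rwa [T.apply_symm_apply])), T.apply_symm_apply x⟩)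
    exact ⟨j, fun x hx => (hM j x).2 (hj ⟨x, hx, rfl⟩)⟩
  · refine eq_of_diagOrder_le hπ hϖ hn fun x hx => ?_
    have h1 := (hM j' _).1 (hjj ((hM j (T.symm x)).2 (by rwa [T.apply_symm_apply])))
    rwa [T.apply_symm_apply] at h1
  · rw [hTA, mem_fracBlockOrder]
    subst hr1
    intro a b
    obtain ⟨y, hy⟩ := (hM j x).1 hx a b
    have hw (a : Σ i, Fin (n i)) : blockWeight ϖ j a = 1 :=
      if_neg (by rw [Subsingleton.elim a.1 j]; exact lt_irrefl _)
    refine ⟨y, by simpa [hw] using hy, fun h => absurd h ?_⟩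
    rw [Subsingleton.elim a.1 b.1]
    exact lt_irrefl _
  · subst hBj
    have hright : IsRightPower ((Subalgebra.inclusion h : A →ₐ[R] M j) : A →+* M j)
        (Submodule.span Aᵐᵒᵖ {d.symm (blockIdempotent R hn (finRotate r j))}) := by
      obtain ⟨s, rfl⟩ := Nat.exists_eq_succ_of_ne_zero hr.ne'
      by_cases hj : j = Fin.last s
      · subst hj
        refine isRightPower_of_weight hπ hϖ T hTA (hM _) h _ 1 (fun a => ?_) _ (he _)
        rw [blockWeight, if_neg (Fin.le_last _).not_gt, if_neg, one_mul]
        change ¬ a.1 < finRotate (s + 1) (Fin.last s)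
        rw [finRotate_last]
        exact (Fin.zero_le _).not_gt
      · refine isRightPower_of_weight hπ hϖ T hTA (hM _) h _ ϖ (fun a => ?_) _ (he _)
        have hlt : a.1 < finRotate (s + 1) j ↔ ¬ j < a.1 := by
          rw [finRotate_apply, not_lt, Fin.lt_def,
            Fin.val_add_one_of_lt (Fin.lt_last_iff_ne_last.2 hj), Fin.le_def]
          omega
        change ϖ = (if j < a.1 then ϖ else 1) * if a.1 < finRotate (s + 1) j then ϖ else 1
        by_cases ha : j < a.1
        · rw [if_pos ha, if_neg fun h => hlt.1 h ha, mul_one]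
        · rw [if_neg ha, if_pos (hlt.2 ha), one_mul]
    have hleft : IsLeftPower ((Subalgebra.inclusion h : A →ₐ[R] M j) : A →+* M j)
        (Submodule.span A {d.symm (blockIdempotent R hn j)}) :=
      isLeftPower_of_weight hπ hϖ T hTA (hM _) h _ (fun a => rfl) _ (he _)
    refine ⟨⟨fun hi => ?_, fun hi => hi ▸ hright⟩, ⟨fun hi => ?_, fun hi => hi ▸ hleft⟩⟩
    · by_contra hne
      exact not_isRightPower_of_ideal (hee i) (J _) (hJl _) (hJr _) (hJe _) (hJe' hne) hright hi
    · by_contra hne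
      exact not_isLeftPower_of_ideal (hee i) (J _) (hJl _) (hJr _) (hJe _) (hJe' hne) hleft hi

end LocalOverorders

/-! ### Sections and stalks of orders -/

section Sections

variable {X : Scheme.{u}} [IsIntegral X] {D : Type v} [Ring D] [Algebra X.functionField D]

instance isScalarTower_stalk (p : X) : IsScalarTower (X.presheaf.stalk p) X.functionField D :=
  IsScalarTower.of_algebraMap_eq fun _ => rfl

instance isScalarTower_sections (U : X.Opens) [Nonempty U] :
    IsScalarTower Γ(X, U) X.functionField D :=
  IsScalarTower.of_algebraMap_eq fun _ => rfl

theorem germ_smul {U : X.Opens} [Nonempty U] {p : X} (hp : p ∈ U) (t : Γ(X, U)) (x : D) :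
    X.presheaf.germ U p hp t • x = t • x := by
  rw [Algebra.smul_def, Algebra.smul_def]
  congr 1
  change algebraMap X.functionField D (algebraMap (X.presheaf.stalk p) X.functionField _) =
    algebraMap X.functionField D (algebraMap Γ(X, U) X.functionField t)
  rw [Scheme.algebraMap_germ_eq_germToFunctionField]
  rfl

theorem germ_injective {U : X.Opens} {p : X} (hp : p ∈ U) :
    Function.Injective (X.presheaf.germ U p hp) := by
  have : Nonempty U := ⟨⟨p, hp⟩⟩
  intro s t hst
  apply X.germToFunctionField_injective U
  rw [← X.algebraMap_germ_eq_germToFunctionField hp, hst,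
    X.algebraMap_germ_eq_germToFunctionField hp]

namespace OrderIn

variable (A : OrderIn X D)

theorem mem_stalk_of_mem_sections {U : X.Opens} [h : Nonempty U] {p : X} (hp : p ∈ U) {x : D}
    (hx : x ∈ A.sections U) : x ∈ A.stalk p := ⟨U, h, hp, hx⟩

theorem mem_sections_iff {U : X.Opens} [Nonempty U] {x : D} :
    x ∈ A.sections U ↔ ∀ p ∈ U, x ∈ A.stalk p := by
  refine ⟨fun hx p hp => A.mem_stalk_of_mem_sections hp hx, fun h => A.local_mem U x ?_⟩
  intro p hp
  obtain ⟨V, hV, hpV, hxV⟩ := h p hp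
  have : Nonempty (U ⊓ V : X.Opens) := ⟨⟨p, hp, hpV⟩⟩
  exact ⟨U ⊓ V, this, ⟨hp, hpV⟩, inf_le_left, A.restrict _ V inf_le_right x hxV⟩

variable {A} in
theorem le_iff_stalk_le {B : OrderIn X D} : A ≤ B ↔ ∀ p, A.stalk p ≤ B.stalk p := by
  refine ⟨fun h p => stalk_mono h p, fun h U _ x hx => ?_⟩
  exact B.mem_sections_iff.2 fun p hp => h p (A.mem_sections_iff.1 hx p hp)

theorem mem_stalk_genericPoint (x : D) : x ∈ A.stalk (genericPoint X) := by
  obtain ⟨U, hU, hx⟩ := A.generic x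
  exact A.mem_stalk_of_mem_sections (genericPoint_mem U) hx

/-- An element of a stalk becomes a section on an affine neighbourhood after multiplication by a
function which does not vanish at the point. -/
theorem exists_smul_mem_of_mem_stalk {U : X.Opens} [Nonempty U] (hU : IsAffineOpen U) {p : X}
    (hp : p ∈ U) {x : D} (hx : x ∈ A.stalk p) :
    ∃ s : Γ(X, U), p ∈ X.basicOpen s ∧ s • x ∈ A.sections U := by
  obtain ⟨V, hV, hpV, hxV⟩ := hx
  obtain ⟨g, hgV, hpg⟩ := hU.exists_basicOpen_le (V := V) ⟨p, hpV⟩ hp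
  have : Nonempty (X.basicOpen g) := ⟨⟨p, hpg⟩⟩
  obtain ⟨m, hm⟩ := A.quasiCoherent U hU g x (A.restrict _ V hgV x hxV)
  refine ⟨g ^ m, ?_, hm⟩
  rw [Scheme.mem_basicOpen _ _ _ hp, map_pow] at *
  exact IsUnit.pow m hpg

theorem exists_smul_mem_sections {U : X.Opens} [Nonempty U] (hU : IsAffineOpen U) (x : D) :
    ∃ s : Γ(X, U), s ≠ 0 ∧ s • x ∈ A.sections U := by
  obtain ⟨s, hs, hsx⟩ := A.exists_smul_mem_of_mem_stalk hU (genericPoint_mem U)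
    (A.mem_stalk_genericPoint x)
  refine ⟨s, ?_, hsx⟩
  rintro rfl
  rw [Scheme.mem_basicOpen _ _ _ (genericPoint_mem U), map_zero] at hs
  exact not_isUnit_zero hs

/-- Generators of the sections over an affine open generate the stalks. -/
theorem stalk_eq_span {U : X.Opens} [Nonempty U] (hU : IsAffineOpen U) {p : X} (hp : p ∈ U)
    {T : Set D} (hT : Submodule.span Γ(X, U) T = Subalgebra.toSubmodule (A.sections U)) :
    Submodule.span (X.presheaf.stalk p) T = Subalgebra.toSubmodule (A.stalk p) := by
  have hle : ∀ y ∈ Submodule.span Γ(X, U) T, y ∈ Submodule.span (X.presheaf.stalk p) T := by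
    intro y hy
    induction hy using Submodule.span_induction with
    | mem y hy => exact Submodule.subset_span hy
    | zero => exact zero_mem _
    | add y z _ _ hy hz => exact add_mem hy hz
    | smul a y _ hy =>
      rw [← germ_smul hp]
      exact Submodule.smul_mem _ _ hy
  refine le_antisymm (Submodule.span_le.2 fun y hy => ?_) fun x hx => ?_
  · refine A.mem_stalk_of_mem_sections hp ?_
    have := Submodule.subset_span (R := Γ(X, U)) hy
    rwa [hT] at this
  · obtain ⟨s, hs, hsx⟩ := A.exists_smul_mem_of_mem_stalk hU hp hx
    rw [Scheme.mem_basicOpen _ _ _ hp] at hs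
    have h1 := hle (s • x) (hT ▸ hsx)
    rw [← germ_smul hp] at h1
    obtain ⟨w, hw⟩ := hs.exists_left_inv
    have h2 := Submodule.smul_mem _ w h1
    rwa [smul_smul, hw, one_smul] at h2

theorem isLocalOrder_stalk (p : X) : IsLocalOrder (A.stalk p) := by
  obtain ⟨U, hU, hp, -⟩ := exists_isAffineOpen_mem_and_subset (x := p) (U := ⊤) trivial
  have : Nonempty U := ⟨⟨p, hp⟩⟩
  refine ⟨?_, fun x => ?_⟩
  · obtain ⟨T, hT⟩ := A.finite U hU
    exact ⟨T, A.stalk_eq_span hU hp hT⟩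
  · obtain ⟨s, hs, hsx⟩ := A.exists_smul_mem_sections hU x
    refine ⟨X.presheaf.germ U p hp s, ?_, ?_⟩
    · rw [Ne, ← map_zero (X.presheaf.germ U p hp).hom]
      exact fun h => hs (germ_injective hp h)
    · rw [germ_smul]
      exact A.mem_stalk_of_mem_sections hp hsx

end OrderIn

end Sections

/-! ### Gluing prescribed stalks -/

section Gluing

variable {k : Type u} [Field k] {C : Scheme.{u}} [IsIntegral C] {D : Type v} [Ring D]
  [Algebra C.functionField D]

theorem isOpen_compl_of_finite (f : C ⟶ Spec (CommRingCat.of k)) [SmoothOfRelativeDimension 1 f]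
    {S : Set C} (hS : S.Finite) (hg : genericPoint C ∉ S) : IsOpen Sᶜ := by
  rw [isOpen_compl_iff, ← Set.biUnion_of_singleton S]
  exact hS.isClosed_biUnion fun p hp => isClosed_singleton f fun h => hg (h ▸ hp)

/-- An element of `D` belongs to almost all stalks. -/
theorem finite_notMem_stalk (f : C ⟶ Spec (CommRingCat.of k)) [SmoothOfRelativeDimension 1 f]
    [QuasiCompact f] (A : OrderIn C D) (x : D) : {p | x ∉ A.stalk p}.Finite := by
  obtain ⟨U, hU, hx⟩ := A.generic x
  refine (finite_compl f U).subset fun p hp hpU => hp ?_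
  exact A.mem_stalk_of_mem_sections hpU hx

/-- A denominator of `x` is associated to some `π ^ m`, which divides `g ^ m`. -/
theorem exists_pow_smul_mem {R E : Type*} [CommRing R] [IsDomain R] [IsDiscreteValuationRing R]
    [Ring E] [Algebra R E] {M : Subalgebra R E} (hM : IsLocalOrder M) {g : R} (hg : ¬ IsUnit g)
    (x : E) : ∃ m : ℕ, g ^ m • x ∈ M := by
  obtain ⟨π, hπ⟩ := IsDiscreteValuationRing.exists_irreducible R
  obtain ⟨r, hr, hrx⟩ := hM.2 x
  obtain ⟨m, hm⟩ := IsDiscreteValuationRing.associated_pow_irreducible hr hπ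
  have hgm : g ∈ IsLocalRing.maximalIdeal R := hg
  rw [hπ.maximalIdeal_eq, Ideal.mem_span_singleton] at hgm
  obtain ⟨w, hw⟩ := hm.dvd.trans (pow_dvd_pow_of_dvd hgm m)
  refine ⟨m, ?_⟩
  rw [hw, mul_comm, mul_smul]
  exact M.smul_mem hrx w

variable (A : OrderIn C D) (M : ∀ p : C, Subalgebra (C.presheaf.stalk p) D)

/-- This is quasi-coherence of the glued sheaf. A positive exponent is needed only at the finitely
many points where `x` is not in the stalk of `A`. -/
theorem exists_pow_smul_mem_of_affine (f : C ⟶ Spec (CommRingCat.of k))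
    [SmoothOfRelativeDimension 1 f] [QuasiCompact f] (hA : ∀ p, A.stalk p ≤ M p)
    (hM : ∀ p, IsLocalOrder (M p)) {U : C.Opens} [Nonempty U] (g : Γ(C, U))
    [Nonempty (C.basicOpen g)] {x : D} (hx : ∀ p ∈ C.basicOpen g, x ∈ M p) :
    ∃ m : ℕ, ∀ p ∈ U, g ^ m • x ∈ M p := by
  classical
  have h1 (p : C) : ∃ m : ℕ, p ∈ U → g ^ m • x ∈ M p := by
    by_cases hpU : p ∈ U
    · by_cases hp : p ∈ C.basicOpen g
      · exact ⟨0, fun _ => by rw [pow_zero, one_smul]; exact hx p hp⟩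
      · have := isDiscreteValuationRing_stalk f (p := p) fun h => hp (h ▸ genericPoint_mem _)
        rw [Scheme.mem_basicOpen _ _ _ hpU] at hp
        obtain ⟨m, hm⟩ := exists_pow_smul_mem (hM p) hp x
        refine ⟨m, fun _ => ?_⟩
        rwa [← map_pow, germ_smul] at hm
    · exact ⟨0, fun h => absurd h hpU⟩
  choose m hm using h1
  have hfin := finite_notMem_stalk f A x
  refine ⟨hfin.toFinset.sup m, fun p hpU => ?_⟩
  by_cases hp : x ∈ A.stalk p
  · rw [← germ_smul hpU]
    exact (M p).smul_mem (hA p hp) _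
  · have hle : m p ≤ hfin.toFinset.sup m := Finset.le_sup (by simpa using hp)
    obtain ⟨l, hl⟩ := Nat.exists_eq_add_of_le hle
    rw [hl, add_comm, pow_add, mul_smul, ← germ_smul hpU (g ^ l)]
    exact (M p).smul_mem (hm p hpU) _

/-- At the exceptional points finitely many generators have a common denominator. Multiplication by
it will embed the glued sections into those of `A`, which makes them finitely generated. -/
theorem exists_smul_mem_of_affine (hM : ∀ p, IsLocalOrder (M p))
    (hfin : {p | M p ≠ A.stalk p}.Finite) {U : C.Opens} [Nonempty U] (hU : IsAffineOpen U) :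
    ∃ g : Γ(C, U), g ≠ 0 ∧ ∀ x, (∀ p ∈ U, x ∈ M p) → g • x ∈ A.sections U := by
  classical
  choose T hT using fun p => (hM p).1
  obtain ⟨g, hg, hgT⟩ := exists_smul_mem_of_fg (R := Γ(C, U))
    (Q := Subalgebra.toSubmodule (A.sections U)) (A.exists_smul_mem_sections hU)
    (Submodule.fg_span (hfin.toFinset.biUnion T).finite_toSet)
  refine ⟨g, hg, fun x hx => A.mem_sections_iff.2 fun p hpU => ?_⟩
  by_cases hp : M p = A.stalk p
  · rw [← germ_smul hpU]
    exact (A.stalk p).smul_mem (hp ▸ hx p hpU) _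
  · have hxp : x ∈ Submodule.span (C.presheaf.stalk p) (T p : Set D) := by
      rw [hT]
      exact hx p hpU
    rw [← germ_smul hpU]
    clear hx
    induction hxp using Submodule.span_induction with
    | mem y hy =>
      rw [germ_smul]
      refine A.mem_stalk_of_mem_sections hpU (hgT y (Submodule.subset_span ?_))
      exact Finset.mem_coe.2 (Finset.mem_biUnion.2 ⟨p, by simpa using hp, hy⟩)
    | zero =>
      rw [smul_zero]
      exact zero_mem _
    | add y z _ _ hy hz =>
      rw [smul_add]
      exact add_mem hy hz
    | smul a y _ hy =>
      rw [smul_comm]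
      exact (A.stalk p).smul_mem hy a

/-- There is an overorder of `A` with prescribed stalks at finitely many points. -/
theorem exists_stalk_eq (f : C ⟶ Spec (CommRingCat.of k))
    [SmoothOfRelativeDimension 1 f] [QuasiCompact f] (hA : ∀ p, A.stalk p ≤ M p)
    (hM : ∀ p, IsLocalOrder (M p)) (hfin : {p | M p ≠ A.stalk p}.Finite) :
    ∃ B : OrderIn C D, ∀ p, B.stalk p = M p := by
  let S (U : C.Opens) [Nonempty U] : Subalgebra Γ(C, U) D :=
    { carrier := {x | ∀ p ∈ U, x ∈ M p}
      mul_mem' := fun hx hy p hp => (M p).mul_mem (hx p hp) (hy p hp)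
      add_mem' := fun hx hy p hp => (M p).add_mem (hx p hp) (hy p hp)
      algebraMap_mem' := fun s p hp => hA p (A.mem_stalk_of_mem_sections hp
        ((A.sections U).algebraMap_mem s)) }
  have hnoeth := isLocallyNoetherian_of_smooth f
  let B : OrderIn C D :=
    { sections := S
      restrict := fun U V _ _ h x hx p hp => hx p (h hp)
      local_mem := fun V _ x h p hp => by
        obtain ⟨U, _, hpU, -, hx⟩ := h p hp
        exact hx p hpU
      quasiCoherent := fun U _ hU g _ x hx =>
        exists_pow_smul_mem_of_affine A M f hA hM g hx
      finite := fun U _ hU => by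
        obtain ⟨g, hg, hgx⟩ := exists_smul_mem_of_affine A M hM hfin hU
        have : IsNoetherianRing Γ(C, U) := hnoeth.component_noetherian ⟨U, hU⟩
        have : FaithfulSMul Γ(C, U) C.functionField :=
          (faithfulSMul_iff_algebraMap_injective _ _).2 (C.germToFunctionField_injective U)
        have : Module.IsTorsionFree Γ(C, U) D :=
          Module.IsTorsionFree.trans_faithfulSMul Γ(C, U) C.functionField D
        have : Module.Finite Γ(C, U) (Subalgebra.toSubmodule (A.sections U)) :=
          Module.Finite.iff_fg.2 (A.finite U hU)
        let φ : Subalgebra.toSubmodule (S U) →ₗ[Γ(C, U)] Subalgebra.toSubmodule (A.sections U) :=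
          ((LinearMap.lsmul Γ(C, U) D g).comp (Submodule.subtype _)).codRestrict _
            fun x => hgx x x.2
        have hφ : Function.Injective φ := fun x y hxy =>
          Subtype.ext (smul_right_injective D hg (congrArg Subtype.val hxy))
        exact Module.Finite.iff_fg.1 (Module.Finite.of_injective φ hφ)
      generic := fun x => by
        obtain ⟨U, hU, hx⟩ := A.generic x
        exact ⟨U, hU, fun p hp => hA p (A.mem_stalk_of_mem_sections hp hx)⟩ }
  refine ⟨B, fun p => le_antisymm ?_ fun x hx => ?_⟩
  · rintro x ⟨U, hU, hp, hx⟩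
    exact hx p hp
  -- Removing the finitely many points where `x` is not allowed leaves a neighbourhood of `p` on
  -- which `x` is a section.
  · have hbad : {q | x ∉ M q}.Finite :=
      (finite_notMem_stalk f A x).subset fun q hq h => hq (hA q h)
    let U : C.Opens := ⟨_, isOpen_compl_of_finite f hbad
      fun h => h (hA _ (A.mem_stalk_genericPoint x))⟩
    have hpU : p ∈ U := fun h => h hx
    exact ⟨U, ⟨⟨p, hpU⟩⟩, hpU, fun q hq => not_not.1 hq⟩

end Gluing

theorem projective_submodule_of_ringEquiv {S S' : Type*} [Semiring S] [Semiring S'] (e : S ≃+* S')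
    (h : ∀ I : Submodule S S, Module.Projective S I) (I : Submodule S' S') :
    Module.Projective S' I := by
  let _ := RingHomInvPair.of_ringEquiv e
  let _ := RingHomInvPair.symm (e : S →+* S') (e.symm : S' →+* S)
  let J : Ideal S := Ideal.comap e I
  have := h J
  let φ : J ≃ₛₗ[(e : S →+* S')] I :=
    { toFun x := ⟨e x, x.2⟩
      invFun y := ⟨e.symm y, by
        change e (e.symm y) ∈ I
        rw [e.apply_symm_apply]
        exact y.2⟩
      map_add' x y := Subtype.ext (map_add e _ _)
      map_smul' c x := Subtype.ext (map_mul e _ _)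
      left_inv x := Subtype.ext (e.symm_apply_apply _)
      right_inv y := Subtype.ext (e.apply_symm_apply _) }
  exact Module.Projective.of_equiv φ

/-- An order which contains a full set of matrix units is Azumaya. -/
theorem isAzumaya_of_matrixUnits {R K E ι : Type*} [CommRing R] [IsDomain R] [IsIntegrallyClosed R]
    [IsNoetherianRing R] [Field K] [Algebra R K] [IsFractionRing R K] [Ring E] [Algebra K E]
    [Algebra R E] [IsScalarTower R K E] [Fintype ι] [DecidableEq ι] [Nonempty ι]
    (T : E ≃ₐ[K] Matrix ι ι K) {A : Subalgebra R E} (hA : IsLocalOrder A)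
    (h : ∀ a b, T.symm (Matrix.single a b 1) ∈ A) : IsAzumaya R A := by
  have hmem (a b : ι) : Matrix.single a b (1 : K) ∈
      A.map (T.restrictScalars R : E →ₐ[R] Matrix ι ι K) := ⟨_, h a b, T.apply_symm_apply _⟩
  -- Multiplication by matrix units isolates each entry, which is integral; so the order is the full
  -- matrix ring over `R`.
  have hT : A.map (T.restrictScalars R : E →ₐ[R] Matrix ι ι K) =
      ((Algebra.ofId R K).mapMatrix : Matrix ι ι R →ₐ[R] Matrix ι ι K).range := by
    refine le_antisymm (fun M hM => ?_) ?_
    · have hent (a b : ι) : M a b ∈ (algebraMap R K).range := by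
        refine mem_range_of_single_mem (hA.map (T.restrictScalars R)) (a := a) ?_ (hmem a a)
        have := mul_mem (mul_mem (hmem a a) hM) (hmem b a)
        rwa [Matrix.single_mul_mul_single, one_mul, mul_one] at this
      choose y hy using hent
      exact ⟨Matrix.of y, Matrix.ext hy⟩
    · rintro _ ⟨M, rfl⟩
      change (Algebra.ofId R K).mapMatrix M ∈ _
      rw [Matrix.matrix_eq_sum_single ((Algebra.ofId R K).mapMatrix M)]
      refine sum_mem fun a _ => sum_mem fun b _ => ?_
      have := Subalgebra.smul_mem _ (hmem a b) (M a b)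
      rwa [Matrix.smul_single, ← Algebra.algebraMap_eq_smul_one] at this
  have hinj : Function.Injective ((Algebra.ofId R K).mapMatrix : Matrix ι ι R →ₐ[R] Matrix ι ι K) :=
    Matrix.map_injective (FaithfulSMul.algebraMap_injective R K)
  have := IsAzumaya.matrix R ι
  exact IsAzumaya.of_AlgEquiv R _ _ (((AlgEquiv.ofInjective _ hinj).trans
    (Subalgebra.equivOfEq _ _ hT.symm)).trans
      (A.equivMapOfInjective _ (T.restrictScalars R).injective).symm)

/-! ### The ramification locus -/

section Curve

variable {k : Type u} [Field k] {C : Scheme.{u}} [IsIntegral C]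
  {D : Type v} [Ring D] [Algebra C.functionField D]

theorem isIntegrallyClosed_stalk (f : C ⟶ Spec (CommRingCat.of k)) [SmoothOfRelativeDimension 1 f]
    (p : C) : IsIntegrallyClosed (C.presheaf.stalk p) := by
  by_cases hp : p = genericPoint C
  · subst hp
    exact inferInstanceAs (IsIntegrallyClosed C.functionField)
  · have := isDiscreteValuationRing_stalk f hp
    infer_instance

theorem notMem_ramificationLocus (f : C ⟶ Spec (CommRingCat.of k))
    [SmoothOfRelativeDimension 1 f] {A : OrderIn C D} {S : Set C} (hS : S.Finite)
    (hg : genericPoint C ∉ S) (h : ∀ p ∉ S, IsAzumaya (C.presheaf.stalk p) (A.stalk p)) {p : C}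
    (hp : p ∉ S) : p ∉ A.ramificationLocus :=
  fun hpA => hpA ⟨⟨_, isOpen_compl_of_finite f hS hg⟩, hp, fun q hq => h q hq⟩

theorem isAzumaya_of_notMem_ramificationLocus {A : OrderIn C D} {p : C}
    (hp : p ∉ A.ramificationLocus) : IsAzumaya (C.presheaf.stalk p) (A.stalk p) := by
  obtain ⟨U, hpU, hU⟩ := not_not.1 hp
  exact hU p hpU

variable [FiniteDimensional C.functionField D] [Algebra.IsCentral C.functionField D]
  [IsSimpleRing D]

/-- A central simple algebra over the function field of a curve is a matrix algebra. -/
theorem exists_algEquiv_matrix_functionField [IsAlgClosed k] (f : C ⟶ Spec (CommRingCat.of k))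
    [SmoothOfRelativeDimension 1 f] : ∃ N, N ≠ 0 ∧
      Nonempty (D ≃ₐ[C.functionField] Matrix (Fin N) (Fin N) C.functionField) := by
  obtain ⟨_, _⟩ := exists_finiteDimensional_functionField f
  exact exists_algEquiv_matrix (k := k) (F := FractionRing (Polynomial k))

theorem nonempty_ramificationData [IsAlgClosed k] (f : C ⟶ Spec (CommRingCat.of k))
    [SmoothOfRelativeDimension 1 f] {A : OrderIn C D} (hA : A.IsHereditary) {p : C}
    (hp : p ≠ genericPoint C) : Nonempty (A.RamificationData p) := by
  obtain ⟨N, -, ⟨T₀⟩⟩ := exists_algEquiv_matrix_functionField (D := D) f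
  have := isDiscreteValuationRing_stalk f hp
  let T := (T₀.trans Matrix.toLinAlgEquiv').restrictScalars (C.presheaf.stalk p)
  let e := (A.stalk p).equivMapOfInjective
    (T : D →ₐ[C.presheaf.stalk p] Module.End C.functionField (Fin N → C.functionField)) T.injective
  obtain ⟨r, n, hn, ⟨d⟩⟩ := exists_equiv_blockOrder ((A.isLocalOrder_stalk p).map T)
    (projective_submodule_of_ringEquiv e.toRingEquiv (hA p).1)
  exact ⟨⟨r, n, hn, e.trans d⟩⟩

/-- Each of the finitely many matrix units of `D` lies in almost all stalks. -/
theorem exists_finite_azumaya [IsAlgClosed k] (f : C ⟶ Spec (CommRingCat.of k))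
    [SmoothOfRelativeDimension 1 f] [QuasiCompact f] (A : OrderIn C D) :
    ∃ S : Set C, S.Finite ∧ genericPoint C ∉ S ∧
      ∀ p ∉ S, IsAzumaya (C.presheaf.stalk p) (A.stalk p) := by
  obtain ⟨N, hN, ⟨T⟩⟩ := exists_algEquiv_matrix_functionField (D := D) f
  have : Nonempty (Fin N) := ⟨⟨0, Nat.pos_of_ne_zero hN⟩⟩
  have := isLocallyNoetherian_of_smooth f
  refine ⟨⋃ a, ⋃ b, {p | T.symm (Matrix.single a b 1) ∉ A.stalk p},
    Set.finite_iUnion fun a => Set.finite_iUnion fun b => finite_notMem_stalk f A _, ?_,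
    fun p hp => ?_⟩
  · simp only [Set.mem_iUnion, not_exists]
    exact fun a b h => h (A.mem_stalk_genericPoint _)
  · simp only [Set.mem_iUnion, not_exists, Set.mem_ofPred_eq, not_not] at hp
    have := isIntegrallyClosed_stalk f p
    exact isAzumaya_of_matrixUnits T (A.isLocalOrder_stalk p) hp

theorem finite_ramificationLocus [IsAlgClosed k] (f : C ⟶ Spec (CommRingCat.of k))
    [SmoothOfRelativeDimension 1 f] [QuasiCompact f] (A : OrderIn C D) :
    A.ramificationLocus.Finite := by
  obtain ⟨S, hS, hg, h⟩ := exists_finite_azumaya f A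
  exact hS.subset fun p hp => by_contra fun hpS => notMem_ramificationLocus f hS hg h hpS hp

theorem genericPoint_notMem_ramificationLocus [IsAlgClosed k] (f : C ⟶ Spec (CommRingCat.of k))
    [SmoothOfRelativeDimension 1 f] [QuasiCompact f] (A : OrderIn C D) :
    genericPoint C ∉ A.ramificationLocus := by
  obtain ⟨S, hS, hg, h⟩ := exists_finite_azumaya f A
  exact notMem_ramificationLocus f hS hg h hg

/-- With a single block the stalk at `p` is Azumaya. Since the locus is finite, `p` could then be
removed from it, the rest still being closed. -/
theorem one_lt_blockCount [IsAlgClosed k] (f : C ⟶ Spec (CommRingCat.of k))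
    [SmoothOfRelativeDimension 1 f] [QuasiCompact f] {A : OrderIn C D} {p : C}
    (hp : p ∈ A.ramificationLocus) (d : A.RamificationData p) : 1 < d.r := by
  have hgen := genericPoint_notMem_ramificationLocus f A
  have := isDiscreteValuationRing_stalk f (p := p) fun h => hgen (h ▸ hp)
  have h0 : 0 < d.r := blockCount_pos d.equiv
  by_contra hr
  have := isAzumaya_blockOrder (R := C.presheaf.stalk p) d.n_pos (by omega)
  have haz : IsAzumaya (C.presheaf.stalk p) (A.stalk p) :=
    IsAzumaya.of_AlgEquiv _ _ _ d.equiv.symm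
  refine notMem_ramificationLocus f (S := A.ramificationLocus \ {p})
    ((finite_ramificationLocus f A).subset Set.sdiff_subset) (fun h => hgen h.1) (fun q hq => ?_)
    (fun h => h.2 rfl) hp
  by_cases hqp : q = p
  · exact hqp ▸ haz
  · exact isAzumaya_of_notMem_ramificationLocus fun h => hq ⟨h, hqp⟩

/-- Off the ramification locus the stalks are maximal orders. -/
theorem le_stalk_of_notMem_ramificationLocus [IsAlgClosed k] (f : C ⟶ Spec (CommRingCat.of k))
    [SmoothOfRelativeDimension 1 f] [QuasiCompact f] {A : OrderIn C D} (hA : A.IsHereditary) {p : C}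
    (hp : p ∉ A.ramificationLocus) {B : Subalgebra (C.presheaf.stalk p) D} (hB : IsLocalOrder B)
    (hAB : A.stalk p ≤ B) : B ≤ A.stalk p := by
  by_cases hgen : p = genericPoint C
  · subst hgen
    exact fun x _ => A.mem_stalk_genericPoint x
  · have := isDiscreteValuationRing_stalk f hgen
    obtain ⟨d⟩ := nonempty_ramificationData f hA hgen
    have := isAzumaya_of_notMem_ramificationLocus hp
    have := IsAzumaya.of_AlgEquiv _ _ _ d.equiv
    -- An Azumaya stalk has a single block, and then the unique maximal overorder is the stalk
    -- itself.
    have hr : d.r = 1 := eq_one_of_isAzumaya (R := C.presheaf.stalk p) (blockCount_pos d.equiv) d.n_pos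
    obtain ⟨M, -, -, -, hle, -, h1, -⟩ :=
      exists_maximal_overorders C.functionField (A.isLocalOrder_stalk p) d.equiv d.n_pos
    obtain ⟨j, hj⟩ := hle B hB hAB
    exact hj.trans (h1 hr j)

end Curve

theorem finite_and_projective_of_dualBasis {S P : Type*} [Ring S] [AddCommGroup P] [Module S P]
    {ι : Type*} [Fintype ι] (x : ι → P) (φ : ι → P →ₗ[S] S) (h : ∀ p, ∑ i, φ i p • x i = p) :
    Module.Finite S P ∧ Module.Projective S P := by
  let s : (ι → S) →ₗ[S] P := Fintype.linearCombination S x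
  have hs : s ∘ₗ LinearMap.pi φ = LinearMap.id := LinearMap.ext h
  refine ⟨Module.Finite.of_surjective s fun p => ⟨_, LinearMap.congr_fun hs p⟩,
    Module.Projective.of_split (LinearMap.pi φ) s hs⟩

/-! ### Dual bases of overorders -/

section LocalDualBasis

variable {R E : Type*} [CommRing R] [Ring E] [Algebra R E] {A B : Subalgebra R E}

/-- An overorder of an order all of whose left ideals are projective has a dual basis. -/
theorem exists_left_dualBasis [IsDomain R] [Module.IsTorsionFree R E] (hA : IsLocalOrder A)
    (hB : IsLocalOrder B) (hAB : A ≤ B)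
    (hproj : ∀ I : Submodule A A, Module.Projective A I) :
    ∃ (T : Finset E) (y : E → E), (∀ x ∈ T, x ∈ B) ∧ (∀ x, ∀ b ∈ B, b * y x ∈ A) ∧
      ∑ x ∈ T, y x * x = 1 := by
  classical
  let N : Submodule A E :=
    { carrier := B
      add_mem' := B.add_mem
      zero_mem' := B.zero_mem
      smul_mem' := fun a _ hx => B.mul_mem (hAB a.2) hx }
  -- Multiplication by `r` embeds `B` as a left ideal of `A`, so `B` is projective. Each coordinate
  -- function is right multiplication by its value at `1`, and the expansion of `1` gives the dual
  -- basis identity.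
  obtain ⟨r, hr, hrB⟩ := hA.exists_smul_mem hB.1
  let j : N →ₗ[A] A :=
    { toFun x := ⟨r • (x : E), hrB _ x.2⟩
      map_add' x y := Subtype.ext (smul_add r _ _)
      map_smul' a x := Subtype.ext (mul_smul_comm r (a : E) (x : E)).symm }
  have hj : Function.Injective j := fun x y h =>
    Subtype.ext (smul_right_injective E hr (congrArg Subtype.val h))
  have := hproj (LinearMap.range j)
  have : Module.Projective A N := Module.Projective.of_equiv (LinearEquiv.ofInjective j hj).symm
  obtain ⟨s, hs⟩ := Module.Projective.out (R := A) (P := N)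
  let one : N := ⟨1, B.one_mem⟩
  let y (x : E) : E := if hx : x ∈ B then (s one ⟨x, hx⟩ : A) else 0
  refine ⟨(s one).support.map (Function.Embedding.subtype _), y, fun x hx => ?_, fun x b hb => ?_, ?_⟩
  · obtain ⟨z, -, rfl⟩ := Finset.mem_map.1 hx
    exact z.2
  · by_cases hx : x ∈ B
    · simp only [y, dif_pos hx]
      let ι : A →ₗ[A] E := ⟨⟨fun a => (a : E), fun _ _ => rfl⟩, fun _ _ => rfl⟩
      let g : N →ₗ[A] E := ι.comp ((Finsupp.lapply (⟨x, hx⟩ : N)).comp s)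
      have h1 := map_eq_smul_of_isLocalOrder hA g b one ⟨b, hb⟩ (mul_one b).symm
      change ((s ⟨b, hb⟩ ⟨x, hx⟩ : A) : E) = b * (s one ⟨x, hx⟩ : A) at h1
      rw [← h1]
      exact Subtype.property _
    · simp only [y, dif_neg hx, mul_zero]
      exact A.zero_mem
  · rw [Finset.sum_map]
    have h1 := congrArg Subtype.val (hs one)
    rw [Finsupp.linearCombination_apply, Finsupp.sum, AddSubmonoidClass.coe_finsetSum] at h1
    refine Eq.trans (Finset.sum_congr rfl fun z _ => ?_) h1
    change y z * (z : E) = (s one z : A) * (z : E)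
    simp only [y]
    rw [dif_pos (show (z : E) ∈ B from z.2)]

theorem IsLocalOrder.op (hA : IsLocalOrder A) : IsLocalOrder A.op := by
  refine ⟨?_, fun x => ?_⟩
  · have h : Subalgebra.toSubmodule A.op =
        (Subalgebra.toSubmodule A).map (opLinearEquiv R : E ≃ₗ[R] Eᵐᵒᵖ).toLinearMap := by
      ext x
      refine ⟨fun hx => ⟨x.unop, hx, rfl⟩, ?_⟩
      rintro ⟨y, hy, rfl⟩
      exact hy
    rw [h]
    exact hA.1.map _
  · obtain ⟨r, hr, hrx⟩ := hA.2 x.unop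
    exact ⟨r, hr, hrx⟩

/-- The opposite of a subalgebra is a subalgebra of the opposite algebra. -/
def subalgebraOpEquiv (A : Subalgebra R E) : Aᵐᵒᵖ ≃+* A.op where
  toFun a := ⟨MulOpposite.op (a.unop : E), a.unop.2⟩
  invFun a := MulOpposite.op ⟨(a : Eᵐᵒᵖ).unop, a.2⟩
  map_mul' _ _ := rfl
  map_add' _ _ := rfl
  left_inv _ := rfl
  right_inv _ := rfl

theorem projective_submodule_op (h : ∀ I : Submodule Aᵐᵒᵖ A, Module.Projective Aᵐᵒᵖ I)
    (I : Submodule A.op A.op) : Module.Projective A.op I := by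
  let e := subalgebraOpEquiv A
  let _ := RingHomInvPair.of_ringEquiv e
  let _ := RingHomInvPair.symm (e : Aᵐᵒᵖ →+* A.op) (e.symm : A.op →+* Aᵐᵒᵖ)
  let J : Submodule Aᵐᵒᵖ A :=
    { carrier := {a | e (MulOpposite.op a) ∈ I}
      add_mem' := fun ha hb => I.add_mem ha hb
      zero_mem' := I.zero_mem
      smul_mem' := fun c a ha => I.smul_mem (e c) ha }
  have := h J
  let φ : J ≃ₛₗ[(e : Aᵐᵒᵖ →+* A.op)] I :=
    { toFun x := ⟨e (MulOpposite.op x), x.2⟩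
      invFun y := ⟨(e.symm y).unop, y.2⟩
      map_add' x y := rfl
      map_smul' c x := rfl
      left_inv x := rfl
      right_inv y := rfl }
  exact Module.Projective.of_equiv φ

theorem exists_right_dualBasis [IsDomain R] [Module.IsTorsionFree R E] (hA : IsLocalOrder A)
    (hB : IsLocalOrder B) (hAB : A ≤ B)
    (hproj : ∀ I : Submodule Aᵐᵒᵖ A, Module.Projective Aᵐᵒᵖ I) :
    ∃ (T : Finset E) (y : E → E), (∀ x ∈ T, x ∈ B) ∧ (∀ x, ∀ b ∈ B, y x * b ∈ A) ∧
      ∑ x ∈ T, x * y x = 1 := by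
  have : Module.IsTorsionFree R Eᵐᵒᵖ :=
    (opLinearEquiv R : E ≃ₗ[R] Eᵐᵒᵖ).symm.injective.moduleIsTorsionFree _ (map_smul _)
  obtain ⟨T, y, hT, hy, h1⟩ := exists_left_dualBasis hA.op hB.op (Subalgebra.op_le_op_iff.2 hAB)
    (projective_submodule_op hproj)
  refine ⟨T.map opEquiv.symm.toEmbedding, fun x => (y (MulOpposite.op x)).unop, fun x hx => ?_,
    fun x b hb => hy _ (MulOpposite.op b) hb, ?_⟩
  · obtain ⟨z, hz, rfl⟩ := Finset.mem_map.1 hx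
    exact hT z hz
  · rw [Finset.sum_map]
    have h2 := congrArg MulOpposite.unop h1
    rw [Finset.unop_sum] at h2
    exact h2

end LocalDualBasis

/-! ### Local projectivity of overorders -/

section LocallyProjective

variable {X : Scheme.{u}} [IsIntegral X] {D : Type v} [Ring D] [Algebra X.functionField D]
  {A B : OrderIn X D}

theorem isOpen_setOf_mem_stalk (A : OrderIn X D) (x : D) : IsOpen {p | x ∈ A.stalk p} := by
  rw [isOpen_iff_forall_mem_open]
  rintro p ⟨U, hU, hp, hx⟩
  exact ⟨U, fun q hq => ⟨U, hU, hq, hx⟩, U.isOpen, hp⟩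

/-- Finitely many conditions on the stalk at `p` hold on an affine neighbourhood. -/
theorem exists_affine_nhd (p : X) (T : Finset D) (hT : ∀ x ∈ T, x ∈ B.stalk p)
    (Φ : D → D →+ D) (hΦ : ∀ q x, ∀ (c : X.presheaf.stalk q) b, Φ x (c • b) = c • Φ x b)
    (hy : ∀ x, ∀ b ∈ B.stalk p, Φ x b ∈ A.stalk p) :
    ∃ (U : X.Opens) (_ : Nonempty U), p ∈ U ∧ IsAffineOpen U ∧ (∀ x ∈ T, x ∈ B.sections U) ∧
      ∀ x ∈ T, ∀ b ∈ B.sections U, Φ x b ∈ A.sections U := by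
  obtain ⟨U₀, hU₀, hp₀, -⟩ := exists_isAffineOpen_mem_and_subset (x := p) (U := ⊤) trivial
  have : Nonempty U₀ := ⟨⟨p, hp₀⟩⟩
  obtain ⟨G, hG⟩ := B.finite U₀ hU₀
  have hGp (q : X) (hq : q ∈ U₀) := B.stalk_eq_span hU₀ hq hG
  -- It is enough to test `Φ x` on the finitely many generators `G` of `B`, which generate all
  -- stalks over `U₀`.
  let W : X.Opens := ⟨(U₀ : Set X) ∩ ((⋂ x ∈ T, {q | x ∈ B.stalk q}) ∩
      ⋂ x ∈ T, ⋂ b ∈ G, {q | Φ x b ∈ A.stalk q}),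
    U₀.isOpen.inter ((isOpen_biInter_finset fun x _ => isOpen_setOf_mem_stalk B x).inter
      (isOpen_biInter_finset fun x _ => isOpen_biInter_finset fun b _ =>
        isOpen_setOf_mem_stalk A _))⟩
  have hpW : p ∈ W := by
    refine ⟨hp₀, Set.mem_iInter₂.2 hT, Set.mem_iInter₂.2 fun x _ => Set.mem_iInter₂.2 fun b hb => ?_⟩
    refine hy x b ?_
    have := Submodule.subset_span (R := X.presheaf.stalk p) (Finset.mem_coe.2 hb)
    rwa [hGp p hp₀] at this
  obtain ⟨U, hU, hpU, hUW⟩ := exists_isAffineOpen_mem_and_subset hpW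
  have hUne : Nonempty U := ⟨⟨p, hpU⟩⟩
  refine ⟨U, hUne, hpU, hU, fun x hx => ?_, fun x hx b hb => ?_⟩
  · exact B.mem_sections_iff.2 fun q hq => Set.mem_iInter₂.1 (hUW hq).2.1 x hx
  · refine A.mem_sections_iff.2 fun q hq => ?_
    have hbq : b ∈ Submodule.span (X.presheaf.stalk q) (G : Set D) := by
      rw [hGp q (hUW hq).1]
      exact B.mem_sections_iff.1 hb q hq
    clear hb
    induction hbq using Submodule.span_induction with
    | mem b hb => exact Set.mem_iInter₂.1 (Set.mem_iInter₂.1 (hUW hq).2.2 x hx) b hb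
    | zero =>
      rw [map_zero]
      exact zero_mem _
    | add b c _ _ hb hc =>
      rw [map_add]
      exact add_mem hb hc
    | smul a b _ hb =>
      rw [hΦ]
      exact (A.stalk q).smul_mem hb a

theorem isTorsionFree_stalk (p : X) : Module.IsTorsionFree (X.presheaf.stalk p) D :=
  Module.IsTorsionFree.trans_faithfulSMul _ X.functionField D

/-- Every overorder of a hereditary order is locally projective as a left module. -/
theorem isLeftLocallyProjective (hA : A.IsHereditary) (h : A ≤ B) :
    OrderIn.IsLeftLocallyProjective h := by
  intro p
  have := isTorsionFree_stalk (D := D) p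
  obtain ⟨T, y, hT, hy, h1⟩ := exists_left_dualBasis (A.isLocalOrder_stalk p)
    (B.isLocalOrder_stalk p) (OrderIn.stalk_mono h p) (hA p).1
  obtain ⟨U, hUne, hpU, hU, hTU, hyU⟩ := exists_affine_nhd p T hT
    (fun x => AddMonoidHom.mulRight (y x)) (fun _ _ _ _ => smul_mul_assoc _ _ _) hy
  refine ⟨U, hUne, hpU, hU, ?_⟩
  let _ := leftModule (OrderIn.sectionsHom h U)
  -- The identity `∑ y x * x = 1` holds in `D`, so it yields a dual basis over any open set on which
  -- the elements `x` and the maps `b ↦ b * y x` are defined.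
  refine finite_and_projective_of_dualBasis (ι := T) (fun x => ⟨x, hTU x x.2⟩)
    (fun x => { toFun := fun b => ⟨b * y x, hyU x x.2 b b.2⟩
                map_add' := fun b c => Subtype.ext (add_mul _ _ _)
                map_smul' := fun a b => Subtype.ext (mul_assoc _ _ _) }) fun b => ?_
  refine Subtype.ext ?_
  rw [AddSubmonoidClass.coe_finsetSum]
  change ∑ x : T, (b : D) * y x * x = b
  simp only [mul_assoc]
  rw [← Finset.mul_sum, Finset.sum_coe_sort T fun x => y x * x, h1, mul_one]

/-- Every overorder of a hereditary order is locally projective as a right module. -/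
theorem isRightLocallyProjective (hA : A.IsHereditary) (h : A ≤ B) :
    OrderIn.IsRightLocallyProjective h := by
  intro p
  have := isTorsionFree_stalk (D := D) p
  obtain ⟨T, y, hT, hy, h1⟩ := exists_right_dualBasis (A.isLocalOrder_stalk p)
    (B.isLocalOrder_stalk p) (OrderIn.stalk_mono h p) (hA p).2
  obtain ⟨U, hUne, hpU, hU, hTU, hyU⟩ := exists_affine_nhd p T hT
    (fun x => AddMonoidHom.mulLeft (y x)) (fun _ _ _ _ => mul_smul_comm _ _ _) hy
  refine ⟨U, hUne, hpU, hU, ?_⟩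
  let _ := rightModule (OrderIn.sectionsHom h U)
  refine finite_and_projective_of_dualBasis (ι := T) (fun x => ⟨x, hTU x x.2⟩)
    (fun x => { toFun := fun b => op ⟨y x * b, hyU x x.2 b b.2⟩
                map_add' := fun b c => unop_injective (Subtype.ext (mul_add _ _ _))
                map_smul' := fun a b => unop_injective (Subtype.ext (mul_assoc _ _ _).symm) })
    fun b => ?_
  refine Subtype.ext ?_
  rw [AddSubmonoidClass.coe_finsetSum]
  change ∑ x : T, (x : D) * (y x * b) = b
  simp only [← mul_assoc]
  rw [← Finset.sum_mul, Finset.sum_coe_sort T fun x => x * y x, h1, one_mul]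

end LocallyProjective

/-! ### From local to global maximal overorders -/

/-- The maximal overorders are parametrized by the choice of a block at each ramified point, and
the choice determines their types. -/
theorem exists_parametrization {k : Type u} [Field k] [IsAlgClosed k] {C : Scheme.{u}}
    [IsIntegral C] (f : C ⟶ Spec (CommRingCat.of k)) [SmoothOfRelativeDimension 1 f]
    [QuasiCompact f] {D : Type v} [Ring D] [Algebra C.functionField D]
    [FiniteDimensional C.functionField D] [Algebra.IsCentral C.functionField D] [IsSimpleRing D]
    {A : OrderIn C D} (hA : A.IsHereditary)
    (d : ∀ p : A.ramificationLocus, A.RamificationData p) :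
    ∃ (B : (∀ p, Fin (d p).r) → OrderIn C D) (σ : ∀ p, Equiv.Perm (Fin (d p).r)),
      Function.Injective B ∧ Set.range B = A.maximalOverorders ∧
      ∀ c (h : A ≤ B c) p i, ((d p).IsPurelyOfType h i ↔ i = σ p (c p)) ∧
        ((d p).IsLeftPurelyOfType h i ↔ i = c p) := by
  classical
  have hdvr (p : A.ramificationLocus) : IsDiscreteValuationRing (C.presheaf.stalk (p : C)) :=
    isDiscreteValuationRing_stalk f fun h => genericPoint_notMem_ramificationLocus f A (h ▸ p.2)
  choose M σ hAM hM hle hinj _ htype using fun p : A.ramificationLocus =>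
    haveI := hdvr p
    exists_maximal_overorders C.functionField (A.isLocalOrder_stalk p) (d p).equiv (d p).n_pos
  let M' (c : ∀ p, Fin (d p).r) (p : C) : Subalgebra (C.presheaf.stalk p) D :=
    if hp : p ∈ A.ramificationLocus then M ⟨p, hp⟩ (c ⟨p, hp⟩) else A.stalk p
  have hM' (c) (p : A.ramificationLocus) : M' c p = M p (c p) := dif_pos p.2
  have hM'A (c) {p : C} (hp : p ∉ A.ramificationLocus) : M' c p = A.stalk p := dif_neg hp
  have hex (c) : ∃ B : OrderIn C D, ∀ p, B.stalk p = M' c p := by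
    refine exists_stalk_eq A (M' c) f (fun p => ?_) (fun p => ?_)
      ((finite_ramificationLocus f A).subset fun p hp => ?_)
    · by_cases hp : p ∈ A.ramificationLocus
      · exact (hAM ⟨p, hp⟩ _).trans (hM' c ⟨p, hp⟩).ge
      · exact (hM'A c hp).ge
    · by_cases hp : p ∈ A.ramificationLocus
      · exact (hM' c ⟨p, hp⟩) ▸ hM ⟨p, hp⟩ _
      · exact (hM'A c hp) ▸ A.isLocalOrder_stalk p
    · by_contra hpA
      exact hp (hM'A c hpA)
  choose B hB using hex
  have hBp (c) (p : A.ramificationLocus) : (B c).stalk p = M p (c p) := (hB c p).trans (hM' c p)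
  have hBA (c) {p : C} (hp : p ∉ A.ramificationLocus) : (B c).stalk p = A.stalk p :=
    (hB c p).trans (hM'A c hp)
  have hAB (c) : A ≤ B c := by
    refine OrderIn.le_iff_stalk_le.2 fun p => ?_
    by_cases hp : p ∈ A.ramificationLocus
    · exact (hAM ⟨p, hp⟩ _).trans (hBp c ⟨p, hp⟩).ge
    · exact (hBA c hp).ge
  -- Every overorder lies below some `B c`. As these are pairwise incomparable, they are precisely
  -- the maximal ones.
  have hup (B' : OrderIn C D) (h : A ≤ B') : ∃ c, B' ≤ B c := by
    choose c hc using fun p : A.ramificationLocus =>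
      hle p (B'.stalk p) (B'.isLocalOrder_stalk p) (OrderIn.stalk_mono h p)
    refine ⟨c, OrderIn.le_iff_stalk_le.2 fun p => ?_⟩
    by_cases hp : p ∈ A.ramificationLocus
    · exact (hc ⟨p, hp⟩).trans (hBp c ⟨p, hp⟩).ge
    · rw [hBA c hp]
      exact le_stalk_of_notMem_ramificationLocus f hA hp (B'.isLocalOrder_stalk p)
        (OrderIn.stalk_mono h p)
  have hBinj (c c') (h : B c ≤ B c') : c = c' := by
    funext p
    refine hinj p _ _ ?_
    rw [← hBp c p, ← hBp c' p]
    exact OrderIn.stalk_mono h p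
  refine ⟨B, σ, fun c c' h => hBinj c c' h.le, ?_, fun c h p i => ?_⟩
  · refine Set.Subset.antisymm ?_ fun B' hB' => ?_
    · rintro _ ⟨c, rfl⟩
      refine ⟨hAB c, fun B' hB' => le_antisymm ?_ hB'⟩
      obtain ⟨c', hc'⟩ := hup B' ((hAB c).trans hB')
      rw [← hBinj c c' (hB'.trans hc')] at hc'
      exact hc'
    · obtain ⟨c, hc⟩ := hup B' hB'.1
      exact ⟨c, hB'.2 _ hc⟩
  · exact htype p (c p) ((B c).stalk p) (OrderIn.stalk_mono h p) (hBp c p) i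

end HereditaryOrder

open AlgebraicGeometry HereditaryOrder OrderIn in
theorem mainTheorem6 {k : Type u} [Field k] [IsAlgClosed k] [CharZero k]
    (C : Scheme.{u}) [IsIntegral C] (f : C ⟶ Spec (CommRingCat.of k))
    [SmoothOfRelativeDimension 1 f] [IsSeparated f] [QuasiCompact f]
    (D : Type v) [Ring D] [Algebra C.functionField D] [FiniteDimensional C.functionField D]
    [Algebra.IsCentral C.functionField D] [IsSimpleRing D]
    (A : OrderIn C D) (hA : A.IsHereditary) :
    A.ramificationLocus.Finite ∧
    (∀ p ∈ A.ramificationLocus, Nonempty (A.RamificationData p)) ∧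
    ∀ d : ∀ p : A.ramificationLocus, A.RamificationData p,
      (∀ p, 1 < (d p).r) ∧
      A.maximalOverorders.encard = ((∏ᶠ p, (d p).r : ℕ) : ℕ∞) ∧
      (∀ B ∈ A.maximalOverorders, ∀ h : A ≤ B,
        IsLeftLocallyProjective h ∧ IsRightLocallyProjective h) ∧
      (∀ B ∈ A.maximalOverorders, ∀ h : A ≤ B, ∀ p,
        (∃! j, (d p).IsPurelyOfType h j) ∧ ∃! j, (d p).IsLeftPurelyOfType h j) ∧
      ∀ B ∈ A.maximalOverorders, ∀ B' ∈ A.maximalOverorders, ∀ (h : A ≤ B) (h' : A ≤ B'),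
        (∀ p, ∃ j, (d p).IsPurelyOfType h j ∧ (d p).IsPurelyOfType h' j) → B = B' := by
  classical
  have hgen := genericPoint_notMem_ramificationLocus f A
  refine ⟨finite_ramificationLocus f A,
    fun p hp => nonempty_ramificationData f hA fun h => hgen (h ▸ hp), fun d => ?_⟩
  obtain ⟨B, σ, hinj, hrange, htype⟩ := exists_parametrization f hA d
  refine ⟨fun p => one_lt_blockCount f p.2 (d p), ?_,
    fun B _ h => ⟨isLeftLocallyProjective hA h, isRightLocallyProjective hA h⟩, ?_, ?_⟩
  · have := (finite_ramificationLocus f A).fintype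
    rw [← hrange, ← Set.image_univ, hinj.encard_image, Set.encard_univ,
      ENat.card_eq_coe_fintype_card, Fintype.card_pi,
      finprod_eq_prod_of_fintype]
    simp
  · intro B' hB' h p
    obtain ⟨c, rfl⟩ := hrange.ge hB'
    exact ⟨⟨_, (htype c h p _).1.2 rfl, fun i hi => (htype c h p i).1.1 hi⟩,
      ⟨_, (htype c h p _).2.2 rfl, fun i hi => (htype c h p i).2.1 hi⟩⟩
  · intro B₁ hB₁ B₂ hB₂ h₁ h₂ h
    obtain ⟨c₁, rfl⟩ := hrange.ge hB₁
    obtain ⟨c₂, rfl⟩ := hrange.ge hB₂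
    congr 1
    funext p
    obtain ⟨j, hj₁, hj₂⟩ := h p
    -- The right type at `p` is a permutation of the parameter, so it determines the chosen block.
    exact (σ p).injective (((htype c₁ h₁ p j).1.1 hj₁).symm.trans ((htype c₂ h₂ p j).1.1 hj₂))
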